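/- **Notation.** Let $q\in\mathbb{C}$ with $0<|q|<1$. For $x\neq 0$ put $(x;q)_\infty=\prod_{i\ge 0}(1-q^ix)$, $j(x;q)=(x;q)_\infty(q/x;q)_\infty(q;q)_\infty$, $J_m=\prod_{i\ge1}(1-q^{mi})$, $$m(x,q,z)=\frac{1}{j(z;q)}\sum_{r\in\mathbb{Z}}\frac{(-1)^rq^{\binom r2}z^r}{1-q^{r-1}xz},$$ and $\mathrm{sg}(r)=1$ for $r\ge 0$, $\mathrm{sg}(r)=-1$ for $r<0$ ($r\in\mathbb{Z}$). Let $$\begin{aligned}G(x,y,z;q)={}&z\,\frac{J_4^3\,j(q^2y^2z^2;q^4)}{j(q^2y^2;q^4)\,j(z^2;q^4)}\,m\Big(-\frac{qx}{yz},q^2,-qyz\Big)+z\,\frac{J_4^3\,j(q^2x^2z^2;q^4)}{j(q^2x^2;q^4)\,j(z^2;q^4)}\,m\Big(-\frac{qy}{xz},q^2,-qxz\Big)\\&-z\,\frac{J_1^3J_2^3}{j(x;q)j(y;q)j(z;q)}\cdot\frac{j(xy;q^2)\,j(qxz;q^2)\,j(qyz;q^2)}{j(-xq;q^2)\,j(-yq;q^2)\,j(-z;q^2)}\\&-\frac{q}{xy}\,\frac{J_4^3\,j(x^2y^2;q^4)}{j(q^2x^2;q^4)\,j(q^2y^2;q^4)}\,m\Big(-\frac{qz}{xy},q^2,-xy\Big)\end{aligned}$$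 and $$F(x,y,z;q)=z\sum_{\mathrm{sg}(s)=\mathrm{sg}(t)}\mathrm{sg}(s)\frac{q^{4st+2s}y^{2s}z^{2t}}{1-x^2q^{4s+4t+2}}+xyq\sum_{\mathrm{sg}(s)=\mathrm{sg}(t)}\mathrm{sg}(s)\frac{q^{4st+2s+4t}y^{2s}z^{2t}}{1-x^2q^{4s+4t+2}}.$$ Call $(x,y,z)$ *regular* if for all $n\in\mathbb{Z}$: $x\ne q^{2n}$, $yz\neq -q^{2n+1}$, $xz\ne -q^{2n+1}$, $xy\neq -q^{2n}$. (Regular triples are dense.) **Theorem 3.** Let $y,z\in\mathbb{C}$ with $|q|<|y|<1$ and $|q|<|z|<1$. (a) If $|q|<|x|<1$, then the following triple series converges absolutely, and $$\sum_{\substack{\mathrm{sg}(r)=\mathrm{sg}(s)=\mathrm{sg}(t)\\ r\equiv s\not\equiv t\ (\mathrm{mod}\ 2)}}q^{rs+rt+st}x^ry^sz^t=G(x,y,z;q)$$ whenever $yz\ne -q$ and $xz\neq -q$. If $yz=-q$ or $xz=-q$, the identity holds with the right-hand side replaced by the limit of $G(x',y',z';q)$ as $(x',y',z')\to(x,y,z)$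 through regular triples. (b) More strongly, if $x\ne0$ and $x\neq\pm q^{2n+1}$ for all $n\in\mathbb{Z}$, then both double series in $F(x,y,z;q)$ converge absolutely, and $F(x,y,z;q)=G(x,y,z;q)$ whenever $(x,y,z)$ is regular. If $(x,y,z)$ is not regular, this holds with the right-hand side replaced by the limit of $G$ at $(x,y,z)$ through regular triples. -/

import Mathlib

open Filter Topology

noncomputable section

namespace KroneckerTriple

/-- The infinite `q`-shifted factorial `(x; q)_∞ = ∏_{i ≥ 0} (1 - q^i x)`. -/
def qPoch (x q : ℂ) : ℂ := ∏' i : ℕ, (1 - q ^ i * x)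

/-- The theta function `j(x; q) = (x; q)_∞ (q/x; q)_∞ (q; q)_∞`. -/
def theta (x q : ℂ) : ℂ := qPoch x q * qPoch (q / x) q * qPoch q q

/-- `J_m = ∏_{i ≥ 1} (1 - q^{m i}) = (q^m; q^m)_∞`. -/
def J (q : ℂ) (m : ℕ) : ℂ := qPoch (q ^ m) (q ^ m)

/-- The Appell–Lerch function
`m(x, q, z) = (1 / j(z; q)) ∑_{r ∈ ℤ} (-1)^r q^{r(r-1)/2} z^r / (1 - q^{r-1} x z)`.
The integer division by `2` is exact. -/
def appellLerch (x q z : ℂ) : ℂ :=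
  1 / theta z q *
    ∑' r : ℤ, (-1) ^ r * q ^ (r * (r - 1) / 2) * z ^ r / (1 - q ^ (r - 1) * x * z)

/-- `sg(r) = 1` for `r ≥ 0` and `sg(r) = -1` for `r < 0`. -/
def sg (r : ℤ) : ℤ := if 0 ≤ r then 1 else -1

/-- The triples `(r, s, t)` with `sg(r) = sg(s) = sg(t)` and `r ≡ s ≢ t (mod 2)`. -/
def tripleIndex : Set (ℤ × ℤ × ℤ) :=
  {p | sg p.1 = sg p.2.1 ∧ sg p.2.1 = sg p.2.2 ∧
    p.1 ≡ p.2.1 [ZMOD 2] ∧ ¬ p.2.1 ≡ p.2.2 [ZMOD 2]}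

/-- The summand `q^{rs+rt+st} x^r y^s z^t`. -/
def tripleTerm (q x y z : ℂ) (p : ℤ × ℤ × ℤ) : ℂ :=
  q ^ (p.1 * p.2.1 + p.1 * p.2.2 + p.2.1 * p.2.2) * x ^ p.1 * y ^ p.2.1 * z ^ p.2.2

/-- The triple sum over `tripleIndex`. -/
def tripleSum (q x y z : ℂ) : ℂ := ∑' p : tripleIndex, tripleTerm q x y z p

/-- The pairs `(s, t)` with `sg(s) = sg(t)`. -/
def pairIndex : Set (ℤ × ℤ) := {p | sg p.1 = sg p.2}

/-- The summand `sg(s) q^{4st+2s} y^{2s} z^{2t} / (1 - x² q^{4s+4t+2})`. -/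
def pairTerm₁ (q x y z : ℂ) (p : ℤ × ℤ) : ℂ :=
  (sg p.1 : ℂ) * (q ^ (4 * p.1 * p.2 + 2 * p.1) * y ^ (2 * p.1) * z ^ (2 * p.2) /
    (1 - x ^ 2 * q ^ (4 * p.1 + 4 * p.2 + 2)))

/-- The summand `sg(s) q^{4st+2s+4t} y^{2s} z^{2t} / (1 - x² q^{4s+4t+2})`. -/
def pairTerm₂ (q x y z : ℂ) (p : ℤ × ℤ) : ℂ :=
  (sg p.1 : ℂ) * (q ^ (4 * p.1 * p.2 + 2 * p.1 + 4 * p.2) * y ^ (2 * p.1) * z ^ (2 * p.2) /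
    (1 - x ^ 2 * q ^ (4 * p.1 + 4 * p.2 + 2)))

/-- The double-sum function `F(x, y, z; q)`. -/
def F (q x y z : ℂ) : ℂ :=
  z * ∑' p : pairIndex, pairTerm₁ q x y z p + x * y * q * ∑' p : pairIndex, pairTerm₂ q x y z p

/-- The combination `G(x, y, z; q)` of three Appell–Lerch terms and a theta quotient. -/
def G (q x y z : ℂ) : ℂ :=
  z * (J q 4 ^ 3 * theta (q ^ 2 * y ^ 2 * z ^ 2) (q ^ 4) /
      (theta (q ^ 2 * y ^ 2) (q ^ 4) * theta (z ^ 2) (q ^ 4))) *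
      appellLerch (-(q * x / (y * z))) (q ^ 2) (-(q * y * z))
  + z * (J q 4 ^ 3 * theta (q ^ 2 * x ^ 2 * z ^ 2) (q ^ 4) /
      (theta (q ^ 2 * x ^ 2) (q ^ 4) * theta (z ^ 2) (q ^ 4))) *
      appellLerch (-(q * y / (x * z))) (q ^ 2) (-(q * x * z))
  - z * (J q 1 ^ 3 * J q 2 ^ 3 / (theta x q * theta y q * theta z q)) *
      (theta (x * y) (q ^ 2) * theta (q * x * z) (q ^ 2) * theta (q * y * z) (q ^ 2) /
        (theta (-(x * q)) (q ^ 2) * theta (-(y * q)) (q ^ 2) * theta (-z) (q ^ 2)))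
  - q / (x * y) * (J q 4 ^ 3 * theta (x ^ 2 * y ^ 2) (q ^ 4) /
      (theta (q ^ 2 * x ^ 2) (q ^ 4) * theta (q ^ 2 * y ^ 2) (q ^ 4))) *
      appellLerch (-(q * z / (x * y))) (q ^ 2) (-(x * y))

/-- The triples `(x, y, z)` that avoid the removable singularities of the expression `G`:
`x = q^{2n}` (a zero of `j(x; q)` and a pole of the first Appell–Lerch series), and the zeros
`yz = -q^{2n+1}`, `xz = -q^{2n+1}`, `xy = -q^{2n}` of the theta functions by which the three
Appell–Lerch functions are divided. -/
def regularSet (q : ℂ) : Set (ℂ × ℂ × ℂ) :=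
  {p | ∀ n : ℤ, p.1 ≠ q ^ (2 * n) ∧ p.2.1 * p.2.2 ≠ -q ^ (2 * n + 1) ∧
    p.1 * p.2.2 ≠ -q ^ (2 * n + 1) ∧ p.1 * p.2.1 ≠ -q ^ (2 * n)}

/-- `regularSet q` is dense, so limits along it are meaningful at every point. -/
theorem dense_regularSet (q : ℂ) : Dense (regularSet q) := by
  have key : ∀ (S : Set ℂ), S.Countable → ∀ (a : ℂ) (ε : ℝ), 0 < ε → ∃ b, dist a b < ε ∧ b ∉ S := by
    intro S hS a ε hε
    obtain ⟨b, hb, h⟩ := (hS.dense_compl ℂ).exists_dist_lt a hε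
    exact ⟨b, h, hb⟩
  rw [Metric.dense_iff]
  rintro ⟨x, y, z⟩ ε hε
  obtain ⟨x', hx, hx'⟩ := key ({0} ∪ Set.range fun n : ℤ => q ^ (2 * n))
    ((Set.countable_singleton 0).union (Set.countable_range _)) x ε hε
  obtain ⟨y', hy, hy'⟩ := key ({0} ∪ Set.range fun n : ℤ => -q ^ (2 * n) / x')
    ((Set.countable_singleton 0).union (Set.countable_range _)) y ε hε
  obtain ⟨z', hz, hz'⟩ := key ((Set.range fun n : ℤ => -q ^ (2 * n + 1) / x') ∪
      Set.range fun n : ℤ => -q ^ (2 * n + 1) / y')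
    ((Set.countable_range _).union (Set.countable_range _)) z ε hε
  simp only [Set.mem_union, Set.mem_singleton_iff, Set.mem_range, not_or, not_exists] at hx' hy' hz'
  refine ⟨(x', y', z'), ?_, fun n => ⟨fun h => hx'.2 n h.symm, fun h => hz'.2 n ?_,
    fun h => hz'.1 n ?_, fun h => hy'.2 n ?_⟩⟩
  · simp only [Metric.mem_ball, Prod.dist_eq, max_lt_iff]
    exact ⟨by rwa [dist_comm], by rwa [dist_comm], by rwa [dist_comm]⟩
  · rw [← h]; exact mul_div_cancel_left₀ _ hy'.1
  · rw [← h]; exact mul_div_cancel_left₀ _ hx'.1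
  · rw [← h]; exact mul_div_cancel_left₀ _ hx'.1

end KroneckerTriple

end

/-!
Summing the geometric series over `r`, separately for the two parity classes of the index triples,
turns the triple sum into `F`, so everything reduces to `F = G` as functions of `x`.

Work in the base `Q = q²` with `b = z / q`. Under `x ↦ Q x` the double series in `F` reproduce
themselves up to a factor linear in `x` and inhomogeneous terms, which are bilateral series
`∑ uⁿ / (1 - Qⁿ v)`; Kronecker's identity evaluates these as theta quotients. The Appell–Lerch sums
in `G` obey a functional equation of the same kind with the same inhomogeneous terms, so the
difference `D` of the two sides satisfies `D(Q x) = c x D(x)`.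

The only possible poles of `D` are simple, up to powers of `Q` at `x = 1` and `x = ±q`. There `F` is
analytic, because `sg(s) = sg(t)` excludes `s + t = -1`, and the residues of `G` cancel: at `x = ±q`
this is an identity between two Lerch sums. So `D` is analytic on the punctured plane. Multiplied by
a theta function in `x`, it gets a constant multiplier that is not a power of `Q`. Then a power of
`x` times this product is bounded near `0`, hence entire, and all its Taylor coefficients vanish.
The limits at irregular triples are then limits of `F`, which is continuous.
-/

noncomputable section

namespace KroneckerTriple

section Pochhammer

variable {q : ℂ}

theorem summable_norm_pow_mul (hq : ‖q‖ < 1) (x : ℂ) : Summable fun i : ℕ => ‖-(q ^ i * x)‖ := by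
  simp only [norm_neg, norm_mul, norm_pow]
  exact (summable_geometric_of_lt_one (norm_nonneg _) hq).mul_right _

theorem multipliable_qPoch (hq : ‖q‖ < 1) (x : ℂ) : Multipliable fun i : ℕ => 1 - q ^ i * x := by
  simpa only [sub_eq_add_neg] using multipliable_one_add_of_summable (summable_norm_pow_mul hq x)

theorem qPoch_eq_one_sub_mul (hq : ‖q‖ < 1) (x : ℂ) :
    qPoch x q = (1 - x) * qPoch (q * x) q := by
  have h := tprod_eq_zero_mul' (f := fun i : ℕ => 1 - q ^ i * x)
    (by simpa only [pow_succ, mul_assoc] using multipliable_qPoch hq (q * x))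
  simp only [qPoch, h, pow_succ, pow_zero, one_mul, mul_assoc]

theorem qPoch_ne_zero (hq : ‖q‖ < 1) {x : ℂ} (hx : ∀ i : ℕ, q ^ i * x ≠ 1) : qPoch x q ≠ 0 := by
  have := tprod_one_add_ne_zero_of_summable (f := fun i : ℕ => -(q ^ i * x))
    (fun i h => hx i (by linear_combination -h)) (summable_norm_pow_mul hq x)
  simpa only [qPoch, sub_eq_add_neg] using this

theorem qPoch_self_ne_zero (hq : ‖q‖ < 1) : qPoch q q ≠ 0 := by
  refine qPoch_ne_zero hq fun i h => ?_
  have hlt : ‖q ^ (i + 1)‖ < 1 := by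
    rw [norm_pow]; exact pow_lt_one₀ (norm_nonneg _) hq i.succ_ne_zero
  rw [pow_succ, h, norm_one] at hlt
  exact lt_irrefl _ hlt

theorem differentiable_qPoch (hq : ‖q‖ < 1) : Differentiable ℂ fun x => qPoch x q := by
  intro x₀
  have hU : IsOpen (Metric.ball (0 : ℂ) (‖x₀‖ + 1)) := Metric.isOpen_ball
  have hprod := Summable.hasProdLocallyUniformlyOn_one_add
    (f := fun (i : ℕ) (x : ℂ) => -(q ^ i * x)) hU
    ((summable_geometric_of_lt_one (norm_nonneg _) hq).mul_right (‖x₀‖ + 1))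
    (Eventually.of_forall fun i x hx => by
      rw [norm_neg, norm_mul, norm_pow]
      have : ‖x‖ ≤ ‖x₀‖ + 1 := (mem_ball_zero_iff.1 hx).le
      gcongr) (fun i => by fun_prop)
  rw [hasProdLocallyUniformlyOn_iff_tendstoLocallyUniformlyOn] at hprod
  have hdiff := hprod.differentiableOn (Eventually.of_forall fun s => by fun_prop) hU
  simpa only [qPoch, sub_eq_add_neg] using hdiff.differentiableAt (hU.mem_nhds (by simp))

theorem analyticAt_qPoch (hq : ‖q‖ < 1) (x : ℂ) : AnalyticAt ℂ (fun x => qPoch x q) x :=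
  (differentiable_qPoch hq).analyticAt x

theorem qPoch_sq (hq : ‖q‖ < 1) (x : ℂ) :
    qPoch (x ^ 2) (q ^ 2) = qPoch x q * qPoch (-x) q := by
  rw [qPoch, qPoch, qPoch, ← (multipliable_qPoch hq x).tprod_mul (multipliable_qPoch hq (-x))]
  exact tprod_congr fun i => by ring

theorem norm_pow_lt_one (hq : ‖q‖ < 1) {k : ℕ} (hk : k ≠ 0) : ‖q ^ k‖ < 1 := by
  rw [norm_pow]; exact pow_lt_one₀ (norm_nonneg _) hq hk

theorem qPoch_eq_prod_pow (hq : ‖q‖ < 1) (x : ℂ) (k : ℕ) [NeZero k] :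
    qPoch x q = ∏ j : Fin k, qPoch (q ^ (j : ℕ) * x) (q ^ k) := by
  have hprod : HasProd (fun p : Fin k × ℕ => 1 - (q ^ k) ^ p.2 * (q ^ (p.1 : ℕ) * x))
      (qPoch x q) := by
    have h : HasProd (fun i => 1 - q ^ i * x) (qPoch x q) := (multipliable_qPoch hq x).hasProd
    convert ((Equiv.prodComm (Fin k) ℕ).trans (Nat.divModEquiv k).symm).hasProd_iff.2 h
      using 2 with p
    simp only [Function.comp_apply, Equiv.trans_apply, Equiv.prodComm_apply, Prod.swap,
      Nat.divModEquiv_symm_apply]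
    ring
  have hfib := hprod.prod_fiberwise fun j =>
    (multipliable_qPoch (norm_pow_lt_one hq (NeZero.ne k)) (q ^ (j : ℕ) * x)).hasProd
  exact hfib.unique (hasProd_fintype _)

end Pochhammer

section Theta

variable {q : ℂ}

theorem theta_mul_left (hq0 : q ≠ 0) (hq : ‖q‖ < 1) {x : ℂ} (hx : x ≠ 0) :
    theta (q * x) q = -x⁻¹ * theta x q := by
  rw [theta, theta, qPoch_eq_one_sub_mul hq x, qPoch_eq_one_sub_mul hq (q / (q * x)),
    show q / (q * x) = x⁻¹ by field_simp, show q * x⁻¹ = q / x from rfl]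
  field_simp
  ring

theorem theta_ne_zero (hq0 : q ≠ 0) (hq : ‖q‖ < 1) {x : ℂ} (hx0 : x ≠ 0)
    (hx : ∀ n : ℤ, q ^ n * x ≠ 1) : theta x q ≠ 0 := by
  refine mul_ne_zero (mul_ne_zero (qPoch_ne_zero hq fun i => by simpa using hx i)
    (qPoch_ne_zero hq fun i h => hx (-(i + 1)) ?_)) (qPoch_self_ne_zero hq)
  rw [zpow_neg, ← Nat.cast_one, ← Nat.cast_add, zpow_natCast, pow_succ]
  field_simp at h
  field_simp
  exact h.symm

theorem analyticAt_theta (hq : ‖q‖ < 1) {x : ℂ} (hx : x ≠ 0) :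
    AnalyticAt ℂ (fun x => theta x q) x :=
  ((analyticAt_qPoch hq x).mul (AnalyticAt.fun_comp (analyticAt_qPoch hq _)
    (analyticAt_const.div analyticAt_id hx))).mul analyticAt_const

theorem theta_one (hq : ‖q‖ < 1) : theta 1 q = 0 := by
  rw [theta, qPoch_eq_one_sub_mul hq 1, sub_self, zero_mul, zero_mul, zero_mul]

theorem hasDerivAt_theta_one (hq : ‖q‖ < 1) :
    HasDerivAt (fun x => theta x q) (-(qPoch q q ^ 3)) 1 := by
  have hright : DifferentiableAt ℂ (fun x => qPoch (q * x) q) 1 :=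
    (differentiable_qPoch hq _).fun_comp' 1 (by fun_prop)
  have hleft : DifferentiableAt ℂ (fun x => qPoch (q / x) q) 1 :=
    (differentiable_qPoch hq _).fun_comp' 1 (by fun_prop (disch := norm_num))
  have hreg : DifferentiableAt ℂ (fun x => qPoch (q * x) q * qPoch (q / x) q * qPoch q q) 1 :=
    (hright.fun_mul hleft).mul_const _
  refine ((((hasDerivAt_id' (1 : ℂ)).const_sub 1).fun_mul hreg.hasDerivAt).congr_deriv
    ?_).congr_of_eventuallyEq (.of_forall fun x => ?_)
  · rw [mul_one, div_one, sub_self, zero_mul, add_zero]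
    ring
  · simp only [theta, qPoch_eq_one_sub_mul hq x, mul_assoc]

theorem theta_sq_mul (hq : ‖q‖ < 1) (x : ℂ) :
    theta (x ^ 2) (q ^ 2) * qPoch q q ^ 2 =
      qPoch (q ^ 2) (q ^ 2) * (theta x q * theta (-x) q) := by
  rw [theta, theta, theta, ← div_pow, qPoch_sq hq x, qPoch_sq hq (q / x), div_neg]
  ring

theorem theta_mul_qPoch_sq (hq0 : q ≠ 0) (hq : ‖q‖ < 1) {x : ℂ} (hx : x ≠ 0) :
    theta x q * qPoch (q ^ 2) (q ^ 2) ^ 2 =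
      theta x (q ^ 2) * theta (q * x) (q ^ 2) * qPoch q q := by
  have hsplit (u : ℂ) : qPoch u q = qPoch u (q ^ 2) * qPoch (q * u) (q ^ 2) := by
    simpa using qPoch_eq_prod_pow hq u 2
  rw [theta, theta, theta, hsplit x, hsplit (q / x),
    show q * (q / x) = q ^ 2 / x by ring, show q ^ 2 / (q * x) = q / x by field_simp]
  ring

theorem theta_self_mul_qPoch_sq (hq0 : q ≠ 0) (hq : ‖q‖ < 1) :
    theta q (q ^ 2) * qPoch (q ^ 2) (q ^ 2) = qPoch q q ^ 2 := by
  have hsplit : qPoch q q = qPoch q (q ^ 2) * qPoch (q ^ 2) (q ^ 2) := by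
    simpa [← sq] using qPoch_eq_prod_pow hq q 2
  rw [theta, hsplit, show q ^ 2 / q = q by field_simp]
  ring

end Theta

section SimplePole

variable {f g : ℂ → ℂ} {a b p : ℂ}

/-- `f` has at most a simple pole at `p`, with residue `a`. With `a = 0` this says that the
singularity of `f` at `p` is removable; the value `f p` is irrelevant. -/
def HasSimplePoleAt (f : ℂ → ℂ) (a p : ℂ) : Prop :=
  ∃ g, AnalyticAt ℂ g p ∧ f =ᶠ[𝓝[≠] p] fun x => a / (x - p) + g x

theorem hasSimplePoleAt_zero_iff :
    HasSimplePoleAt f 0 p ↔ ∃ g, AnalyticAt ℂ g p ∧ f =ᶠ[𝓝[≠] p] g := by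
  simp only [HasSimplePoleAt, zero_div, zero_add]

theorem hasSimplePoleAt_of_analyticAt (hf : AnalyticAt ℂ f p) : HasSimplePoleAt f 0 p :=
  hasSimplePoleAt_zero_iff.2 ⟨f, hf, EventuallyEq.rfl⟩

theorem HasSimplePoleAt.congr (hf : HasSimplePoleAt f a p) (hgf : g =ᶠ[𝓝[≠] p] f) :
    HasSimplePoleAt g a p :=
  let ⟨k, hk, hfk⟩ := hf; ⟨k, hk, hgf.trans hfk⟩

theorem HasSimplePoleAt.add (hf : HasSimplePoleAt f a p) (hg : HasSimplePoleAt g b p) :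
    HasSimplePoleAt (fun x => f x + g x) (a + b) p := by
  obtain ⟨k, hk, hfk⟩ := hf
  obtain ⟨l, hl, hgl⟩ := hg
  refine ⟨fun x => k x + l x, hk.add hl, ?_⟩
  filter_upwards [hfk, hgl] with x hfx hgx
  rw [hfx, hgx]; ring

theorem hasSimplePoleAt_div {w : ℂ → ℂ} {d : ℂ} (hf : AnalyticAt ℂ f p) (hw : AnalyticAt ℂ w p)
    (hw0 : w p = 0) (hwd : HasDerivAt w d p) (hd : d ≠ 0) :
    HasSimplePoleAt (fun x => f x / w x) (f p / d) p := by
  have hv : AnalyticAt ℂ (dslope w p) p := by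
    obtain ⟨P, hP⟩ := hw
    exact hP.has_fpower_series_dslope_fslope.analyticAt
  have hvp : dslope w p p = d := by rw [dslope_same, hwd.deriv]
  have hu : AnalyticAt ℂ (fun x => f x / dslope w p x) p := hf.div hv (hvp.symm ▸ hd)
  have hs : AnalyticAt ℂ (dslope (fun x => f x / dslope w p x) p) p := by
    obtain ⟨P, hP⟩ := hu
    exact hP.has_fpower_series_dslope_fslope.analyticAt
  refine ⟨_, hs, ?_⟩
  filter_upwards [self_mem_nhdsWithin] with x hx
  have hxp : x - p ≠ 0 := sub_ne_zero.2 hx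
  rw [dslope_of_ne _ hx, slope_def_field, dslope_of_ne w hx, slope_def_field, hvp, hw0, sub_zero]
  field_simp
  ring

theorem HasSimplePoleAt.analyticAt_mul (hf : HasSimplePoleAt f a p) (hg : AnalyticAt ℂ g p) :
    HasSimplePoleAt (fun x => g x * f x) (g p * a) p := by
  obtain ⟨k, hk, hfk⟩ := hf
  have hdiv := hasSimplePoleAt_div (f := fun x => g x * a) (hg.mul analyticAt_const)
    (analyticAt_id.sub analyticAt_const) (sub_self p) ((hasDerivAt_id p).sub_const p) one_ne_zero
  simpa using (hdiv.add (hasSimplePoleAt_of_analyticAt (hg.mul hk))).congr (by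
    filter_upwards [hfk] with x hx
    simp [hx]; ring)

theorem HasSimplePoleAt.comp {φ : ℂ → ℂ} {d : ℂ} (hf : HasSimplePoleAt f a (φ p))
    (hφ : AnalyticAt ℂ φ p) (hφd : HasDerivAt φ d p) (hd : d ≠ 0) :
    HasSimplePoleAt (fun x => f (φ x)) (a / d) p := by
  obtain ⟨k, hk, hfk⟩ := hf
  have hdiv := hasSimplePoleAt_div (f := fun _ => a) analyticAt_const
    (hφ.sub analyticAt_const) (sub_self (φ p)) (hφd.sub_const _) hd
  have htends := hφd.tendsto_nhdsNE hd
  simpa using (hdiv.add (hasSimplePoleAt_of_analyticAt (hk.fun_comp hφ))).congr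
    (htends.eventually hfk)

theorem exists_analytic_extension {U : Set ℂ} (hf : ∀ p ∈ U, HasSimplePoleAt f 0 p) :
    ∃ g : ℂ → ℂ, (∀ p ∈ U, AnalyticAt ℂ g p) ∧ ∀ p ∈ U, f =ᶠ[𝓝[≠] p] g := by
  have hmer : MeromorphicOn f U := fun p hp =>
    let ⟨_, hh, hfh⟩ := hasSimplePoleAt_zero_iff.1 (hf p hp)
    hh.meromorphicAt.congr hfh.symm
  have heq (p : ℂ) (hp : p ∈ U) := hmer.toMeromorphicNFOn_eq_self_on_nhdsNE hp
  refine ⟨toMeromorphicNFOn f U, fun p hp => ?_, fun p hp => (heq p hp).symm⟩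
  obtain ⟨h, hh, hfh⟩ := hasSimplePoleAt_zero_iff.1 (hf p hp)
  rw [← (meromorphicNFOn_toMeromorphicNFOn f U hp).meromorphicOrderAt_nonneg_iff_analyticAt,
    meromorphicOrderAt_congr ((heq p hp).trans hfh)]
  exact hh.meromorphicOrderAt_nonneg

end SimplePole

section Denominators

variable {Q x₀ : ℂ}

theorem exists_pos_le_norm_of_tendsto {φ : ℕ → ℂ → ℂ} {L : ℂ} (hL : L ≠ 0)
    (hφ : ∀ n, ContinuousAt (φ n) x₀)
    (hlim : Tendsto (fun p : ℂ × ℕ => φ p.2 p.1) (𝓝 x₀ ×ˢ atTop) (𝓝 L)) :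
    ∃ δ > 0, ∀ᶠ x in 𝓝 x₀, ∀ n, φ n x₀ ≠ 0 → δ ≤ ‖φ n x‖ := by
  have hLpos : 0 < ‖L‖ := norm_pos_iff.2 hL
  obtain ⟨near, hnear, far, hfar, hlarge⟩ := eventually_prod_iff.1
    (hlim.norm.eventually_const_le (half_lt_self hLpos))
  obtain ⟨N, hN⟩ := eventually_atTop.1 hfar
  have hsmall : ∀ᶠ δ in 𝓝[>] (0 : ℝ), ∀ n ∈ Set.Iio N,
      ∀ᶠ x in 𝓝 x₀, φ n x₀ ≠ 0 → δ ≤ ‖φ n x‖ := by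
    refine (eventually_all_finite (Set.finite_Iio N)).2 fun n _ => ?_
    by_cases hn : φ n x₀ = 0
    · simp [hn]
    · filter_upwards [Ioo_mem_nhdsGT (norm_pos_iff.2 hn)] with δ hδ
      filter_upwards [(hφ n).norm.eventually_const_le hδ.2] with x hx _ using hx
  obtain ⟨δ, ⟨hδ, hδL⟩, hδ0⟩ :=
    ((hsmall.and (Ioc_mem_nhdsGT (half_pos hLpos))).and self_mem_nhdsWithin).exists
  refine ⟨δ, hδ0, ?_⟩
  filter_upwards [(eventually_all_finite (Set.finite_Iio N)).2 hδ, hnear] with x hx hxnear n hn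
  rcases lt_or_ge n N with hlt | hge
  · exact hx n hlt hn
  · exact hδL.2.trans (hlarge hxnear (hN n hge))

theorem exists_mul_max_le_norm_one_sub (hQ0 : Q ≠ 0) (hQ : ‖Q‖ < 1) (hx₀ : x₀ ≠ 0) :
    ∃ δ > 0, ∀ᶠ x in 𝓝 x₀, ∀ n : ℤ, Q ^ n * x₀ ≠ 1 →
      δ * max 1 (‖Q‖ ^ n) ≤ ‖1 - Q ^ n * x‖ := by
  have hpow : Tendsto (fun p : ℂ × ℕ => Q ^ p.2) (𝓝 x₀ ×ˢ atTop) (𝓝 0) :=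
    (tendsto_pow_atTop_nhds_zero_of_norm_lt_one hQ).comp tendsto_snd
  obtain ⟨δ₁, hδ₁, hnonneg⟩ := exists_pos_le_norm_of_tendsto (x₀ := x₀)
    (φ := fun n x => 1 - Q ^ n * x) one_ne_zero (fun n => by fun_prop)
    (by simpa using (hpow.mul tendsto_fst).const_sub 1)
  obtain ⟨δ₂, hδ₂, hneg⟩ := exists_pos_le_norm_of_tendsto (x₀ := x₀)
    (φ := fun n x => Q ^ n - x) (neg_ne_zero.2 hx₀) (fun n => by fun_prop)
    (by simpa using hpow.sub tendsto_fst)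
  refine ⟨min δ₁ δ₂, lt_min hδ₁ hδ₂, ?_⟩
  filter_upwards [hnonneg, hneg] with x hx₁ hx₂ n hn
  obtain ⟨m, rfl | rfl⟩ := n.eq_nat_or_neg
  · simp only [zpow_natCast] at hn ⊢
    rw [max_eq_left (pow_le_one₀ (norm_nonneg Q) hQ.le), mul_one]
    exact (min_le_left _ _).trans (hx₁ m (sub_ne_zero.2 hn.symm))
  · have hQm : Q ^ m ≠ 0 := pow_ne_zero m hQ0
    have hQpos : 0 < ‖Q‖ ^ m := pow_pos (norm_pos_iff.2 hQ0) m
    simp only [zpow_neg, zpow_natCast] at hn ⊢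
    rw [max_eq_right ((one_le_inv₀ hQpos).2 (pow_le_one₀ (norm_nonneg Q) hQ.le)),
      show 1 - (Q ^ m)⁻¹ * x = (Q ^ m - x) * (Q ^ m)⁻¹ by field_simp, norm_mul, norm_inv, norm_pow]
    gcongr
    exact (min_le_right _ _).trans (hx₂ m fun h => hn (by
      rw [← sub_eq_zero.1 h, inv_mul_cancel₀ hQm]))

theorem exists_norm_inv_one_sub_le (hQ0 : Q ≠ 0) (hQ : ‖Q‖ < 1) (hx₀ : x₀ ≠ 0) :
    ∃ C, ∀ᶠ x in 𝓝 x₀, ∀ n : ℤ, Q ^ n * x₀ ≠ 1 →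
      1 - Q ^ n * x ≠ 0 ∧ ‖(1 - Q ^ n * x)⁻¹‖ ≤ C * min 1 (‖Q‖ ^ (-n)) := by
  obtain ⟨δ, hδ, hlower⟩ := exists_mul_max_le_norm_one_sub hQ0 hQ hx₀
  refine ⟨δ⁻¹, hlower.mono fun x hx n hn => ?_⟩
  have hpos : 0 < δ * max 1 (‖Q‖ ^ n) := by positivity
  have hQn : 0 < ‖Q‖ ^ n := zpow_pos (norm_pos_iff.2 hQ0) n
  refine ⟨norm_pos_iff.1 (hpos.trans_le (hx n hn)), ?_⟩
  rw [norm_inv, zpow_neg]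
  refine (inv_anti₀ hpos (hx n hn)).trans ?_
  rw [mul_inv]
  gcongr
  exact le_min (inv_le_one_of_one_le₀ (le_max_left _ _)) (inv_anti₀ hQn (le_max_right _ _))

theorem eventually_zpow_mul_ne_one (hQ0 : Q ≠ 0) (hQ : ‖Q‖ < 1) (hx₀ : x₀ ≠ 0) :
    ∀ᶠ x in 𝓝[≠] x₀, ∀ n : ℤ, Q ^ n * x ≠ 1 := by
  obtain ⟨C, hC⟩ := exists_norm_inv_one_sub_le hQ0 hQ hx₀
  filter_upwards [hC.filter_mono nhdsWithin_le_nhds, self_mem_nhdsWithin] with x hx hne n hn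
  by_cases h0 : Q ^ n * x₀ = 1
  · exact hne (mul_left_cancel₀ (zpow_ne_zero n hQ0) (hn.trans h0.symm))
  · exact (hx n h0).1 (by rw [hn, sub_self])

end Denominators

section PartialFractions

variable {Q : ℂ} {a : ℤ → ℂ}

/-- The partial fraction series `∑ a_n / (1 - Q^n x)`, whose poles are the `Q^(-n)` with
`a_n ≠ 0`. -/
def fracSum (a : ℤ → ℂ) (Q x : ℂ) : ℂ := ∑' n : ℤ, a n / (1 - Q ^ n * x)

theorem norm_div_le_of_norm_inv_le {u c : ℂ} {B d : ℝ} (h : c ≠ 0 → ‖u⁻¹‖ ≤ B * d) :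
    ‖c / u‖ ≤ B * (‖c‖ * d) := by
  by_cases hc : c = 0
  · simp [hc]
  · rw [div_eq_mul_inv, norm_mul, mul_left_comm]
    gcongr
    exact h hc

theorem summable_frac (hQ0 : Q ≠ 0) (hQ : ‖Q‖ < 1)
    (ha : Summable fun n : ℤ => ‖a n‖ * min 1 (‖Q‖ ^ (-n))) {x : ℂ} (hx : x ≠ 0)
    (h : ∀ n, a n ≠ 0 → Q ^ n * x ≠ 1) : Summable fun n : ℤ => a n / (1 - Q ^ n * x) := by
  obtain ⟨C, hC⟩ := exists_norm_inv_one_sub_le hQ0 hQ hx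
  exact (ha.mul_left C).of_norm_bounded fun n =>
    norm_div_le_of_norm_inv_le fun hn => (hC.self_of_nhds n (h n hn)).2

theorem analyticAt_fracSum (hQ0 : Q ≠ 0) (hQ : ‖Q‖ < 1)
    (ha : Summable fun n : ℤ => ‖a n‖ * min 1 (‖Q‖ ^ (-n))) {x : ℂ} (hx : x ≠ 0)
    (h : ∀ n, a n ≠ 0 → Q ^ n * x ≠ 1) : AnalyticAt ℂ (fracSum a Q) x := by
  obtain ⟨C, hC⟩ := exists_norm_inv_one_sub_le hQ0 hQ hx
  obtain ⟨U, hU, hUo, hxU⟩ := eventually_nhds_iff.1 hC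
  refine DifferentiableOn.analyticAt (s := U) ?_ (hUo.mem_nhds hxU)
  refine Complex.differentiableOn_tsum_of_summable_norm (ha.mul_left C) (fun n => ?_) hUo
    fun w n hw => norm_div_le_of_norm_inv_le fun hn => (hU n hw w (h w hn)).2
  by_cases hn : a n = 0
  · simp only [hn, zero_div]; exact differentiableOn_const _
  · exact DifferentiableOn.div (by fun_prop) (by fun_prop) fun w hw => (hU w hw n (h n hn)).1

theorem zpow_ne_one_of_norm_lt_one (hQ : ‖Q‖ < 1) {n : ℤ} (hn : n ≠ 0) :
    Q ^ n ≠ 1 := fun h => hn <| by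
  have hnorm : ‖Q‖ ^ n = 1 := by rw [← norm_zpow, h, norm_one]
  exact (zpow_eq_one_iff_right₀ (norm_nonneg _) hQ.ne).1 hnorm

theorem hasSimplePoleAt_fracSum (hQ0 : Q ≠ 0) (hQ : ‖Q‖ < 1)
    (ha : Summable fun n : ℤ => ‖a n‖ * min 1 (‖Q‖ ^ (-n))) :
    HasSimplePoleAt (fracSum a Q) (-a 0) 1 := by
  set b : ℤ → ℂ := Function.update a 0 0
  have hba {n : ℤ} (hn : n ≠ 0) : a n = b n := (Function.update_of_ne hn _ _).symm
  have hb : Summable fun n : ℤ => ‖b n‖ * min 1 (‖Q‖ ^ (-n)) := by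
    refine ha.congr_cofinite ?_
    filter_upwards [(Set.finite_singleton (0 : ℤ)).compl_mem_cofinite] with n hn
    rw [hba hn]
  refine ⟨fracSum b Q, analyticAt_fracSum hQ0 hQ hb one_ne_zero fun n hn => ?_, ?_⟩
  · rw [mul_one]
    exact zpow_ne_one_of_norm_lt_one hQ fun h => hn (by simp [b, h])
  · filter_upwards [eventually_zpow_mul_ne_one hQ0 hQ one_ne_zero,
      eventually_ne_nhdsWithin one_ne_zero] with x hx hx0
    rw [fracSum, (summable_frac hQ0 hQ ha hx0 fun n _ => hx n).tsum_eq_add_tsum_ite 0, fracSum,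
      zpow_zero, one_mul, neg_div, ← div_neg, neg_sub]
    congr 2
    ext n
    rcases eq_or_ne n 0 with rfl | hn
    · simp [b]
    · rw [if_neg hn, hba hn]

end PartialFractions

section Multiplier

variable {Q c : ℂ} {g : ℂ → ℂ}

theorem apply_pow_mul_eq (hQ0 : Q ≠ 0) (hfe : ∀ x ≠ 0, g (Q * x) = c * g x) (n : ℕ) {x : ℂ}
    (hx : x ≠ 0) : g (Q ^ n * x) = c ^ n * g x := by
  induction n with
  | zero => simp
  | succ n ih =>
    rw [pow_succ', mul_assoc, hfe _ (mul_ne_zero (pow_ne_zero n hQ0) hx), ih, pow_succ', mul_assoc]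

theorem exists_bound_of_multiplier (hQ0 : Q ≠ 0) (hQ : ‖Q‖ < 1) (hc : ‖c‖ ≤ 1)
    (hg : ∀ x ≠ 0, ContinuousAt g x) (hfe : ∀ x ≠ 0, g (Q * x) = c * g x) :
    ∃ M, ∀ x ≠ 0, ‖x‖ ≤ 1 → ‖g x‖ ≤ M := by
  have hQpos : 0 < ‖Q‖ := norm_pos_iff.2 hQ0
  have hcont : ContinuousOn g (Metric.closedBall 0 1 \ Metric.ball 0 ‖Q‖) := fun x hx =>
    (hg x fun h => hx.2 (h ▸ Metric.mem_ball_self hQpos)).continuousWithinAt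
  obtain ⟨M, hM⟩ :=
    ((isCompact_closedBall _ _).diff Metric.isOpen_ball).exists_bound_of_continuousOn hcont
  refine ⟨M, fun x hx hx1 => ?_⟩
  obtain ⟨n, hlow, hupp⟩ := exists_nat_pow_near_of_lt_one (norm_pos_iff.2 hx) hx1 hQpos hQ
  have hQn : 0 < ‖Q‖ ^ n := pow_pos hQpos n
  have hu : x / Q ^ n ∈ Metric.closedBall (0 : ℂ) 1 \ Metric.ball 0 ‖Q‖ := by
    rw [Set.mem_sdiff, mem_closedBall_zero_iff, mem_ball_zero_iff, not_lt, norm_div, norm_pow,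
      div_le_one₀ hQn, le_div_iff₀ hQn, ← pow_succ']
    exact ⟨hupp, hlow.le⟩
  calc ‖g x‖ = ‖c‖ ^ n * ‖g (x / Q ^ n)‖ := by
        rw [← norm_pow, ← norm_mul, ← apply_pow_mul_eq hQ0 hfe n (div_ne_zero hx
          (pow_ne_zero n hQ0)), mul_div_cancel₀ _ (pow_ne_zero n hQ0)]
    _ ≤ 1 * M := by gcongr; exacts [pow_le_one₀ (norm_nonneg c) hc, hM _ hu]
    _ = M := one_mul M

theorem exists_entire_extension (hQ0 : Q ≠ 0) (hQ : ‖Q‖ < 1) (hc : ‖c‖ ≤ 1)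
    (hg : ∀ x ≠ 0, AnalyticAt ℂ g x) (hfe : ∀ x ≠ 0, g (Q * x) = c * g x) :
    ∃ G : ℂ → ℂ, Differentiable ℂ G ∧ (∀ x ≠ 0, G x = g x) ∧ ∀ x, G (Q * x) = c * G x := by
  obtain ⟨M, hM⟩ := exists_bound_of_multiplier hQ0 hQ hc (fun x hx => (hg x hx).continuousAt) hfe
  have hball : Metric.ball (0 : ℂ) 1 ∈ 𝓝 0 := Metric.ball_mem_nhds _ one_pos
  have hdiff := Complex.differentiableOn_update_limUnder_of_bddAbove (f := g) hball
    (fun x hx => (hg x hx.2).differentiableAt.differentiableWithinAt)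
    ⟨M, Set.forall_mem_image.2 fun x hx => hM x hx.2 (mem_ball_zero_iff.1 hx.1).le⟩
  set G := Function.update g 0 (limUnder (𝓝[≠] 0) g)
  have hGg (x : ℂ) (hx : x ≠ 0) : G x = g x := Function.update_of_ne hx _ _
  have hG : Differentiable ℂ G := fun x => by
    rcases eq_or_ne x 0 with rfl | hx
    · exact hdiff.differentiableAt hball
    · exact (hg x hx).differentiableAt.congr_of_eventuallyEq
        ((eventually_ne_nhds hx).mono hGg)
  refine ⟨G, hG, hGg, fun x => ?_⟩
  have hclosed : IsClosed {x | G (Q * x) = c * G x} :=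
    isClosed_eq (hG.continuous.comp (by fun_prop)) (hG.continuous.const_mul c)
  refine hclosed.closure_subset_iff.2 (fun u hu => ?_) (dense_compl_singleton (0 : ℂ) x)
  rw [Set.mem_ofPred_eq, hGg u hu, hGg _ (mul_ne_zero hQ0 hu), hfe u hu]

theorem exists_eq_const_of_invariant (hQ0 : Q ≠ 0) (hQ : ‖Q‖ < 1) (hg : ∀ x ≠ 0, AnalyticAt ℂ g x)
    (hfe : ∀ x ≠ 0, g (Q * x) = g x) : ∃ C, ∀ x ≠ 0, g x = C := by
  obtain ⟨G, hG, hGg, hGfe⟩ := exists_entire_extension hQ0 hQ (c := 1) norm_one.le hg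
    (by simpa only [one_mul] using hfe)
  refine ⟨G 0, fun x hx => ?_⟩
  have hlim : Tendsto (fun n : ℕ => G (Q ^ n * x)) atTop (𝓝 (G 0)) :=
    (hG.continuous.tendsto' _ _ rfl).comp
      (by simpa using (tendsto_pow_atTop_nhds_zero_of_norm_lt_one hQ).mul_const x)
  refine tendsto_nhds_unique (tendsto_const_nhds.congr fun n => ?_) hlim
  rw [apply_pow_mul_eq hQ0 (fun x _ => hGfe x) n hx, one_pow, one_mul, hGg x hx]

theorem eq_zero_of_entire_of_multiplier (hg : Differentiable ℂ g) (hc : ∀ n : ℕ, Q ^ n ≠ c)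
    (hfe : ∀ x, g (Q * x) = c * g x) (x : ℂ) : g x = 0 := by
  have hderiv (n : ℕ) : iteratedDeriv n g 0 = 0 := by
    have hn := congrFun (iteratedDeriv_comp_const_mul (n := n) hg.contDiff Q) 0
    rw [funext hfe, iteratedDeriv_const_mul_field, mul_zero] at hn
    exact (mul_eq_mul_right_iff.1 hn).resolve_left (hc n).symm
  rw [← Complex.taylorSeries_eq_of_entire hg 0 x]
  simp [hderiv]

theorem eq_zero_of_multiplier (hQ0 : Q ≠ 0) (hQ : ‖Q‖ < 1) (hc : ∀ n : ℤ, Q ^ n * c ≠ 1)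
    (hg : ∀ x ≠ 0, AnalyticAt ℂ g x) (hfe : ∀ x ≠ 0, g (Q * x) = c * g x) {x : ℂ} (hx : x ≠ 0) :
    g x = 0 := by
  obtain ⟨n, hn⟩ : ∃ n : ℕ, ‖Q ^ n * c‖ ≤ 1 := by
    have hlim := ((tendsto_pow_atTop_nhds_zero_of_norm_lt_one hQ).mul_const c).norm
    rw [zero_mul, norm_zero] at hlim
    exact (hlim.eventually_le_const one_pos).exists
  obtain ⟨G, hG, hGg, hGfe⟩ := exists_entire_extension (g := fun x => x ^ n * g x) hQ0 hQ hn
    (fun x hx => (analyticAt_id.pow n).mul (hg x hx)) (fun x hx => by rw [hfe x hx]; ring)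
  have hzero := eq_zero_of_entire_of_multiplier hG (fun m hm => hc (n - m) (by
    rw [zpow_sub₀ hQ0, zpow_natCast, zpow_natCast, div_mul_eq_mul_div, hm,
      div_self (hm ▸ pow_ne_zero m hQ0)])) hGfe x
  exact (mul_eq_zero.1 (hGg x hx ▸ hzero)).resolve_left (pow_ne_zero n hx)

end Multiplier

section Quasiperiodic

variable {Q c : ℂ} {A : Finset ℂ} {f : ℂ → ℂ}

/-- The nonzero points whose orbit under multiplication by powers of `Q` avoids `A`. A
quasiperiodic function with poles only in the orbits of `A` is analytic there. -/
def orbitCompl (Q : ℂ) (A : Finset ℂ) : Set ℂ := {x | x ≠ 0 ∧ ∀ a ∈ A, ∀ n : ℤ, Q ^ n * x ≠ a}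

theorem orbitCompl_anti {A B : Finset ℂ} (h : A ⊆ B) : orbitCompl Q B ⊆ orbitCompl Q A :=
  fun _ hx => ⟨hx.1, fun a ha => hx.2 a (h ha)⟩

theorem zpow_mul_mem_orbitCompl (hQ0 : Q ≠ 0) {x : ℂ} (hx : x ∈ orbitCompl Q A) (m : ℤ) :
    Q ^ m * x ∈ orbitCompl Q A := by
  refine ⟨mul_ne_zero (zpow_ne_zero m hQ0) hx.1, fun a ha n => ?_⟩
  rw [← mul_assoc, ← zpow_add₀ hQ0]
  exact hx.2 a ha (n + m)

theorem eventually_mem_orbitCompl (hQ0 : Q ≠ 0) (hQ : ‖Q‖ < 1) (A : Finset ℂ) {p : ℂ}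
    (hp : p ≠ 0) : ∀ᶠ x in 𝓝[≠] p, x ∈ orbitCompl Q A := by
  have hpunct : ∀ᶠ x in 𝓝[≠] p, x ≠ 0 := eventually_ne_nhdsWithin hp
  refine hpunct.and ((Finset.eventually_all A).2 fun a _ => ?_)
  rcases eq_or_ne a 0 with rfl | ha
  · exact hpunct.mono fun x hx n => mul_ne_zero (zpow_ne_zero n hQ0) hx
  · have hdiv : HasDerivAt (fun x => x / a) (1 / a) p := (hasDerivAt_id p).div_const a
    filter_upwards [(hdiv.tendsto_nhdsNE (by simpa using ha)).eventually
      (eventually_zpow_mul_ne_one hQ0 hQ (div_ne_zero hp ha))] with x hx n hn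
    exact hx n (by rw [← mul_div_assoc, hn, div_self ha])

theorem isOpen_orbitCompl (hQ0 : Q ≠ 0) (hQ : ‖Q‖ < 1) (A : Finset ℂ) :
    IsOpen (orbitCompl Q A) :=
  isOpen_iff_mem_nhds.2 fun _ hx => Set.insert_eq_of_mem hx ▸
    insert_mem_nhds_iff.2 (eventually_mem_orbitCompl hQ0 hQ A hx.1)

theorem eq_of_eq_on_orbitCompl (hQ0 : Q ≠ 0) (hQ : ‖Q‖ < 1) {p : ℂ} (hp : p ≠ 0)
    (hf : ContinuousAt f p) (hg : ContinuousAt g p) (hfg : ∀ x ∈ orbitCompl Q A, f x = g x) :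
    f p = g p :=
  ((hf.eventuallyEq_nhds_iff_eventuallyEq_nhdsNE hg).1
    ((eventually_mem_orbitCompl hQ0 hQ A hp).mono hfg)).eq_of_nhds

theorem apply_zpow_mul_eq (hQ0 : Q ≠ 0) (hc : c ≠ 0)
    (hfe : ∀ x ∈ orbitCompl Q A, f (Q * x) = c * f x) (n : ℤ) {x : ℂ} (hx : x ∈ orbitCompl Q A) :
    f (Q ^ n * x) = c ^ n * f x := by
  have hstep (m : ℤ) : f (Q ^ (m + 1) * x) = c * f (Q ^ m * x) := by
    rw [zpow_add_one₀ hQ0, mul_comm (Q ^ m), mul_assoc]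
    exact hfe _ (zpow_mul_mem_orbitCompl hQ0 hx m)
  induction n using Int.induction_on with
  | zero => simp
  | succ n ih => rw [hstep, ih, zpow_add_one₀ hc]; ring
  | pred n ih =>
    have hprev := hstep (-n - 1)
    rw [sub_add_cancel, ih] at hprev
    rw [zpow_sub_one₀ hc, mul_right_comm, hprev]
    field_simp

theorem hasSimplePoleAt_zero_of_quasiperiodic (hQ0 : Q ≠ 0) (hQ : ‖Q‖ < 1) (hc : c ≠ 0)
    (hf : ∀ x ∈ orbitCompl Q A, AnalyticAt ℂ f x) (hA : ∀ a ∈ A, HasSimplePoleAt f 0 a)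
    (hfe : ∀ x ∈ orbitCompl Q A, f (Q * x) = c * f x) {p : ℂ} (hp : p ≠ 0) :
    HasSimplePoleAt f 0 p := by
  by_cases hgood : p ∈ orbitCompl Q A
  · exact hasSimplePoleAt_of_analyticAt (hf p hgood)
  obtain ⟨a, ha, n, hn⟩ : ∃ a ∈ A, ∃ n : ℤ, Q ^ n * p = a := by
    simpa [orbitCompl, hp] using hgood
  have hmove : HasSimplePoleAt (fun x => f (Q ^ n * x)) 0 p := by
    have hφ : AnalyticAt ℂ (fun x => Q ^ n * x) p := analyticAt_const.mul analyticAt_id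
    have hφd : HasDerivAt (fun x => Q ^ n * x) (Q ^ n) p := by
      simpa using (hasDerivAt_id p).const_mul (Q ^ n)
    have hpole : HasSimplePoleAt f 0 (Q ^ n * p) := hn.symm ▸ hA a ha
    simpa only [zero_div] using hpole.comp hφ hφd (zpow_ne_zero n hQ0)
  have hscale := hmove.analyticAt_mul (analyticAt_const (v := c ^ (-n)))
  rw [mul_zero] at hscale
  refine hscale.congr ((eventually_mem_orbitCompl hQ0 hQ A hp).mono fun x hx => ?_)
  simp only [apply_zpow_mul_eq hQ0 hc hfe n hx]
  rw [zpow_neg, inv_mul_cancel_left₀ (zpow_ne_zero n hc)]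

theorem exists_quasiperiodic_extension (hQ0 : Q ≠ 0) (hQ : ‖Q‖ < 1) (hc : c ≠ 0)
    (hf : ∀ x ∈ orbitCompl Q A, AnalyticAt ℂ f x) (hA : ∀ a ∈ A, HasSimplePoleAt f 0 a)
    (hfe : ∀ x ∈ orbitCompl Q A, f (Q * x) = c * f x) :
    ∃ g : ℂ → ℂ, (∀ x ≠ 0, AnalyticAt ℂ g x) ∧ (∀ x ≠ 0, g (Q * x) = c * g x) ∧
      ∀ x ∈ orbitCompl Q A, f x = g x := by
  obtain ⟨g, hg, hfg⟩ := exists_analytic_extension (f := f) (U := {0}ᶜ) fun p hp =>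
    hasSimplePoleAt_zero_of_quasiperiodic hQ0 hQ hc hf hA hfe hp
  have hgood (x : ℂ) (hx : x ∈ orbitCompl Q A) : f x = g x :=
    (((hf x hx).continuousAt.eventuallyEq_nhds_iff_eventuallyEq_nhdsNE
      (hg x hx.1).continuousAt).1 (hfg x hx.1)).eq_of_nhds
  refine ⟨g, hg, fun p hp => ?_, hgood⟩
  have hleft : ContinuousAt (fun x => g (Q * x)) p :=
    ContinuousAt.comp' (hg _ (mul_ne_zero hQ0 hp)).continuousAt (by fun_prop)
  have hright : ContinuousAt (fun x => c * g x) p := (hg p hp).continuousAt.const_mul c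
  refine eq_of_eq_on_orbitCompl (A := A) hQ0 hQ hp hleft hright fun x hx => ?_
  have hQx : Q * x ∈ orbitCompl Q A := by simpa using zpow_mul_mem_orbitCompl hQ0 hx 1
  rw [← hgood x hx, ← hgood _ hQx, hfe x hx]

theorem eq_zero_of_quasiperiodic (hQ0 : Q ≠ 0) (hQ : ‖Q‖ < 1) (hc : c ≠ 0)
    (hcQ : ∀ n : ℤ, Q ^ n * c ≠ 1) (hf : ∀ x ∈ orbitCompl Q A, AnalyticAt ℂ f x)
    (hA : ∀ a ∈ A, HasSimplePoleAt f 0 a) (hfe : ∀ x ∈ orbitCompl Q A, f (Q * x) = c * f x)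
    {x : ℂ} (hx : x ∈ orbitCompl Q A) : f x = 0 := by
  obtain ⟨g, hg, hgfe, hfg⟩ := exists_quasiperiodic_extension hQ0 hQ hc hf hA hfe
  rw [hfg x hx, eq_zero_of_multiplier hQ0 hQ hcQ hg hgfe hx.1]

theorem exists_eq_const_of_periodic (hQ0 : Q ≠ 0) (hQ : ‖Q‖ < 1)
    (hf : ∀ x ∈ orbitCompl Q A, AnalyticAt ℂ f x) (hA : ∀ a ∈ A, HasSimplePoleAt f 0 a)
    (hfe : ∀ x ∈ orbitCompl Q A, f (Q * x) = f x) : ∃ C, ∀ x ∈ orbitCompl Q A, f x = C := by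
  obtain ⟨g, hg, hgfe, hfg⟩ := exists_quasiperiodic_extension hQ0 hQ one_ne_zero hf hA
    (by simpa only [one_mul] using hfe)
  obtain ⟨C, hC⟩ := exists_eq_const_of_invariant hQ0 hQ hg (by simpa only [one_mul] using hgfe)
  exact ⟨C, fun x hx => (hfg x hx).trans (hC x hx.1)⟩

end Quasiperiodic

section ThetaSeries

variable {Q X : ℂ}

theorem succ_mul_pred_half (r : ℤ) : (r + 1) * (r + 1 - 1) / 2 = r * (r - 1) / 2 + r := by
  rw [← Int.add_mul_ediv_left _ _ two_ne_zero]
  congr 1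
  ring

theorem summable_nat_gauss {ρ t : ℝ} (hρ0 : 0 < ρ) (hρ : ρ < 1) (ht : 0 < t) :
    Summable fun n : ℕ => ρ ^ ((n : ℤ) * (n - 1) / 2) * t ^ n := by
  refine summable_of_ratio_test_tendsto_lt_one zero_lt_one
    (Eventually.of_forall fun n => by positivity) ?_
  have hratio : Tendsto (fun n : ℕ => ρ ^ n * t) atTop (𝓝 0) := by
    simpa using (tendsto_pow_atTop_nhds_zero_of_lt_one hρ0.le hρ).mul_const t
  refine hratio.congr fun n => ?_
  rw [Nat.cast_add, Nat.cast_one, succ_mul_pred_half, zpow_add₀ hρ0.ne', zpow_natCast, pow_succ,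
    Real.norm_of_nonneg (by positivity), Real.norm_of_nonneg (by positivity)]
  have hne : ρ ^ ((n : ℤ) * (n - 1) / 2) ≠ 0 := by positivity
  field_simp

theorem summable_gauss {ρ t : ℝ} (hρ0 : 0 < ρ) (hρ : ρ < 1) (ht : 0 < t) :
    Summable fun n : ℤ => ρ ^ (n * (n - 1) / 2) * t ^ n := by
  refine Summable.of_nat_of_neg (by simpa using summable_nat_gauss hρ0 hρ ht) ?_
  refine (summable_nat_gauss hρ0 hρ (div_pos hρ0 ht)).congr fun n => ?_
  rw [show -(n : ℤ) * (-n - 1) = (n + 1) * (n + 1 - 1) by ring, succ_mul_pred_half,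
    zpow_add₀ hρ0.ne', zpow_neg, zpow_natCast, zpow_natCast, div_pow]
  ring

theorem summable_norm_gauss (hQ0 : Q ≠ 0) (hQ : ‖Q‖ < 1) (hX : X ≠ 0) :
    Summable fun r : ℤ => ‖Q ^ (r * (r - 1) / 2) * X ^ r‖ := by
  simpa only [norm_mul, norm_zpow] using
    summable_gauss (norm_pos_iff.2 hQ0) hQ (norm_pos_iff.2 hX)

theorem zpow_le_zpow_add_zpow {a b t : ℝ} (ha : 0 < a) (hat : a ≤ t) (htb : t ≤ b) (n : ℤ) :
    t ^ n ≤ a ^ n + b ^ n := by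
  have ht : 0 < t := ha.trans_le hat
  rcases le_total 0 n with hn | hn
  · exact (zpow_le_zpow_left₀ hn ht.le htb).trans (le_add_of_nonneg_left (by positivity))
  · rw [← neg_neg n, zpow_neg t, zpow_neg a, ← inv_zpow, ← inv_zpow a]
    have hb : 0 < b := ht.trans_le htb
    exact (zpow_le_zpow_left₀ (neg_nonneg.2 hn) (by positivity) (inv_anti₀ ha hat)).trans
      (le_add_of_nonneg_right (by positivity))

theorem analyticAt_gauss_series (hQ0 : Q ≠ 0) (hQ : ‖Q‖ < 1) {c : ℤ → ℂ} {C : ℝ}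
    (hc : ∀ r, ‖c r‖ ≤ C) (hX : X ≠ 0) :
    AnalyticAt ℂ (fun X => ∑' r : ℤ, Q ^ (r * (r - 1) / 2) * X ^ r * c r) X := by
  have hX' : 0 < ‖X‖ := norm_pos_iff.2 hX
  have hQ0' : 0 < ‖Q‖ := norm_pos_iff.2 hQ0
  set a := ‖X‖ / 2
  set b := 2 * ‖X‖
  have hUo : IsOpen {W : ℂ | a < ‖W‖ ∧ ‖W‖ < b} :=
    (isOpen_lt continuous_const continuous_norm).inter
      (isOpen_lt continuous_norm continuous_const)
  have hmajorant : Summable fun r : ℤ =>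
      (‖Q‖ ^ (r * (r - 1) / 2) * a ^ r + ‖Q‖ ^ (r * (r - 1) / 2) * b ^ r) * C :=
    ((summable_gauss hQ0' hQ (by positivity)).add
      (summable_gauss hQ0' hQ (by positivity))).mul_right C
  refine DifferentiableOn.analyticAt (Complex.differentiableOn_tsum_of_summable_norm hmajorant
    (fun r W hW => ?_) hUo fun r W hW => ?_) (hUo.mem_nhds ⟨half_lt_self hX', lt_two_mul_self hX'⟩)
  · have hW0 : W ≠ 0 := norm_pos_iff.1 ((half_pos hX').trans hW.1)
    exact (((differentiableAt_zpow.2 (.inl hW0)).const_mul _).mul_const _).differentiableWithinAt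
  · rw [norm_mul, norm_mul, norm_zpow, norm_zpow, ← mul_add]
    have hpow := zpow_le_zpow_add_zpow (half_pos hX') hW.1.le hW.2.le r
    have : 0 ≤ a ^ r + b ^ r := by positivity
    gcongr
    exact hc r

/-- The bilateral theta series `∑ Q^{r(r-1)/2} X^r`, the sum side of the Jacobi triple product. -/
def thetaSum (X Q : ℂ) : ℂ := ∑' r : ℤ, Q ^ (r * (r - 1) / 2) * X ^ r

theorem thetaSum_mul_left (hQ0 : Q ≠ 0) (hX : X ≠ 0) :
    thetaSum (Q * X) Q = X⁻¹ * thetaSum X Q := by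
  rw [thetaSum, thetaSum, ← (Equiv.addRight (1 : ℤ)).tsum_eq
    (fun r : ℤ => Q ^ (r * (r - 1) / 2) * X ^ r), ← tsum_mul_left]
  refine tsum_congr fun r => ?_
  rw [Equiv.coe_addRight, succ_mul_pred_half, zpow_add₀ hQ0, zpow_add_one₀ hX, mul_zpow]
  field_simp

theorem analyticAt_thetaSum (hQ0 : Q ≠ 0) (hQ : ‖Q‖ < 1) (hX : X ≠ 0) :
    AnalyticAt ℂ (fun X => thetaSum X Q) X := by
  simpa only [thetaSum, mul_one] using
    analyticAt_gauss_series (c := fun _ => 1) (C := 1) hQ0 hQ (by simp) hX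

theorem thetaSum_neg_one (Q : ℂ) : thetaSum (-1) Q = 0 := by
  have hflip := (Equiv.subLeft (1 : ℤ)).tsum_eq fun r : ℤ => Q ^ (r * (r - 1) / 2) * (-1 : ℂ) ^ r
  have hneg (r : ℤ) : Q ^ ((1 - r) * (1 - r - 1) / 2) * (-1 : ℂ) ^ (1 - r) =
      -(Q ^ (r * (r - 1) / 2) * (-1 : ℂ) ^ r) := by
    rw [show (1 - r) * (1 - r - 1) = r * (r - 1) by ring, zpow_sub₀ (by norm_num), zpow_one,
      div_eq_mul_inv, ← inv_zpow, inv_neg_one]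
    ring
  simp only [Equiv.subLeft_apply, hneg, tsum_neg] at hflip
  exact CharZero.neg_eq_self_iff.1 hflip

end ThetaSeries

section JacobiTripleProduct

variable {q Q : ℂ}

theorem norm_prod_one_sub_pow_le (hq : ‖q‖ < 1) (k n : ℕ) :
    ‖∏ i ∈ Finset.range n, (1 - q ^ (k + i + 1))‖ ≤ Real.exp (1 - ‖q‖)⁻¹ := by
  rw [norm_prod]
  calc ∏ i ∈ Finset.range n, ‖1 - q ^ (k + i + 1)‖
      ≤ ∏ i ∈ Finset.range n, Real.exp (‖q‖ ^ i) := by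
        refine Finset.prod_le_prod (fun i _ => norm_nonneg _) fun i _ => ?_
        have hpow : ‖q‖ ^ (k + i + 1) ≤ ‖q‖ ^ i :=
          pow_le_pow_of_le_one (norm_nonneg _) hq.le (by omega)
        have htriangle := norm_sub_le (1 : ℂ) (q ^ (k + i + 1))
        rw [norm_one, norm_pow] at htriangle
        linarith [Real.add_one_le_exp (‖q‖ ^ i)]
    _ = Real.exp (∑ i ∈ Finset.range n, ‖q‖ ^ i) := (Real.exp_sum _ _).symm
    _ ≤ Real.exp (1 - ‖q‖)⁻¹ := by
        rw [Real.exp_le_exp, ← tsum_geometric_of_lt_one (norm_nonneg _) hq]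
        exact (summable_geometric_of_lt_one (norm_nonneg _) hq).sum_le_tsum _
          fun i _ => by positivity

theorem norm_pow_mul_prod_one_sub_pow_le (hq : ‖q‖ < 1) (k n : ℕ) :
    ‖q ^ ((k + 1) * n) * ∏ i ∈ Finset.range (n + 1), (1 - q ^ (k + i + 1))‖ ≤
      ‖q‖ ^ n * Real.exp (1 - ‖q‖)⁻¹ := by
  rw [norm_mul, norm_pow]
  gcongr ?_ * ?_
  · exact pow_le_pow_of_le_one (norm_nonneg _) hq.le (by nlinarith)
  · exact norm_prod_one_sub_pow_le hq k (n + 1)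

theorem tendsto_pentagonal_remainder (hq : ‖q‖ < 1) :
    Tendsto (fun k => (-1) ^ (k + 1) * q ^ ((k + 1) * (3 * k + 4) / 2) *
      ∑' n : ℕ, q ^ ((k + 1) * n) * ∏ i ∈ Finset.range (n + 1), (1 - q ^ (k + i + 1)))
      atTop (𝓝 0) := by
  have hgeo := summable_geometric_of_lt_one (norm_nonneg q) hq
  refine squeeze_zero_norm (a := fun k => ‖q‖ ^ k * ((1 - ‖q‖)⁻¹ * Real.exp (1 - ‖q‖)⁻¹))
    (fun k => ?_) (by
      simpa using (tendsto_pow_atTop_nhds_zero_of_lt_one (norm_nonneg _) hq).mul_const _)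
  rw [norm_mul, norm_mul, norm_pow, norm_neg, norm_one, one_pow, one_mul, norm_pow]
  refine mul_le_mul ?_ ?_ (norm_nonneg _) (by positivity)
  · refine pow_le_pow_of_le_one (norm_nonneg _) hq.le ?_
    rw [Nat.le_div_iff_mul_le two_pos]
    nlinarith
  · have hs := (hgeo.mul_right (Real.exp (1 - ‖q‖)⁻¹)).hasSum
    rw [tsum_mul_right, tsum_geometric_of_lt_one (norm_nonneg _) hq] at hs
    exact tsum_of_norm_bounded hs (norm_pow_mul_prod_one_sub_pow_le hq k)

theorem neg_one_zpow_mul_pow_pentagonal (hq0 : q ≠ 0) (r : ℤ) :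
    (-1 : ℂ) ^ r * q ^ pentagonal r = (q ^ 3) ^ (r * (r - 1) / 2) * (-q) ^ r := by
  have hcast : (pentagonal r : ℤ) = 3 * (r * (r - 1) / 2) + r := by
    have hhalf := Int.mul_ediv_cancel' (Int.even_mul_pred_self r).two_dvd
    linarith [two_mul_natCast_pentagonal r]
  rw [← zpow_natCast q (pentagonal r), hcast, zpow_add₀ hq0, zpow_mul, neg_eq_neg_one_mul q,
    mul_zpow]
  norm_cast
  ring

theorem qPoch_self_eq_thetaSum (hq0 : q ≠ 0) (hq : ‖q‖ < 1) :
    qPoch q q = thetaSum (-q) (q ^ 3) := by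
  have hsum : Summable fun r : ℤ => (-1 : ℂ) ^ r * q ^ pentagonal r := by
    simpa only [neg_one_zpow_mul_pow_pentagonal hq0] using
      (summable_norm_gauss (pow_ne_zero 3 hq0) (norm_pow_lt_one hq three_ne_zero)
        (neg_ne_zero.2 hq0)).of_norm
  have hneg : Summable fun k : ℕ => (-1 : ℂ) ^ (-(k : ℤ)) * q ^ pentagonal (-(k : ℤ)) :=
    hsum.comp_injective (i := fun k : ℕ => -(k : ℤ)) fun _ _ h => by simpa using h
  have hpos : Summable fun k : ℕ => (-1 : ℂ) ^ ((k : ℤ) + 1) * q ^ pentagonal ((k : ℤ) + 1) :=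
    hsum.comp_injective (i := fun k : ℕ => (k : ℤ) + 1) fun _ _ h => by simpa using h
  have hpair (k : ℕ) :
      (-1 : ℂ) ^ k * (q ^ pentagonal (-(k : ℤ)) - q ^ pentagonal ((k : ℤ) + 1)) =
        (-1 : ℂ) ^ (-(k : ℤ)) * q ^ pentagonal (-(k : ℤ)) +
          (-1 : ℂ) ^ ((k : ℤ) + 1) * q ^ pentagonal ((k : ℤ) + 1) := by
    rw [← inv_zpow', inv_neg_one, zpow_add_one₀ (by norm_num), zpow_natCast]
    ring
  have hmul (k : ℕ) : Multipliable fun n : ℕ => 1 - q ^ (n + k + 1) := by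
    simpa only [← pow_add, add_assoc] using multipliable_qPoch hq (q ^ (k + 1))
  have hsplit := tsum_of_nat_of_neg_add_one
    (f := fun r : ℤ => (-1 : ℂ) ^ (-r) * q ^ pentagonal (-r)) hneg
    (by simpa only [neg_neg] using hpos)
  simp only [neg_neg] at hsplit
  calc qPoch q q = ∏' n : ℕ, (1 - q ^ (n + 1)) := by simp only [qPoch, pow_succ]
    _ = ∑' r : ℤ, (-1 : ℂ) ^ (-r) * q ^ pentagonal (-r) := by
        rw [Pentagonal.tprod_one_sub_pow (tendsto_pow_atTop_nhds_zero_of_norm_lt_one hq)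
          (fun k => ((summable_geometric_of_lt_one (norm_nonneg q) hq).mul_right
            _).of_norm_bounded (norm_pow_mul_prod_one_sub_pow_le hq k)) hmul
          ((hneg.add hpos).congr fun k => (hpair k).symm) (tendsto_pentagonal_remainder hq),
          tsum_congr hpair, hneg.tsum_add hpos, hsplit]
    _ = ∑' r : ℤ, (-1 : ℂ) ^ r * q ^ pentagonal r :=
        (Equiv.neg ℤ).tsum_eq fun r : ℤ => (-1 : ℂ) ^ r * q ^ pentagonal r
    _ = thetaSum (-q) (q ^ 3) := tsum_congr (neg_one_zpow_mul_pow_pentagonal hq0)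

theorem mem_orbitCompl_one {x : ℂ} :
    x ∈ orbitCompl Q {1} ↔ x ≠ 0 ∧ ∀ n : ℤ, Q ^ n * x ≠ 1 := by
  simp only [orbitCompl, Finset.mem_singleton, forall_eq, Set.mem_ofPred_eq]

theorem theta_ne_zero_of_mem (hQ0 : Q ≠ 0) (hQ : ‖Q‖ < 1) {x : ℂ} (hx : x ∈ orbitCompl Q {1}) :
    theta x Q ≠ 0 :=
  theta_ne_zero hQ0 hQ hx.1 (mem_orbitCompl_one.1 hx).2

theorem hasSimplePoleAt_div_theta (hQ : ‖Q‖ < 1) {f : ℂ → ℂ} (hf : AnalyticAt ℂ f 1) :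
    HasSimplePoleAt (fun x => f x / theta x Q) (-(f 1 / qPoch Q Q ^ 3)) 1 := by
  rw [← div_neg]
  exact hasSimplePoleAt_div hf (analyticAt_theta hQ one_ne_zero) (theta_one hQ)
    (hasDerivAt_theta_one hQ) (neg_ne_zero.2 (pow_ne_zero 3 (qPoch_self_ne_zero hQ)))

theorem exists_thetaSum_eq_const_mul (hQ0 : Q ≠ 0) (hQ : ‖Q‖ < 1) :
    ∃ c, ∀ x ≠ 0, thetaSum (-x) Q = c * theta x Q := by
  have han {x : ℂ} (hx : x ≠ 0) : AnalyticAt ℂ (fun x => thetaSum (-x) Q) x :=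
    AnalyticAt.fun_comp (analyticAt_thetaSum hQ0 hQ (neg_ne_zero.2 hx)) analyticAt_id.neg
  have hpole : HasSimplePoleAt (fun x => thetaSum (-x) Q / theta x Q) 0 1 := by
    simpa only [thetaSum_neg_one, zero_div, neg_zero] using
      hasSimplePoleAt_div_theta hQ (han one_ne_zero)
  obtain ⟨c, hc⟩ := exists_eq_const_of_periodic (A := {1})
    (f := fun x => thetaSum (-x) Q / theta x Q) hQ0 hQ
    (fun x hx => (han hx.1).div (analyticAt_theta hQ hx.1) (theta_ne_zero_of_mem hQ0 hQ hx))
    (by simpa only [Finset.mem_singleton, forall_eq] using hpole) fun x hx => by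
      rw [theta_mul_left hQ0 hQ hx.1, ← mul_neg, thetaSum_mul_left hQ0 (neg_ne_zero.2 hx.1),
        inv_neg]
      exact mul_div_mul_left _ _ (neg_ne_zero.2 (inv_ne_zero hx.1))
  refine ⟨c, fun x hx => eq_of_eq_on_orbitCompl (A := {1}) hQ0 hQ hx (han hx).continuousAt
    ((analyticAt_theta hQ hx).continuousAt.const_mul c) fun x hx => ?_⟩
  rw [← hc x hx, div_mul_cancel₀ _ (theta_ne_zero_of_mem hQ0 hQ hx)]

-- The constant is found at `x = q`, `Q = q ^ 3`, where the identity is the pentagonal number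
-- theorem.
theorem thetaSum_neg (hQ0 : Q ≠ 0) (hQ : ‖Q‖ < 1) {x : ℂ} (hx : x ≠ 0) :
    thetaSum (-x) Q = theta x Q := by
  obtain ⟨c, hc⟩ := exists_thetaSum_eq_const_mul hQ0 hQ
  obtain ⟨q, rfl⟩ := IsAlgClosed.exists_pow_nat_eq Q three_pos
  have hq0 : q ≠ 0 := ne_zero_pow three_ne_zero hQ0
  have hq : ‖q‖ < 1 := by
    rwa [norm_pow, pow_lt_one_iff_of_nonneg (norm_nonneg q) three_ne_zero] at hQ
  have htheta : theta q (q ^ 3) = qPoch q q := by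
    rw [qPoch_eq_prod_pow hq q 3, Fin.prod_univ_three, theta, show q ^ 3 / q = q * q by field_simp]
    simp only [Fin.val_zero, Fin.val_one, Fin.val_two, pow_zero, pow_one, one_mul, ← pow_succ]
  have hc1 : c = 1 := by
    refine mul_right_cancel₀ (qPoch_self_ne_zero hq) ?_
    rw [one_mul, ← htheta, ← hc q hq0, htheta, qPoch_self_eq_thetaSum hq0 hq]
  rw [hc x hx, hc1, one_mul]

theorem thetaSum_eq (hQ0 : Q ≠ 0) (hQ : ‖Q‖ < 1) {x : ℂ} (hx : x ≠ 0) :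
    thetaSum x Q = theta (-x) Q := by
  rw [← thetaSum_neg hQ0 hQ (neg_ne_zero.2 hx), neg_neg]

end JacobiTripleProduct

section Kronecker

variable {Q w : ℂ}

theorem zpow_mul_ne_one_of_norm (hQ0 : Q ≠ 0) (hQ : ‖Q‖ < 1) (hw : ‖Q‖ < ‖w‖) (hw1 : ‖w‖ < 1)
    (n : ℤ) : Q ^ n * w ≠ 1 := by
  intro h
  have hQn : 0 < ‖Q‖ := norm_pos_iff.2 hQ0
  have hnorm : ‖w‖ = ‖Q‖ ^ (-n) := by
    rw [eq_inv_of_mul_eq_one_right h, norm_inv, norm_zpow, zpow_neg]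
  rw [hnorm, ← zpow_one ‖Q‖, ← zpow_mul, zpow_lt_zpow_iff_right_of_lt_one₀ hQn hQ] at hw
  rw [hnorm, ← zpow_zero ‖Q‖, zpow_lt_zpow_iff_right_of_lt_one₀ hQn hQ] at hw1
  omega

theorem zpow_mul_inv_ne_one (h : ∀ n : ℤ, Q ^ n * w ≠ 1) (n : ℤ) : Q ^ n * w⁻¹ ≠ 1 := by
  rw [← inv_ne_one, mul_inv, inv_inv, ← zpow_neg]
  exact h (-n)

theorem analyticAt_theta_const_mul (hQ : ‖Q‖ < 1) {c x : ℂ} (hc : c ≠ 0) (hx : x ≠ 0) :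
    AnalyticAt ℂ (fun x => theta (c * x) Q) x :=
  AnalyticAt.fun_comp (analyticAt_theta hQ (mul_ne_zero hc hx))
    (analyticAt_const.mul analyticAt_id)

theorem summable_kronecker_coeff (hQ0 : Q ≠ 0) (hw : ‖Q‖ < ‖w‖) (hw1 : ‖w‖ < 1) :
    Summable fun n : ℤ => ‖w ^ n‖ * min 1 (‖Q‖ ^ (-n)) := by
  have hQn : 0 < ‖Q‖ := norm_pos_iff.2 hQ0
  have hwn : 0 < ‖w‖ := hQn.trans hw
  refine Summable.of_nat_of_neg ?_ ?_
  · refine (summable_geometric_of_lt_one hwn.le hw1).of_nonneg_of_le (fun n => by positivity)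
      fun n => ?_
    rw [zpow_natCast, norm_pow]
    exact mul_le_of_le_one_right (by positivity) (min_le_left _ _)
  · refine (summable_geometric_of_lt_one (by positivity) ((div_lt_one hwn).2 hw)).of_nonneg_of_le
      (fun n => by positivity) fun n => ?_
    rw [neg_neg, zpow_natCast, norm_zpow, zpow_neg, zpow_natCast, div_pow, div_eq_inv_mul]
    gcongr
    exact min_le_right _ _

theorem fracSum_zpow_mul_left (hQ0 : Q ≠ 0) (hw0 : w ≠ 0) (x : ℂ) :
    fracSum (fun n => w ^ n) Q (Q * x) = w⁻¹ * fracSum (fun n => w ^ n) Q x := by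
  rw [fracSum, fracSum, ← (Equiv.addRight (1 : ℤ)).tsum_eq (fun n : ℤ => w ^ n / (1 - Q ^ n * x)),
    ← tsum_mul_left]
  refine tsum_congr fun r => ?_
  rw [Equiv.coe_addRight, zpow_add_one₀ hw0, zpow_add_one₀ hQ0, mul_assoc (Q ^ r)]
  field_simp

theorem fracSum_zpow_eq (hQ0 : Q ≠ 0) (hQ : ‖Q‖ < 1) (hw : ‖Q‖ < ‖w‖) (hw1 : ‖w‖ < 1)
    {x : ℂ} (hx : x ∈ orbitCompl Q {1}) :
    fracSum (fun n => w ^ n) Q x =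
      qPoch Q Q ^ 3 * theta (w * x) Q / (theta x Q * theta w Q) := by
  have hw0 : w ≠ 0 := norm_pos_iff.1 ((norm_pos_iff.2 hQ0).trans hw)
  have hwQ := zpow_mul_ne_one_of_norm hQ0 hQ hw hw1
  have hθw := theta_ne_zero hQ0 hQ hw0 hwQ
  have hs := summable_kronecker_coeff hQ0 hw hw1
  have hnum {x : ℂ} (hx : x ≠ 0) :
      AnalyticAt ℂ (fun x => -(qPoch Q Q ^ 3 * theta (w * x) Q / theta w Q)) x :=
    ((analyticAt_const.mul (analyticAt_theta_const_mul hQ hw0 hx)).div analyticAt_const hθw).neg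
  set D : ℂ → ℂ := fun x => fracSum (fun n => w ^ n) Q x +
    -(qPoch Q Q ^ 3 * theta (w * x) Q / theta w Q) / theta x Q with hD
  have hpole : HasSimplePoleAt D 0 1 := by
    have hP := qPoch_self_ne_zero hQ
    convert (hasSimplePoleAt_fracSum hQ0 hQ hs).add
      (hasSimplePoleAt_div_theta hQ (hnum one_ne_zero)) using 1
    rw [mul_one, zpow_zero]
    field_simp
    simp
  have hzero : D x = 0 := by
    refine eq_zero_of_quasiperiodic (A := {1}) hQ0 hQ (inv_ne_zero hw0) (zpow_mul_inv_ne_one hwQ)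
      (fun x hx => ?_) (by simpa only [Finset.mem_singleton, forall_eq] using hpole)
      (fun x hx => ?_) hx
    · exact (analyticAt_fracSum hQ0 hQ hs hx.1 fun n _ => (mem_orbitCompl_one.1 hx).2 n).add
        ((hnum hx.1).div (analyticAt_theta hQ hx.1) (theta_ne_zero_of_mem hQ0 hQ hx))
    · have hθ := theta_ne_zero_of_mem hQ0 hQ hx
      have hx0 := hx.1
      simp only [hD]
      rw [fracSum_zpow_mul_left hQ0 hw0, theta_mul_left hQ0 hQ hx0, mul_left_comm w Q,
        theta_mul_left hQ0 hQ (mul_ne_zero hw0 hx0)]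
      field_simp
  have hθ := theta_ne_zero_of_mem hQ0 hQ hx
  rw [add_eq_zero_iff_eq_neg.1 hzero]
  field_simp

end Kronecker

section Lerch

variable {Q X b : ℂ}

/-- The Lerch series `∑ Q^{r(r-1)/2} X^r / (1 - Q^r b)`. Up to a theta function it is the
Appell–Lerch sum, in the variables in which its functional equations are simplest. -/
def lerch (X b Q : ℂ) : ℂ := fracSum (fun r => Q ^ (r * (r - 1) / 2) * X ^ r) Q b

theorem appellLerch_eq (hQ0 : Q ≠ 0) (x z : ℂ) :
    appellLerch x Q z = lerch (-z) (x * z / Q) Q / theta z Q := by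
  rw [appellLerch, lerch, fracSum, one_div_mul_eq_div]
  congr 2
  ext r
  rw [neg_eq_neg_one_mul z, mul_zpow, zpow_sub_one₀ hQ0]
  congr 1 <;> ring

theorem summable_lerch_coeff (hQ0 : Q ≠ 0) (hQ : ‖Q‖ < 1) (hX : X ≠ 0) :
    Summable fun r : ℤ => ‖Q ^ (r * (r - 1) / 2) * X ^ r‖ * min 1 (‖Q‖ ^ (-r)) :=
  (summable_norm_gauss hQ0 hQ hX).of_nonneg_of_le (fun _ => by positivity)
    fun _ => mul_le_of_le_one_right (norm_nonneg _) (min_le_left _ _)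

theorem summable_lerch (hQ0 : Q ≠ 0) (hQ : ‖Q‖ < 1) (hX : X ≠ 0) (hb : b ∈ orbitCompl Q {1}) :
    Summable fun r : ℤ => Q ^ (r * (r - 1) / 2) * X ^ r / (1 - Q ^ r * b) :=
  summable_frac hQ0 hQ (summable_lerch_coeff hQ0 hQ hX) hb.1
    fun n _ => (mem_orbitCompl_one.1 hb).2 n

theorem one_sub_zpow_mul_ne_zero (hb : b ∈ orbitCompl Q {1}) (n : ℤ) : 1 - Q ^ n * b ≠ 0 :=
  sub_ne_zero.2 ((mem_orbitCompl_one.1 hb).2 n).symm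

theorem lerch_mul_right (hQ0 : Q ≠ 0) (hQ : ‖Q‖ < 1) (hX : X ≠ 0) (hb : b ∈ orbitCompl Q {1}) :
    lerch X (Q * b) Q = theta (-X) Q + Q * b / X * lerch X b Q := by
  have hshift : Summable fun r : ℤ => Q * b / X *
      (Q ^ ((r + 1) * (r + 1 - 1) / 2) * X ^ (r + 1) / (1 - Q ^ (r + 1) * b)) :=
    ((Equiv.addRight (1 : ℤ)).summable_iff.2 (summable_lerch hQ0 hQ hX hb)).mul_left _
  rw [← thetaSum_eq hQ0 hQ hX, thetaSum, lerch, lerch, fracSum, fracSum,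
    ← (Equiv.addRight (1 : ℤ)).tsum_eq (fun r : ℤ => Q ^ (r * (r - 1) / 2) * X ^ r /
      (1 - Q ^ r * b)), ← tsum_mul_left]
  simp only [Equiv.coe_addRight]
  rw [← (summable_norm_gauss hQ0 hQ hX).of_norm.tsum_add hshift]
  refine tsum_congr fun r => ?_
  have hne : 1 - Q ^ r * Q * b ≠ 0 := by
    simpa only [zpow_add_one₀ hQ0] using one_sub_zpow_mul_ne_zero hb (r + 1)
  rw [succ_mul_pred_half, zpow_add₀ hQ0, zpow_add_one₀ hQ0, zpow_add_one₀ hX,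
    ← mul_assoc (Q ^ r)]
  field_simp
  ring

theorem lerch_mul_left (hQ0 : Q ≠ 0) (hQ : ‖Q‖ < 1) (hX : X ≠ 0) (hb : b ∈ orbitCompl Q {1}) :
    lerch (Q * X) b Q = b⁻¹ * (lerch X b Q - theta (-X) Q) := by
  rw [← thetaSum_eq hQ0 hQ hX, thetaSum, lerch, lerch, fracSum, fracSum,
    ← (summable_lerch hQ0 hQ hX hb).tsum_sub (summable_norm_gauss hQ0 hQ hX).of_norm,
    ← tsum_mul_left]
  refine tsum_congr fun r => ?_
  have hne := one_sub_zpow_mul_ne_zero hb r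
  have hb0 := hb.1
  rw [mul_zpow]
  field_simp
  ring

theorem analyticAt_lerch_right (hQ0 : Q ≠ 0) (hQ : ‖Q‖ < 1) (hX : X ≠ 0)
    (hb : b ∈ orbitCompl Q {1}) : AnalyticAt ℂ (fun b => lerch X b Q) b :=
  analyticAt_fracSum hQ0 hQ (summable_lerch_coeff hQ0 hQ hX) hb.1
    fun n _ => (mem_orbitCompl_one.1 hb).2 n

theorem hasSimplePoleAt_lerch (hQ0 : Q ≠ 0) (hQ : ‖Q‖ < 1) (hX : X ≠ 0) :
    HasSimplePoleAt (fun b => lerch X b Q) (-1) 1 := by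
  simpa [lerch] using hasSimplePoleAt_fracSum hQ0 hQ (summable_lerch_coeff hQ0 hQ hX)

theorem analyticAt_lerch_left (hQ0 : Q ≠ 0) (hQ : ‖Q‖ < 1) (hX : X ≠ 0)
    (hb : b ∈ orbitCompl Q {1}) : AnalyticAt ℂ (fun X => lerch X b Q) X := by
  obtain ⟨C, hC⟩ := exists_norm_inv_one_sub_le hQ0 hQ hb.1
  have hbound (r : ℤ) : ‖(1 - Q ^ r * b)⁻¹‖ ≤ max C 0 := by
    have hr := (hC.self_of_nhds r ((mem_orbitCompl_one.1 hb).2 r)).2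
    have hmin : 0 ≤ min 1 (‖Q‖ ^ (-r)) := by positivity
    calc ‖(1 - Q ^ r * b)⁻¹‖ ≤ max C 0 * min 1 (‖Q‖ ^ (-r)) :=
          hr.trans (mul_le_mul_of_nonneg_right (le_max_left _ _) hmin)
      _ ≤ max C 0 := mul_le_of_le_one_right (le_max_right _ _) (min_le_left _ _)
  simpa only [lerch, fracSum, div_eq_mul_inv] using analyticAt_gauss_series hQ0 hQ hbound hX

theorem analyticAt_lerch_const_mul_left (hQ0 : Q ≠ 0) (hQ : ‖Q‖ < 1) {c : ℂ} (hc : c ≠ 0)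
    (hX : X ≠ 0) (hb : b ∈ orbitCompl Q {1}) : AnalyticAt ℂ (fun X => lerch (c * X) b Q) X :=
  AnalyticAt.fun_comp (analyticAt_lerch_left hQ0 hQ (mul_ne_zero hc hX) hb)
    (analyticAt_const.mul analyticAt_id)

/-- The difference of the two sides of `lerch_add_lerch`, as a function of `y`. -/
def lerchDefect (e b Q y : ℂ) : ℂ :=
  theta (-e * y) Q * lerch (e * b) y Q +
    (theta (-e * b) Q * lerch (e * y) b Q - theta (-e * y) Q * theta (-e * b) Q) +
    -(qPoch Q Q ^ 3 * theta (-e) Q * theta (b * y) Q / theta b Q) / theta y Q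

section

variable {e y : ℂ}

theorem lerchDefect_mul (hQ0 : Q ≠ 0) (hQ : ‖Q‖ < 1) (he : e ^ 2 = Q)
    (hb : b ∈ orbitCompl Q {1}) (hy : y ∈ orbitCompl Q {1}) :
    lerchDefect e b Q (Q * y) = b⁻¹ * lerchDefect e b Q y := by
  have he0 : e ≠ 0 := ne_zero_pow two_ne_zero (he ▸ hQ0)
  have hb0 := hb.1
  have hy0 := hy.1
  have hθb := theta_ne_zero_of_mem hQ0 hQ hb
  have hθy := theta_ne_zero_of_mem hQ0 hQ hy
  simp only [lerchDefect]
  rw [mul_left_comm (-e) Q, mul_left_comm b Q, mul_left_comm e Q, theta_mul_left hQ0 hQ hy0,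
    theta_mul_left hQ0 hQ (mul_ne_zero hb0 hy0),
    theta_mul_left hQ0 hQ (mul_ne_zero (neg_ne_zero.2 he0) hy0),
    lerch_mul_right hQ0 hQ (mul_ne_zero he0 hb0) hy,
    lerch_mul_left hQ0 hQ (mul_ne_zero he0 hy0) hb, ← neg_mul e y, ← neg_mul e b]
  field_simp
  rw [← he]
  ring

theorem analyticAt_lerchDefect_middle (hQ0 : Q ≠ 0) (hQ : ‖Q‖ < 1) (he0 : e ≠ 0)
    (hb : b ∈ orbitCompl Q {1}) (hy : y ≠ 0) :
    AnalyticAt ℂ (fun y => theta (-e * b) Q * lerch (e * y) b Q -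
      theta (-e * y) Q * theta (-e * b) Q) y :=
  (analyticAt_const.mul (analyticAt_lerch_const_mul_left hQ0 hQ he0 hy hb)).sub
    ((analyticAt_theta_const_mul hQ (neg_ne_zero.2 he0) hy).mul analyticAt_const)

theorem analyticAt_lerchDefect_numerator (hQ0 : Q ≠ 0) (hQ : ‖Q‖ < 1)
    (hb : b ∈ orbitCompl Q {1}) (hy : y ≠ 0) :
    AnalyticAt ℂ (fun y => -(qPoch Q Q ^ 3 * theta (-e) Q * theta (b * y) Q / theta b Q)) y :=
  ((analyticAt_const.mul (analyticAt_theta_const_mul hQ hb.1 hy)).div analyticAt_const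
    (theta_ne_zero_of_mem hQ0 hQ hb)).neg

theorem analyticAt_lerchDefect (hQ0 : Q ≠ 0) (hQ : ‖Q‖ < 1) (he0 : e ≠ 0)
    (hb : b ∈ orbitCompl Q {1}) (hy : y ∈ orbitCompl Q {1}) :
    AnalyticAt ℂ (lerchDefect e b Q) y :=
  (((analyticAt_theta_const_mul hQ (neg_ne_zero.2 he0) hy.1).mul
    (analyticAt_lerch_right hQ0 hQ (mul_ne_zero he0 hb.1) hy)).add
    (analyticAt_lerchDefect_middle hQ0 hQ he0 hb hy.1)).add
    ((analyticAt_lerchDefect_numerator hQ0 hQ hb hy.1).div (analyticAt_theta hQ hy.1)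
      (theta_ne_zero_of_mem hQ0 hQ hy))

theorem hasSimplePoleAt_lerchDefect (hQ0 : Q ≠ 0) (hQ : ‖Q‖ < 1) (he0 : e ≠ 0)
    (hb : b ∈ orbitCompl Q {1}) : HasSimplePoleAt (lerchDefect e b Q) 0 1 := by
  have hθb := theta_ne_zero_of_mem hQ0 hQ hb
  have hP := qPoch_self_ne_zero hQ
  convert (((hasSimplePoleAt_lerch hQ0 hQ (mul_ne_zero he0 hb.1)).analyticAt_mul
    (analyticAt_theta_const_mul hQ (neg_ne_zero.2 he0) one_ne_zero)).add
    (hasSimplePoleAt_of_analyticAt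
      (analyticAt_lerchDefect_middle hQ0 hQ he0 hb one_ne_zero))).add
    (hasSimplePoleAt_div_theta hQ (analyticAt_lerchDefect_numerator (e := e) hQ0 hQ hb one_ne_zero))
    using 1
  · rfl
  · rw [mul_one, mul_one]
    field_simp
    simp

theorem lerch_add_lerch (hQ0 : Q ≠ 0) (hQ : ‖Q‖ < 1) (he : e ^ 2 = Q)
    (hb : b ∈ orbitCompl Q {1}) (hy : y ∈ orbitCompl Q {1}) :
    theta (-(e * y)) Q * lerch (e * b) y Q + theta (-(e * b)) Q * lerch (e * y) b Q =
      theta (-(e * y)) Q * theta (-(e * b)) Q +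
        qPoch Q Q ^ 3 * theta (-e) Q * theta (b * y) Q / (theta y Q * theta b Q) := by
  have he0 : e ≠ 0 := ne_zero_pow two_ne_zero (he ▸ hQ0)
  have hzero : lerchDefect e b Q y = 0 :=
    eq_zero_of_quasiperiodic (A := {1}) hQ0 hQ (inv_ne_zero hb.1)
      (zpow_mul_inv_ne_one (mem_orbitCompl_one.1 hb).2)
      (fun _ hx => analyticAt_lerchDefect hQ0 hQ he0 hb hx)
      (by simpa only [Finset.mem_singleton, forall_eq] using
        hasSimplePoleAt_lerchDefect hQ0 hQ he0 hb)
      (fun _ hx => lerchDefect_mul hQ0 hQ he hb hx) hy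
  rw [lerchDefect] at hzero
  simp only [neg_mul] at hzero
  rw [div_mul_eq_div_div_swap]
  linear_combination hzero

end

end Lerch

section Sign

theorem sg_eq_sg_iff {r s : ℤ} : sg r = sg s ↔ (0 ≤ r ↔ 0 ≤ s) := by
  unfold sg
  split_ifs with hr hs hs <;> simp [hr, hs]

/-- The weight of the pair `(s, t)` in a signed double sum: `sg(s)` if `sg(s) = sg(t)`, and `0`
otherwise. -/
def pairWeight (p : ℤ × ℤ) : ℂ := if sg p.1 = sg p.2 then (sg p.1 : ℂ) else 0

theorem pairWeight_eq_zero {p : ℤ × ℤ} (h : sg p.1 ≠ sg p.2) : pairWeight p = 0 := if_neg h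

theorem norm_pairWeight_le (p : ℤ × ℤ) : ‖pairWeight p‖ ≤ 1 := by
  unfold pairWeight sg
  split_ifs <;> simp

theorem pairWeight_swap (p : ℤ × ℤ) : pairWeight p.swap = pairWeight p := by
  simp only [pairWeight, sg, Prod.fst_swap, Prod.snd_swap]
  split_ifs <;> simp_all

theorem pairWeight_sub_left (s t : ℤ) :
    pairWeight (s - 1, t) = pairWeight (s, t) - if s = 0 then 1 else 0 := by
  simp only [pairWeight, sg]
  split_ifs <;> first | contradiction | omega | simp

theorem hasSum_pairWeight_mul_zpow {s : ℤ} {u : ℂ} (hnonneg : 0 ≤ s → ‖u‖ < 1)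
    (hneg : s < 0 → 1 < ‖u‖) :
    HasSum (fun t : ℤ => pairWeight (s, t) * u ^ t) (1 - u)⁻¹ := by
  have hnat (n : ℕ) : ¬ 0 ≤ -((n : ℤ) + 1) := by omega
  rcases le_or_gt 0 s with hs | hs
  · have hright : HasSum (fun n : ℕ => pairWeight (s, (n : ℤ)) * u ^ (n : ℤ)) (1 - u)⁻¹ := by
      simpa [pairWeight, sg, hs] using hasSum_geometric_of_norm_lt_one (hnonneg hs)
    have hleft : HasSum (fun n : ℕ => pairWeight (s, -((n : ℤ) + 1)) * u ^ (-((n : ℤ) + 1))) 0 := by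
      simpa only [pairWeight, sg, hs, hnat, if_true, if_false, reduceCtorEq, Int.reduceNeg,
        Int.reduceEq, zero_mul] using hasSum_zero
    simpa only [add_zero] using
      HasSum.of_nat_of_neg_add_one (f := fun t : ℤ => pairWeight (s, t) * u ^ t) hright hleft
  · have hu := hneg hs
    have hu0 : u ≠ 0 := norm_pos_iff.1 (one_pos.trans hu)
    have hright : HasSum (fun n : ℕ => pairWeight (s, (n : ℤ)) * u ^ (n : ℤ)) 0 := by
      simp [pairWeight, sg, hs.not_ge]
    have hleft : HasSum (fun n : ℕ => pairWeight (s, -((n : ℤ) + 1)) * u ^ (-((n : ℤ) + 1)))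
        (-u⁻¹ * (1 - u⁻¹)⁻¹) := by
      have hgeom := (hasSum_geometric_of_norm_lt_one (ξ := u⁻¹)
        (by rw [norm_inv]; exact inv_lt_one_of_one_lt₀ hu)).mul_left (-u⁻¹)
      refine hgeom.congr_fun fun n => ?_
      simp only [pairWeight, sg, hs.not_ge, hnat, if_false, if_true, Int.cast_neg, Int.cast_one]
      rw [zpow_neg, ← inv_zpow, zpow_add_one₀ (inv_ne_zero hu0), zpow_natCast]
      ring
    convert HasSum.of_nat_of_neg_add_one (f := fun t : ℤ => pairWeight (s, t) * u ^ t)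
      hright hleft using 1
    have hu1 : u - 1 ≠ 0 := sub_ne_zero.2 fun h => by simp [h] at hu
    have hu2 : 1 - u ≠ 0 := sub_ne_zero.2 fun h => by simp [← h] at hu
    field_simp
    ring

variable {f : ℤ × ℤ → ℂ}

theorem hasSum_pairWeight_shift_left (hf : Summable fun p => pairWeight p * f p)
    (hedge : Summable fun t => f (0, t)) :
    HasSum (fun p : ℤ × ℤ => pairWeight p * f (p.1 + 1, p.2))
      (∑' p, pairWeight p * f p - ∑' t, f (0, t)) := by
  have hzero : HasSum (fun p : ℤ × ℤ => if p.1 = 0 then f p else 0) (∑' t, f (0, t)) := by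
    refine ((Prod.mk_right_injective (0 : ℤ)).hasSum_iff ?_).1 ?_
    · rintro ⟨s, t⟩ hst
      exact if_neg fun hs => hst ⟨t, by rw [← show s = 0 from hs]⟩
    · simpa only [Function.comp_def, if_true] using hedge.hasSum
  refine ((Equiv.addRight ((1, 0) : ℤ × ℤ)).hasSum_iff.2 (hf.hasSum.sub hzero)).congr_fun
    fun ⟨s, t⟩ => ?_
  have hweight := pairWeight_sub_left (s + 1) t
  rw [add_sub_cancel_right] at hweight
  simp only [Function.comp_apply, Equiv.coe_addRight, Prod.mk_add_mk, add_zero]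
  rw [hweight, sub_mul, ite_mul, one_mul, zero_mul]

theorem hasSum_pairWeight_shift_right (hf : Summable fun p => pairWeight p * f p)
    (hedge : Summable fun s => f (s, 0)) :
    HasSum (fun p : ℤ × ℤ => pairWeight p * f (p.1, p.2 + 1))
      (∑' p, pairWeight p * f p - ∑' s, f (s, 0)) := by
  have hswap (p : ℤ × ℤ) : pairWeight p * f p.swap = pairWeight p.swap * f p.swap := by
    rw [pairWeight_swap]
  have hshift := hasSum_pairWeight_shift_left (f := f ∘ Prod.swap)
    (((Equiv.prodComm ℤ ℤ).summable_iff.2 hf).congr fun p => (hswap p).symm) hedge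
  simp only [Function.comp_apply, Prod.swap_prod_mk] at hshift
  rw [tsum_congr hswap, show ∑' p : ℤ × ℤ, pairWeight p.swap * f p.swap = ∑' p, pairWeight p * f p
    from (Equiv.prodComm ℤ ℤ).tsum_eq fun p => pairWeight p * f p] at hshift
  refine ((Equiv.prodComm ℤ ℤ).hasSum_iff.2 hshift).congr_fun fun p => ?_
  simp [pairWeight_swap]

end Sign

section SignedBounds

theorem summable_pow_natAbs {ρ : ℝ} (h0 : 0 ≤ ρ) (h1 : ρ < 1) :
    Summable fun n : ℤ => ρ ^ n.natAbs := by
  refine Summable.of_nat_of_neg ?_ ?_ <;> simpa using summable_geometric_of_lt_one h0 h1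

theorem pow_toNat_mul_zpow_le {M W ρ : ℝ} (hM : 0 ≤ M) (hW : 0 < W) (hWρ : W ≤ ρ)
    (hMρ : M / W ≤ ρ) (s : ℤ) : M ^ (-s).toNat * W ^ s ≤ ρ ^ s.natAbs := by
  obtain ⟨n, rfl | rfl⟩ := s.eq_nat_or_neg
  · simpa using pow_le_pow_left₀ hW.le hWρ n
  · simpa [← div_eq_mul_inv, ← div_pow] using pow_le_pow_left₀ (by positivity) hMρ n

theorem zpow_mul_min_le {κ : ℝ} (hκ0 : 0 < κ) (hκ1 : κ ≤ 1) (k : ℕ) {s t : ℤ}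
    (hst : sg s = sg t) :
    κ ^ (s * t) * min 1 (κ ^ (-(k * (s + t)))) ≤
      κ⁻¹ * ((κ ^ (k + 1)) ^ (-s).toNat * (κ ^ (k + 1)) ^ (-t).toNat) := by
  have hsign := sg_eq_sg_iff.1 hst
  rcases le_or_gt 0 s with hs | hs
  · rw [Int.toNat_of_nonpos (by omega), Int.toNat_of_nonpos (by omega), pow_zero, mul_one, mul_one]
    calc κ ^ (s * t) * min 1 (κ ^ (-(k * (s + t)))) ≤ 1 * 1 := by
          gcongr
          exacts [zpow_le_one₀ hκ0 hκ1 (mul_nonneg hs (hsign.1 hs)), min_le_left _ _]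
      _ ≤ κ⁻¹ := by simpa using (one_le_inv₀ hκ0).2 hκ1
  · have ht : t < 0 := by omega
    calc κ ^ (s * t) * min 1 (κ ^ (-(k * (s + t)))) ≤ κ ^ (s * t) * κ ^ (-(k * (s + t))) := by
          gcongr
          exact min_le_right _ _
      _ = κ ^ (s * t - k * (s + t)) := by rw [← zpow_add₀ hκ0.ne', sub_eq_add_neg]
      _ ≤ κ ^ (-1 + ((k + 1) * -s + (k + 1) * -t)) := by
          refine zpow_le_zpow_right_of_le_one₀ hκ0 hκ1 ?_
          have := mul_nonneg (show 0 ≤ -s - 1 by omega) (show 0 ≤ -t - 1 by omega)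
          linarith
      _ = κ⁻¹ * ((κ ^ (k + 1)) ^ (-s).toNat * (κ ^ (k + 1)) ^ (-t).toNat) := by
          rw [zpow_add₀ hκ0.ne', zpow_add₀ hκ0.ne', zpow_neg_one, ← pow_mul, ← pow_mul,
            ← zpow_natCast κ, ← zpow_natCast κ]
          push_cast
          rw [Int.toNat_of_nonneg (by omega), Int.toNat_of_nonneg (by omega)]

end SignedBounds

section PairSum

variable {Q X w a : ℂ}

/-- The summand `Q^{st} w^s a^t / (1 - Q^{s+t} X)`. -/
def pairFrac (Q X w a : ℂ) (p : ℤ × ℤ) : ℂ :=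
  Q ^ (p.1 * p.2) * w ^ p.1 * a ^ p.2 / (1 - Q ^ (p.1 + p.2) * X)

/-- The signed double sum `∑_{sg(s) = sg(t)} sg(s) Q^{st} w^s a^t / (1 - Q^{s+t} X)`, of which both
sums in `F` are specializations. At `X = 0` it is the double series of Kronecker's identity. -/
def pairSum (Q X w a : ℂ) : ℂ := ∑' p : ℤ × ℤ, pairWeight p * pairFrac Q X w a p

theorem norm_pairWeight_mul_pairFrac_le (hQ0 : Q ≠ 0) (hQ : ‖Q‖ ≤ 1) {k : ℕ} {C ρ : ℝ}
    (hC : 0 ≤ C) (hw0 : w ≠ 0) (ha0 : a ≠ 0) (hw : ‖w‖ ≤ ρ) (ha : ‖a‖ ≤ ρ)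
    (hw' : ‖Q‖ ^ (k + 1) / ‖w‖ ≤ ρ) (ha' : ‖Q‖ ^ (k + 1) / ‖a‖ ≤ ρ) {p : ℤ × ℤ}
    (h : sg p.1 = sg p.2 →
      ‖(1 - Q ^ (p.1 + p.2) * X)⁻¹‖ ≤ C * min 1 (‖Q‖ ^ (-(k * (p.1 + p.2))))) :
    ‖pairWeight p * pairFrac Q X w a p‖ ≤ C * ‖Q‖⁻¹ * (ρ ^ p.1.natAbs * ρ ^ p.2.natAbs) := by
  have hwn : 0 < ‖w‖ := norm_pos_iff.2 hw0
  have han : 0 < ‖a‖ := norm_pos_iff.2 ha0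
  have hρ : 0 < ρ := hwn.trans_le hw
  by_cases hp : sg p.1 = sg p.2
  · rw [norm_mul, pairFrac, div_eq_mul_inv, norm_mul, norm_mul, norm_mul, norm_zpow, norm_zpow,
      norm_zpow]
    calc _ ≤ 1 * (‖Q‖ ^ (p.1 * p.2) * ‖w‖ ^ p.1 * ‖a‖ ^ p.2 *
          (C * min 1 (‖Q‖ ^ (-(k * (p.1 + p.2)))))) := by
          gcongr
          exacts [norm_pairWeight_le p, h hp]
      _ = C * (‖Q‖ ^ (p.1 * p.2) * min 1 (‖Q‖ ^ (-(k * (p.1 + p.2))))) * ‖w‖ ^ p.1 *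
          ‖a‖ ^ p.2 := by ring
      _ ≤ C * (‖Q‖⁻¹ * ((‖Q‖ ^ (k + 1)) ^ (-p.1).toNat * (‖Q‖ ^ (k + 1)) ^ (-p.2).toNat)) *
          ‖w‖ ^ p.1 * ‖a‖ ^ p.2 := by
          gcongr C * ?_ * _ * _
          exact zpow_mul_min_le (norm_pos_iff.2 hQ0) hQ k hp
      _ = C * ‖Q‖⁻¹ * (((‖Q‖ ^ (k + 1)) ^ (-p.1).toNat * ‖w‖ ^ p.1) *
          ((‖Q‖ ^ (k + 1)) ^ (-p.2).toNat * ‖a‖ ^ p.2)) := by ring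
      _ ≤ C * ‖Q‖⁻¹ * (ρ ^ p.1.natAbs * ρ ^ p.2.natAbs) := by
          gcongr
          exacts [pow_toNat_mul_zpow_le (by positivity) hwn hw hw' _,
            pow_toNat_mul_zpow_le (by positivity) han ha ha' _]
  · rw [pairWeight_eq_zero hp, zero_mul, norm_zero]
    positivity

theorem summable_mul_pow_natAbs_mul_pow_natAbs (C : ℝ) {ρ : ℝ} (h0 : 0 ≤ ρ) (h1 : ρ < 1) :
    Summable fun p : ℤ × ℤ => C * (ρ ^ p.1.natAbs * ρ ^ p.2.natAbs) :=
  ((summable_pow_natAbs h0 h1).mul_of_nonneg (summable_pow_natAbs h0 h1)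
    (fun _ => by positivity) (fun _ => by positivity)).mul_left C

theorem exists_summable_bound_pairSum (hQ0 : Q ≠ 0) (hQ : ‖Q‖ < 1) (hX0 : X ≠ 0)
    (hX : ∀ n : ℤ, n ≠ -1 → Q ^ n * X ≠ 1) (hw : ‖Q‖ ^ 2 < ‖w‖) (hw1 : ‖w‖ < 1)
    (ha : ‖Q‖ ^ 2 < ‖a‖) (ha1 : ‖a‖ < 1) :
    ∃ B : ℤ × ℤ → ℝ, Summable B ∧ ∀ᶠ v : ℂ × ℂ × ℂ in 𝓝 (X, w, a), v.2.1 ≠ 0 ∧ v.2.2 ≠ 0 ∧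
      ∀ p : ℤ × ℤ, (sg p.1 = sg p.2 → 1 - Q ^ (p.1 + p.2) * v.1 ≠ 0) ∧
        ‖pairWeight p * pairFrac Q v.1 v.2.1 v.2.2 p‖ ≤ B p := by
  obtain ⟨C, hC⟩ := exists_norm_inv_one_sub_le hQ0 hQ hX0
  have hwn : 0 < ‖w‖ := (by positivity : 0 ≤ ‖Q‖ ^ 2).trans_lt hw
  have han : 0 < ‖a‖ := (by positivity : 0 ≤ ‖Q‖ ^ 2).trans_lt ha
  obtain ⟨ρ, hρ, hρ1⟩ : ∃ ρ, max (max ‖w‖ ‖a‖) (max (‖Q‖ ^ 2 / ‖w‖) (‖Q‖ ^ 2 / ‖a‖)) < ρ ∧ ρ < 1 :=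
    exists_between (by
      simp only [max_lt_iff, div_lt_one hwn, div_lt_one han]
      exact ⟨⟨hw1, ha1⟩, hw, ha⟩)
  simp only [max_lt_iff] at hρ
  obtain ⟨⟨hwρ, haρ⟩, hwρ', haρ'⟩ := hρ
  have hw_cont : ContinuousAt (fun v : ℂ × ℂ × ℂ => ‖v.2.1‖) (X, w, a) := by fun_prop
  have ha_cont : ContinuousAt (fun v : ℂ × ℂ × ℂ => ‖v.2.2‖) (X, w, a) := by fun_prop
  refine ⟨_, summable_mul_pow_natAbs_mul_pow_natAbs (max C 0 * ‖Q‖⁻¹)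
    ((norm_nonneg _).trans hwρ.le) hρ1, ?_⟩
  filter_upwards [continuousAt_fst.eventually hC, hw_cont.eventually_const_lt hwn,
    ha_cont.eventually_const_lt han, hw_cont.eventually_le_const hwρ,
    ha_cont.eventually_le_const haρ,
    (continuousAt_const.div hw_cont hwn.ne').eventually_le_const hwρ',
    (continuousAt_const.div ha_cont han.ne').eventually_le_const haρ'] with v hv hw0 ha0 h1 h2 h3 h4
  have hv' (p : ℤ × ℤ) (hp : sg p.1 = sg p.2) :=
    hv (p.1 + p.2) (hX _ (by rw [sg_eq_sg_iff] at hp; omega))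
  refine ⟨norm_pos_iff.1 hw0, norm_pos_iff.1 ha0, fun p => ⟨fun hp => (hv' p hp).1, ?_⟩⟩
  refine norm_pairWeight_mul_pairFrac_le (k := 1) hQ0 hQ.le (le_max_right _ _)
    (norm_pos_iff.1 hw0) (norm_pos_iff.1 ha0) h1 h2 h3 h4 fun hp => (hv' p hp).2.trans ?_
  rw [Nat.cast_one, one_mul]
  gcongr
  exact le_max_left _ _

theorem summable_pairSum (hQ0 : Q ≠ 0) (hQ : ‖Q‖ < 1) (hX0 : X ≠ 0)
    (hX : ∀ n : ℤ, n ≠ -1 → Q ^ n * X ≠ 1) (hw : ‖Q‖ ^ 2 < ‖w‖) (hw1 : ‖w‖ < 1)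
    (ha : ‖Q‖ ^ 2 < ‖a‖) (ha1 : ‖a‖ < 1) :
    Summable fun p : ℤ × ℤ => pairWeight p * pairFrac Q X w a p := by
  obtain ⟨B, hB, h⟩ := exists_summable_bound_pairSum hQ0 hQ hX0 hX hw hw1 ha ha1
  exact hB.of_norm_bounded fun p => (h.self_of_nhds.2.2 p).2

theorem continuousAt_pairSum (hQ0 : Q ≠ 0) (hQ : ‖Q‖ < 1) (hX0 : X ≠ 0)
    (hX : ∀ n : ℤ, n ≠ -1 → Q ^ n * X ≠ 1) (hw : ‖Q‖ ^ 2 < ‖w‖) (hw1 : ‖w‖ < 1)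
    (ha : ‖Q‖ ^ 2 < ‖a‖) (ha1 : ‖a‖ < 1) :
    ContinuousAt (fun v : ℂ × ℂ × ℂ => pairSum Q v.1 v.2.1 v.2.2) (X, w, a) := by
  obtain ⟨B, hB, h⟩ := exists_summable_bound_pairSum hQ0 hQ hX0 hX hw hw1 ha ha1
  obtain ⟨U, hU, hUo, hxU⟩ := eventually_nhds_iff.1 h
  refine ContinuousOn.continuousAt (s := U) ?_ (hUo.mem_nhds hxU)
  refine continuousOn_tsum (fun p v hv => ?_) hB fun p v hv => ((hU v hv).2.2 p).2
  by_cases hp : sg p.1 = sg p.2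
  · obtain ⟨hw0, ha0, hv⟩ := hU v hv
    have hw_cont : ContinuousAt (fun v : ℂ × ℂ × ℂ => v.2.1 ^ p.1) v :=
      ContinuousAt.zpow₀ (by fun_prop) _ (Or.inl hw0)
    have ha_cont : ContinuousAt (fun v : ℂ × ℂ × ℂ => v.2.2 ^ p.2) v :=
      ContinuousAt.zpow₀ (by fun_prop) _ (Or.inl ha0)
    exact (continuousAt_const.mul (((continuousAt_const.mul hw_cont).mul ha_cont).div (by fun_prop)
      ((hv p).1 hp))).continuousWithinAt
  · simp only [pairWeight_eq_zero hp, zero_mul]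
    exact continuousWithinAt_const

theorem analyticAt_pairSum (hQ0 : Q ≠ 0) (hQ : ‖Q‖ < 1) (hX0 : X ≠ 0)
    (hX : ∀ n : ℤ, n ≠ -1 → Q ^ n * X ≠ 1) (hw : ‖Q‖ ^ 2 < ‖w‖) (hw1 : ‖w‖ < 1)
    (ha : ‖Q‖ ^ 2 < ‖a‖) (ha1 : ‖a‖ < 1) :
    AnalyticAt ℂ (fun X => pairSum Q X w a) X := by
  obtain ⟨B, hB, h⟩ := exists_summable_bound_pairSum hQ0 hQ hX0 hX hw hw1 ha ha1
  have hcont : Tendsto (fun Y : ℂ => (Y, w, a)) (𝓝 X) (𝓝 (X, w, a)) :=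
    Continuous.tendsto (by fun_prop) X
  obtain ⟨U, hU, hUo, hxU⟩ := eventually_nhds_iff.1 (hcont.eventually h)
  refine DifferentiableOn.analyticAt (s := U) ?_ (hUo.mem_nhds hxU)
  refine Complex.differentiableOn_tsum_of_summable_norm hB (fun p => ?_) hUo
    fun p v hv => ((hU v hv).2.2 p).2
  by_cases hp : sg p.1 = sg p.2
  · exact DifferentiableOn.const_mul (DifferentiableOn.div (by fun_prop) (by fun_prop)
      fun v hv => ((hU v hv).2.2 p).1 hp) _
  · simp only [pairWeight_eq_zero hp, zero_mul]
    exact differentiableOn_const _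

theorem summable_pairSum_zero (hQ0 : Q ≠ 0) (hQ : ‖Q‖ < 1) (hw : ‖Q‖ < ‖w‖) (hw1 : ‖w‖ < 1)
    (ha : ‖Q‖ < ‖a‖) (ha1 : ‖a‖ < 1) :
    Summable fun p : ℤ × ℤ => pairWeight p * pairFrac Q 0 w a p := by
  have hwn : 0 < ‖w‖ := (norm_nonneg _).trans_lt hw
  have han : 0 < ‖a‖ := (norm_nonneg _).trans_lt ha
  set ρ := max (max ‖w‖ ‖a‖) (max (‖Q‖ / ‖w‖) (‖Q‖ / ‖a‖)) with hρ
  have hρ1 : ρ < 1 := by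
    simp only [hρ, max_lt_iff, div_lt_one hwn, div_lt_one han]
    exact ⟨⟨hw1, ha1⟩, hw, ha⟩
  exact (summable_mul_pow_natAbs_mul_pow_natAbs (1 * ‖Q‖⁻¹) (by positivity) hρ1).of_norm_bounded
    fun p => norm_pairWeight_mul_pairFrac_le (k := 0) hQ0 hQ.le zero_le_one
      (norm_pos_iff.1 hwn) (norm_pos_iff.1 han) (by simp [hρ]) (by simp [hρ]) (by simp [hρ])
      (by simp [hρ]) (fun _ => by simp)

/-- Summing over `t` first: the sign condition turns both half-line sums into the same
geometric series, evaluated inside or outside the unit disc. -/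
theorem pairSum_zero_eq (hQ0 : Q ≠ 0) (hQ : ‖Q‖ < 1) (hw : ‖Q‖ < ‖w‖) (hw1 : ‖w‖ < 1)
    (ha : ‖Q‖ < ‖a‖) (ha1 : ‖a‖ < 1) : pairSum Q 0 w a = fracSum (fun n => w ^ n) Q a := by
  have hQn : 0 < ‖Q‖ := norm_pos_iff.2 hQ0
  rw [pairSum, (summable_pairSum_zero hQ0 hQ hw hw1 ha ha1).tsum_prod, fracSum]
  refine tsum_congr fun s => ?_
  have hnonneg (hs : 0 ≤ s) : ‖Q ^ s * a‖ < 1 := by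
    rw [norm_mul, norm_zpow]
    exact mul_lt_one_of_nonneg_of_lt_one_right (zpow_le_one₀ hQn hQ.le hs) (norm_nonneg _) ha1
  have hneg (hs : s < 0) : 1 < ‖Q ^ s * a‖ := by
    rw [norm_mul, norm_zpow]
    have hpow : ‖Q‖⁻¹ ≤ ‖Q‖ ^ s := by
      rw [← zpow_neg_one]
      exact zpow_le_zpow_right_of_le_one₀ hQn hQ.le (by omega)
    calc 1 < ‖Q‖⁻¹ * ‖a‖ := by rwa [← div_eq_inv_mul, one_lt_div hQn]
      _ ≤ ‖Q‖ ^ s * ‖a‖ := by gcongr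
  rw [div_eq_mul_inv, ← ((hasSum_pairWeight_mul_zpow hnonneg hneg).mul_left (w ^ s)).tsum_eq]
  refine tsum_congr fun t => ?_
  rw [pairFrac, mul_zero, sub_zero, div_one, mul_zpow, ← zpow_mul]
  ring

theorem norm_sq_lt_norm (hQ0 : Q ≠ 0) (hQ : ‖Q‖ < 1) : ‖Q‖ ^ 2 < ‖Q‖ :=
  pow_lt_self_of_lt_one₀ (norm_pos_iff.2 hQ0) hQ one_lt_two

theorem pairSum_shift_left (hQ0 : Q ≠ 0) (hQ : ‖Q‖ < 1) (hX : X ∈ orbitCompl Q {1})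
    (hw : ‖Q‖ < ‖w‖) (hw1 : ‖w‖ < 1) (ha : ‖Q‖ < ‖a‖) (ha1 : ‖a‖ < 1) :
    pairSum Q (Q * X) w (Q * a) = w⁻¹ * (pairSum Q X w a - fracSum (fun n => a ^ n) Q X) := by
  obtain ⟨hX0, hX1⟩ := mem_orbitCompl_one.1 hX
  have hw0 : w ≠ 0 := norm_pos_iff.1 ((norm_nonneg _).trans_lt hw)
  have hQ2 := norm_sq_lt_norm hQ0 hQ
  have hsum := summable_pairSum hQ0 hQ hX0 (fun n _ => hX1 n) (hQ2.trans hw) hw1 (hQ2.trans ha) ha1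
  have hedge (t : ℤ) : a ^ t / (1 - Q ^ t * X) = pairFrac Q X w a (0, t) := by simp [pairFrac]
  have hshift := hasSum_pairWeight_shift_left hsum
    ((summable_frac hQ0 hQ (summable_kronecker_coeff hQ0 ha ha1) hX0 fun n _ => hX1 n).congr hedge)
  rw [fracSum, tsum_congr hedge]
  refine ((hshift.mul_left w⁻¹).congr_fun fun ⟨s, t⟩ => ?_).tsum_eq
  simp only [pairFrac]
  rw [zpow_add_one₀ hw0, mul_zpow, add_one_mul, zpow_add₀ hQ0 (s * t) t,
    add_right_comm s 1 t, zpow_add_one₀ hQ0, mul_assoc (Q ^ (s + t))]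
  field_simp

theorem pairSum_shift_right (hQ0 : Q ≠ 0) (hQ : ‖Q‖ < 1) (hX : X ∈ orbitCompl Q {1})
    (hw : ‖Q‖ < ‖w‖) (hw1 : ‖w‖ < 1) (ha : ‖Q‖ < ‖a‖) (ha1 : ‖a‖ < 1) :
    pairSum Q (Q * X) w a =
      pairSum Q 0 w a + X / a * (pairSum Q X w (Q * a) - fracSum (fun n => w ^ n) Q X) := by
  obtain ⟨hX0, hX1⟩ := mem_orbitCompl_one.1 hX
  have ha0 : a ≠ 0 := norm_pos_iff.1 ((norm_nonneg _).trans_lt ha)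
  have hQn : 0 < ‖Q‖ := norm_pos_iff.2 hQ0
  have hsum := summable_pairSum hQ0 hQ hX0 (fun n _ => hX1 n)
    ((norm_sq_lt_norm hQ0 hQ).trans hw) hw1 (a := Q * a) (by rw [norm_mul, pow_two]; gcongr)
    (by rw [norm_mul]; exact mul_lt_one_of_nonneg_of_lt_one_left hQn.le hQ ha1.le)
  have hedge (s : ℤ) : w ^ s / (1 - Q ^ s * X) = pairFrac Q X w (Q * a) (s, 0) := by
    simp [pairFrac]
  have hshift := hasSum_pairWeight_shift_right hsum
    ((summable_frac hQ0 hQ (summable_kronecker_coeff hQ0 hw hw1) hX0 fun n _ => hX1 n).congr hedge)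
  rw [fracSum, tsum_congr hedge]
  refine (((summable_pairSum_zero hQ0 hQ hw hw1 ha ha1).hasSum.add
    (hshift.mul_left (X / a))).congr_fun fun ⟨s, t⟩ => ?_).tsum_eq
  have hne : 1 - Q ^ s * Q ^ t * Q * X ≠ 0 := by
    rw [← zpow_add₀ hQ0, ← zpow_add_one₀ hQ0]
    exact sub_ne_zero.2 (hX1 _).symm
  simp only [pairFrac]
  rw [zpow_add_one₀ (mul_ne_zero hQ0 ha0), mul_zpow, mul_add_one, zpow_add₀ hQ0 (s * t) s,
    ← add_assoc s t 1, zpow_add_one₀ hQ0, zpow_add₀ hQ0 s t, ← mul_assoc (Q ^ s * Q ^ t), mul_zero,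
    sub_zero]
  field_simp
  ring

end PairSum

section LinearMultiplier

variable {Q c e : ℂ} {f : ℂ → ℂ} {A : Finset ℂ}

theorem norm_lt_one_of_sq_eq (hQ : ‖Q‖ < 1) (he : e ^ 2 = Q) : ‖e‖ < 1 := by
  rwa [← he, norm_pow, pow_lt_one_iff_of_nonneg (norm_nonneg e) two_ne_zero] at hQ

theorem mem_orbitCompl_one_of_sq_eq (hQ0 : Q ≠ 0) (hQ : ‖Q‖ < 1) (he : e ^ 2 = Q) :
    e ∈ orbitCompl Q {1} := by
  have he0 : e ≠ 0 := ne_zero_pow two_ne_zero (he ▸ hQ0)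
  refine mem_orbitCompl_one.2 ⟨he0, fun n => ?_⟩
  rw [← he, ← zpow_natCast, ← zpow_mul, ← zpow_add_one₀ he0]
  exact zpow_ne_one_of_norm_lt_one (norm_lt_one_of_sq_eq hQ he) (by push_cast; omega)

/-- A theta factor turns the multiplier `c x` into a constant `e` with `e ^ 2 = Q`, which is not a
power of `Q`. -/
theorem eq_zero_of_linear_multiplier (hQ0 : Q ≠ 0) (hQ : ‖Q‖ < 1) (hc : c ≠ 0)
    (hf : ∀ x ∈ orbitCompl Q A, AnalyticAt ℂ f x) (hA : ∀ a ∈ A, HasSimplePoleAt f 0 a)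
    (hA0 : ∀ a ∈ A, a ≠ 0) (hfe : ∀ x ∈ orbitCompl Q A, f (Q * x) = c * x * f x) {x : ℂ}
    (hx : x ∈ orbitCompl Q A) : f x = 0 := by
  obtain ⟨e, he⟩ := IsAlgClosed.exists_pow_nat_eq Q two_pos
  have he0 : e ≠ 0 := ne_zero_pow two_ne_zero (he ▸ hQ0)
  set l := -(c / e) with hl
  have hl0 : l ≠ 0 := neg_ne_zero.2 (div_ne_zero hc he0)
  have heQ := (mem_orbitCompl_one.1 (mem_orbitCompl_one_of_sq_eq hQ0 hQ he)).2
  have hfθ (u : ℂ) (hu : u ∈ orbitCompl Q A) : f u * theta (l * u) Q = 0 := by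
    refine eq_zero_of_quasiperiodic (f := fun u => f u * theta (l * u) Q) hQ0 hQ he0 heQ
      (fun v hv => (hf v hv).mul (analyticAt_theta_const_mul hQ hl0 hv.1)) (fun a ha => ?_)
      (fun v hv => ?_) hu
    · simpa only [mul_zero, mul_comm] using
        (hA a ha).analyticAt_mul (analyticAt_theta_const_mul hQ hl0 (hA0 a ha))
    · have hv0 := hv.1
      rw [hfe v hv, mul_left_comm l, theta_mul_left hQ0 hQ (mul_ne_zero hl0 hv0), hl]
      field_simp
  refine eq_of_eq_on_orbitCompl (A := insert l⁻¹ A) (g := fun _ => 0) hQ0 hQ hx.1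
    (hf x hx).continuousAt continuousAt_const fun u hu => ?_
  have hl1 (n : ℤ) : Q ^ n * (l * u) ≠ 1 := fun h =>
    hu.2 l⁻¹ (Finset.mem_insert_self _ _) n (by field_simp; rw [← h]; ring)
  exact (mul_eq_zero.1 (hfθ u (orbitCompl_anti (Finset.subset_insert _ _) hu))).resolve_right
    (theta_ne_zero hQ0 hQ (mul_ne_zero hl0 hu.1) hl1)

end LinearMultiplier

section ThetaOdd

variable {Q e u : ℂ}

/-- The theta function `j(Q u²; Q²)`, whose zeros are the odd powers of a square root of `Q` and
their negatives. The denominators `j(q²x²; q⁴)`, `j(q²y²; q⁴)` and `j(z²; q⁴)` in `G` have this form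
with `Q = q²`, the last one for `u = z / q`. -/
def thetaOdd (u Q : ℂ) : ℂ := theta (Q * u ^ 2) (Q ^ 2)

theorem thetaOdd_mul_left (hQ0 : Q ≠ 0) (hQ : ‖Q‖ < 1) (hu : u ≠ 0) :
    thetaOdd (Q * u) Q = -(Q * u ^ 2)⁻¹ * thetaOdd u Q := by
  rw [thetaOdd, thetaOdd, ← theta_mul_left (pow_ne_zero 2 hQ0) (norm_pow_lt_one hQ two_ne_zero)
    (mul_ne_zero hQ0 (pow_ne_zero 2 hu))]
  ring_nf

theorem thetaOdd_one_mul (hQ0 : Q ≠ 0) (hQ : ‖Q‖ < 1) :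
    thetaOdd 1 Q * qPoch (Q ^ 2) (Q ^ 2) = qPoch Q Q ^ 2 := by
  rw [thetaOdd, one_pow, mul_one, theta_self_mul_qPoch_sq hQ0 hQ]

theorem thetaOdd_mul_qPoch_sq (hQ : ‖Q‖ < 1) (he : e ^ 2 = Q) (u : ℂ) :
    thetaOdd u Q * qPoch Q Q ^ 2 =
      qPoch (Q ^ 2) (Q ^ 2) * (theta (e * u) Q * theta (-(e * u)) Q) := by
  rw [← theta_sq_mul hQ, mul_pow, he, thetaOdd]

theorem mul_mem_orbitCompl_one (he : e ^ 2 = Q) (hQ0 : Q ≠ 0) (hu : u ∈ orbitCompl Q {e}) :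
    e * u ∈ orbitCompl Q {1} := by
  have he0 : e ≠ 0 := ne_zero_pow two_ne_zero (he ▸ hQ0)
  refine mem_orbitCompl_one.2 ⟨mul_ne_zero he0 hu.1, fun n h =>
    hu.2 e (Finset.mem_singleton_self e) (n + 1) ?_⟩
  rw [zpow_add_one₀ hQ0]
  linear_combination e * h - Q ^ n * u * he

theorem thetaOdd_ne_zero (hQ0 : Q ≠ 0) (hQ : ‖Q‖ < 1) (he : e ^ 2 = Q)
    (hu : u ∈ orbitCompl Q {e, -e}) : thetaOdd u Q ≠ 0 := by
  have hprod : qPoch (Q ^ 2) (Q ^ 2) * (theta (e * u) Q * theta (-(e * u)) Q) ≠ 0 :=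
    mul_ne_zero (qPoch_self_ne_zero (norm_pow_lt_one hQ two_ne_zero)) (mul_ne_zero
      (theta_ne_zero_of_mem hQ0 hQ (mul_mem_orbitCompl_one he hQ0 (orbitCompl_anti (by simp) hu)))
      (neg_mul e u ▸ theta_ne_zero_of_mem hQ0 hQ (mul_mem_orbitCompl_one ((neg_sq e).trans he) hQ0
        (orbitCompl_anti (by simp) hu))))
  rw [← thetaOdd_mul_qPoch_sq hQ he] at hprod
  exact left_ne_zero_of_mul hprod

theorem analyticAt_thetaOdd (hQ0 : Q ≠ 0) (hQ : ‖Q‖ < 1) (hu : u ≠ 0) :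
    AnalyticAt ℂ (fun u => thetaOdd u Q) u :=
  AnalyticAt.fun_comp (g := fun v => theta (Q * v) (Q ^ 2)) (analyticAt_theta_const_mul
    (norm_pow_lt_one hQ two_ne_zero) hQ0 (pow_ne_zero 2 hu)) (analyticAt_id.fun_pow 2)

theorem hasDerivAt_thetaOdd (hQ0 : Q ≠ 0) (hQ : ‖Q‖ < 1) (he : e ^ 2 = Q) :
    HasDerivAt (fun u => thetaOdd u Q) (2 * qPoch (Q ^ 2) (Q ^ 2) ^ 3 / e) e := by
  have he0 : e ≠ 0 := ne_zero_pow two_ne_zero (he ▸ hQ0)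
  have hQ2 := norm_pow_lt_one hQ two_ne_zero
  have hsq : HasDerivAt (fun u : ℂ => u ^ 2 / Q) (2 * e / Q) e := by
    simpa using (hasDerivAt_pow 2 e).div_const Q
  have hone : e ^ 2 / Q = 1 := by rw [he, div_self hQ0]
  have hθ : HasDerivAt (fun u : ℂ => theta (u ^ 2 / Q) (Q ^ 2))
      (-(qPoch (Q ^ 2) (Q ^ 2) ^ 3) * (2 * e / Q)) e :=
    (hasDerivAt_theta_one hQ2).comp_of_eq e hsq hone.symm
  refine ((hsq.fun_inv (hone ▸ one_ne_zero)).fun_neg.fun_mul hθ).congr_deriv ?_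
    |>.congr_of_eventuallyEq ?_
  · rw [hone, theta_one hQ2, ← he]
    field_simp
    ring
  · filter_upwards [eventually_ne_nhds he0] with u hu
    rw [thetaOdd, ← theta_mul_left (pow_ne_zero 2 hQ0) hQ2 (div_ne_zero (pow_ne_zero 2 hu) hQ0)]
    congr 1
    field_simp

theorem hasSimplePoleAt_div_thetaOdd (hQ0 : Q ≠ 0) (hQ : ‖Q‖ < 1) (he : e ^ 2 = Q)
    {f : ℂ → ℂ} (hf : AnalyticAt ℂ f e) (hfe : f e = 0) :
    HasSimplePoleAt (fun x => f x / thetaOdd x Q) 0 e := by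
  have he0 : e ≠ 0 := ne_zero_pow two_ne_zero (he ▸ hQ0)
  have hone : Q * e ^ 2 = Q ^ 2 * 1 := by rw [he, mul_one, sq]
  have hP := qPoch_self_ne_zero (norm_pow_lt_one hQ two_ne_zero)
  have hzero : thetaOdd e Q = 0 := by
    rw [thetaOdd, hone, theta_mul_left (pow_ne_zero 2 hQ0) (norm_pow_lt_one hQ two_ne_zero)
      one_ne_zero, theta_one (norm_pow_lt_one hQ two_ne_zero), mul_zero]
  simpa only [hfe, zero_div] using hasSimplePoleAt_div hf (analyticAt_thetaOdd hQ0 hQ he0) hzero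
    (hasDerivAt_thetaOdd hQ0 hQ he)
    (div_ne_zero (mul_ne_zero two_ne_zero (pow_ne_zero 3 hP)) he0)

end ThetaOdd

section ReducedG

variable {Q e x y b : ℂ}

/-- The numerator over `j(Q x²; Q²)` in `reducedG`. -/
def oddNumerator (x y b Q : ℂ) : ℂ :=
  thetaOdd y Q * (theta (b * x) Q * (lerch (b * x) y Q - theta (-(b * x)) Q)) +
      thetaOdd b Q * (theta (x * y) Q * lerch (x * y) b Q) +
    -(qPoch Q Q ^ 3 * thetaOdd 1 Q * theta (b * y) Q * theta (b * x) Q * theta (x * y) Q /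
      (theta y Q * theta b Q)) / theta x Q

/-- The function `G`, up to a constant and a factor `x y`, in the base `Q = q²` and in the variables
`x`, `y`, `b = z / q`, in which the theta quotients of `G` become symmetric; see `G_eq_reducedG`. -/
def reducedG (x y b Q : ℂ) : ℂ :=
  (theta (b * y) Q * (lerch (b * y) x Q - theta (-(b * y)) Q) +
    oddNumerator x y b Q / thetaOdd x Q) / (thetaOdd y Q * thetaOdd b Q)

theorem theta_neg_mul_left (hQ0 : Q ≠ 0) (hQ : ‖Q‖ < 1) (hx : x ≠ 0) :
    theta (-(Q * x)) Q = x⁻¹ * theta (-x) Q := by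
  rw [← mul_neg, theta_mul_left hQ0 hQ (neg_ne_zero.2 hx), inv_neg, neg_neg]

theorem oddNumerator_mul_left (hQ0 : Q ≠ 0) (hQ : ‖Q‖ < 1) (hx : x ∈ orbitCompl Q {1})
    (hy : y ∈ orbitCompl Q {1}) (hb : b ∈ orbitCompl Q {1}) :
    oddNumerator (Q * x) y b Q = -(b * x * y)⁻¹ * oddNumerator x y b Q +
      thetaOdd y Q * (theta (b * x) Q * theta (-(b * x)) Q) / (b * x) ^ 2 +
      thetaOdd b Q * (theta (x * y) Q * theta (-(x * y)) Q) / (b * x * y) := by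
  have hx0 := hx.1
  have hy0 := hy.1
  have hb0 := hb.1
  have hbx := mul_ne_zero hb0 hx0
  have hxy := mul_ne_zero hx0 hy0
  have hθx := theta_ne_zero_of_mem hQ0 hQ hx
  have hθy := theta_ne_zero_of_mem hQ0 hQ hy
  have hθb := theta_ne_zero_of_mem hQ0 hQ hb
  rw [oddNumerator, oddNumerator, mul_left_comm b Q x, mul_assoc Q x y,
    theta_mul_left hQ0 hQ hx0, theta_mul_left hQ0 hQ hbx, theta_mul_left hQ0 hQ hxy,
    theta_neg_mul_left hQ0 hQ hbx, lerch_mul_left hQ0 hQ hbx hy, lerch_mul_left hQ0 hQ hxy hb]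
  field_simp
  ring

theorem reducedG_mul_left (hQ0 : Q ≠ 0) (hQ : ‖Q‖ < 1) (he : e ^ 2 = Q)
    (hx : x ∈ orbitCompl Q {1, e, -e}) (hy : y ∈ orbitCompl Q {1, e, -e})
    (hb : b ∈ orbitCompl Q {1, e, -e}) :
    reducedG (Q * x) y b Q = Q * x / (b * y) * (reducedG x y b Q +
        theta (b * y) Q * theta (-(b * y)) Q / (thetaOdd y Q * thetaOdd b Q)) -
      Q * x ^ 2 *
        (theta (b * x) Q * theta (-(b * x)) Q / ((b * x) ^ 2 * thetaOdd x Q * thetaOdd b Q) +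
          theta (x * y) Q * theta (-(x * y)) Q / (b * x * y * thetaOdd x Q * thetaOdd y Q)) := by
  have hone : {1} ⊆ ({1, e, -e} : Finset ℂ) := by simp
  have hodd : {e, -e} ⊆ ({1, e, -e} : Finset ℂ) := by simp
  have hx0 := hx.1
  have hy0 := hy.1
  have hb0 := hb.1
  have hWx := thetaOdd_ne_zero hQ0 hQ he (orbitCompl_anti hodd hx)
  have hWy := thetaOdd_ne_zero hQ0 hQ he (orbitCompl_anti hodd hy)
  have hWb := thetaOdd_ne_zero hQ0 hQ he (orbitCompl_anti hodd hb)
  rw [reducedG, reducedG, thetaOdd_mul_left hQ0 hQ hx0,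
    oddNumerator_mul_left hQ0 hQ (orbitCompl_anti hone hx) (orbitCompl_anti hone hy)
      (orbitCompl_anti hone hb),
    lerch_mul_right hQ0 hQ (mul_ne_zero hb0 hy0) (orbitCompl_anti hone hx)]
  field_simp
  ring

theorem analyticAt_oddNumerator_regular (hQ0 : Q ≠ 0) (hQ : ‖Q‖ < 1) (hx : x ≠ 0)
    (hy : y ∈ orbitCompl Q {1}) (hb : b ∈ orbitCompl Q {1}) :
    AnalyticAt ℂ (fun x =>
      thetaOdd y Q * (theta (b * x) Q * (lerch (b * x) y Q - theta (-(b * x)) Q)) +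
        thetaOdd b Q * (theta (x * y) Q * lerch (x * y) b Q)) x := by
  simp only [mul_comm _ y, ← neg_mul]
  exact (analyticAt_const.mul ((analyticAt_theta_const_mul hQ hb.1 hx).mul
    ((analyticAt_lerch_const_mul_left hQ0 hQ hb.1 hx hy).sub
      (analyticAt_theta_const_mul hQ (neg_ne_zero.2 hb.1) hx)))).add
    (analyticAt_const.mul ((analyticAt_theta_const_mul hQ hy.1 hx).mul
      (analyticAt_lerch_const_mul_left hQ0 hQ hy.1 hx hb)))

theorem analyticAt_oddNumerator_polar (hQ : ‖Q‖ < 1) (hx : x ≠ 0) (hy : y ≠ 0) (hb : b ≠ 0) :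
    AnalyticAt ℂ (fun x => -(qPoch Q Q ^ 3 * thetaOdd 1 Q * theta (b * y) Q * theta (b * x) Q *
      theta (x * y) Q / (theta y Q * theta b Q))) x := by
  simp only [mul_comm _ y]
  exact ((((analyticAt_const.mul (analyticAt_theta_const_mul hQ hb hx)).mul
    (analyticAt_theta_const_mul hQ hy hx))).div_const).neg

theorem analyticAt_oddNumerator (hQ0 : Q ≠ 0) (hQ : ‖Q‖ < 1) (hx : x ∈ orbitCompl Q {1})
    (hy : y ∈ orbitCompl Q {1}) (hb : b ∈ orbitCompl Q {1}) :
    AnalyticAt ℂ (fun x => oddNumerator x y b Q) x :=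
  (analyticAt_oddNumerator_regular hQ0 hQ hx.1 hy hb).add
    ((analyticAt_oddNumerator_polar hQ hx.1 hy.1 hb.1).div (analyticAt_theta hQ hx.1)
      (theta_ne_zero_of_mem hQ0 hQ hx))

theorem oddNumerator_eq_zero (hQ0 : Q ≠ 0) (hQ : ‖Q‖ < 1) (he : e ^ 2 = Q)
    (heA : e ∈ orbitCompl Q {1}) (hy : y ∈ orbitCompl Q {1}) (hb : b ∈ orbitCompl Q {1}) :
    oddNumerator e y b Q = 0 := by
  have hθe := theta_ne_zero_of_mem hQ0 hQ heA
  have hθy := theta_ne_zero_of_mem hQ0 hQ hy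
  have hθb := theta_ne_zero_of_mem hQ0 hQ hb
  have hP := qPoch_self_ne_zero hQ
  have hodd (u : ℂ) : thetaOdd u Q =
      qPoch (Q ^ 2) (Q ^ 2) / qPoch Q Q ^ 2 * (theta (e * u) Q * theta (-(e * u)) Q) := by
    field_simp
    linear_combination thetaOdd_mul_qPoch_sq hQ he u
  have hsum := lerch_add_lerch hQ0 hQ he hb hy
  rw [oddNumerator, hodd 1, hodd y, hodd b, mul_one, mul_comm b e]
  calc _ = qPoch (Q ^ 2) (Q ^ 2) / qPoch Q Q ^ 2 * theta (e * b) Q * theta (e * y) Q *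
        (theta (-(e * y)) Q * lerch (e * b) y Q + theta (-(e * b)) Q * lerch (e * y) b Q -
          (theta (-(e * y)) Q * theta (-(e * b)) Q +
            qPoch Q Q ^ 3 * theta (-e) Q * theta (b * y) Q / (theta y Q * theta b Q))) := by
        field_simp
        ring
    _ = 0 := by rw [hsum, sub_self, mul_zero]

theorem analyticAt_reducedG (hQ0 : Q ≠ 0) (hQ : ‖Q‖ < 1) (he : e ^ 2 = Q)
    (hx : x ∈ orbitCompl Q {1, e, -e}) (hy : y ∈ orbitCompl Q {1}) (hb : b ∈ orbitCompl Q {1}) :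
    AnalyticAt ℂ (fun x => reducedG x y b Q) x := by
  have hx1 : x ∈ orbitCompl Q {1} := orbitCompl_anti (by simp) hx
  exact ((analyticAt_const.mul ((analyticAt_lerch_right hQ0 hQ (mul_ne_zero hb.1 hy.1) hx1).sub
    analyticAt_const)).add ((analyticAt_oddNumerator hQ0 hQ hx1 hy hb).div
      (analyticAt_thetaOdd hQ0 hQ hx.1)
      (thetaOdd_ne_zero hQ0 hQ he (orbitCompl_anti (by simp) hx)))).div_const

theorem hasSimplePoleAt_reducedG_sqrt (hQ0 : Q ≠ 0) (hQ : ‖Q‖ < 1) (he : e ^ 2 = Q)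
    (heA : e ∈ orbitCompl Q {1}) (hy : y ∈ orbitCompl Q {1}) (hb : b ∈ orbitCompl Q {1}) :
    HasSimplePoleAt (fun x => reducedG x y b Q) 0 e := by
  have hlerch : AnalyticAt ℂ (fun x => theta (b * y) Q *
      (lerch (b * y) x Q - theta (-(b * y)) Q)) e :=
    analyticAt_const.mul ((analyticAt_lerch_right hQ0 hQ (mul_ne_zero hb.1 hy.1) heA).sub
      analyticAt_const)
  have hodd := hasSimplePoleAt_div_thetaOdd hQ0 hQ he
    (analyticAt_oddNumerator hQ0 hQ heA hy hb) (oddNumerator_eq_zero hQ0 hQ he heA hy hb)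
  simpa [reducedG, div_eq_inv_mul] using ((hasSimplePoleAt_of_analyticAt hlerch).add
    hodd).analyticAt_mul (analyticAt_const (v := (thetaOdd y Q * thetaOdd b Q)⁻¹))

theorem hasSimplePoleAt_reducedG_one (hQ0 : Q ≠ 0) (hQ : ‖Q‖ < 1) (hy : y ∈ orbitCompl Q {1})
    (hb : b ∈ orbitCompl Q {1}) : HasSimplePoleAt (fun x => reducedG x y b Q) 0 1 := by
  have hθy := theta_ne_zero_of_mem hQ0 hQ hy
  have hθb := theta_ne_zero_of_mem hQ0 hQ hb
  have hP := qPoch_self_ne_zero hQ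
  have hW1 : thetaOdd 1 Q ≠ 0 :=
    left_ne_zero_of_mul (thetaOdd_one_mul hQ0 hQ ▸ pow_ne_zero 2 hP)
  have hW := analyticAt_thetaOdd hQ0 hQ one_ne_zero
  have hlerch := (hasSimplePoleAt_lerch hQ0 hQ (mul_ne_zero hb.1 hy.1)).analyticAt_mul
    (analyticAt_const (v := theta (b * y) Q))
  have hregular := ((analyticAt_oddNumerator_regular hQ0 hQ one_ne_zero hy hb).div hW hW1).sub
    (analyticAt_const (v := theta (b * y) Q * theta (-(b * y)) Q))
  have hpolar := hasSimplePoleAt_div_theta hQ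
    ((analyticAt_oddNumerator_polar hQ one_ne_zero hy.1 hb.1).div hW hW1)
  have hbracket := (hlerch.add hpolar).add (hasSimplePoleAt_of_analyticAt hregular)
  convert (hbracket.analyticAt_mul (analyticAt_const
    (v := (thetaOdd y Q * thetaOdd b Q)⁻¹))).congr (.of_forall fun x => ?_) using 1
  · simp only [Pi.div_apply, mul_one, one_mul]
    field_simp
    ring
  · simp only [reducedG, oddNumerator, Pi.div_apply, Pi.sub_apply]
    ring

end ReducedG

section MainIdentity

variable {Q e x y b u v : ℂ}

/-- The range of the variables `y` and `b = z / q`, with `e = q`: an annulus minus the unit circle.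
It avoids the zeros of all theta functions of one variable, and the double series converge in it. -/
structure InStrip (e u : ℂ) : Prop where
  lt_norm : ‖e‖ < ‖u‖
  norm_mul_lt : ‖e * u‖ < 1
  norm_ne_one : ‖u‖ ≠ 1

theorem InStrip.mem_orbitCompl (hu : InStrip e u) (he0 : e ≠ 0) (he1 : ‖e‖ < 1) (he : e ^ 2 = Q) :
    u ∈ orbitCompl Q {1, e, -e} := by
  have hen : 0 < ‖e‖ := norm_pos_iff.2 he0
  refine ⟨norm_pos_iff.1 (hen.trans hu.lt_norm), fun a ha n h => ?_⟩
  obtain ⟨k, hk⟩ : ∃ k : ℤ, ‖u‖ = ‖e‖ ^ k := by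
    have hu' : u = e ^ (-(2 * n)) * a := by
      rw [zpow_neg, eq_inv_mul_iff_mul_eq₀ (zpow_ne_zero _ he0), ← h, ← he, zpow_mul]
      rfl
    have ha' : ‖a‖ = 1 ∨ ‖a‖ = ‖e‖ := by
      simp only [Finset.mem_insert, Finset.mem_singleton] at ha
      rcases ha with rfl | rfl | rfl <;> simp
    rcases ha' with ha' | ha'
    · exact ⟨-(2 * n), by rw [hu', norm_mul, norm_zpow, ha', mul_one]⟩
    · exact ⟨-(2 * n) + 1, by rw [hu', norm_mul, norm_zpow, ha', zpow_add_one₀ hen.ne']⟩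
  have hk1 : k < 1 := by
    rw [← zpow_lt_zpow_iff_right_of_lt_one₀ hen he1, zpow_one, ← hk]
    exact hu.lt_norm
  have hk0 : 0 < k + 1 := by
    rw [← zpow_lt_zpow_iff_right_of_lt_one₀ hen he1, zpow_zero, zpow_add_one₀ hen.ne', ← hk,
      mul_comm, ← norm_mul]
    exact hu.norm_mul_lt
  exact hu.norm_ne_one (by rw [hk, show k = 0 by omega, zpow_zero])

theorem InStrip.norm_sq_lt (hu : InStrip e u) (he0 : e ≠ 0) (he : e ^ 2 = Q) :
    ‖Q ^ 2‖ < ‖Q * u ^ 2‖ := by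
  have : 0 < ‖e‖ := norm_pos_iff.2 he0
  have := hu.lt_norm
  rw [← he, sq (e ^ 2), norm_mul, norm_mul, norm_pow, norm_pow]
  gcongr

theorem InStrip.norm_mul_sq_lt_one (hu : InStrip e u) (he : e ^ 2 = Q) : ‖Q * u ^ 2‖ < 1 := by
  rw [← he, ← mul_pow, norm_pow]
  exact pow_lt_one₀ (norm_nonneg _) hu.norm_mul_lt two_ne_zero

theorem mul_sq_mem_orbitCompl (hQ0 : Q ≠ 0) (he : e ^ 2 = Q) (hx : x ∈ orbitCompl Q {e, -e}) :
    Q * x ^ 2 ∈ orbitCompl (Q ^ 2) {1} := by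
  have hplus := mem_orbitCompl_one.1
    (mul_mem_orbitCompl_one he hQ0 (orbitCompl_anti (A := {e}) (by simp) hx))
  have hminus := mem_orbitCompl_one.1 (mul_mem_orbitCompl_one ((neg_sq e).trans he) hQ0
    (orbitCompl_anti (A := {-e}) (by simp) hx))
  refine mem_orbitCompl_one.2 ⟨mul_ne_zero hQ0 (pow_ne_zero 2 hx.1), fun n h => ?_⟩
  have hsq : (Q ^ n * (e * x)) ^ 2 = 1 := by
    rw [← h, mul_pow, mul_pow, he, ← zpow_natCast (Q ^ n), zpow_comm, zpow_natCast]
  rcases sq_eq_sq_iff_eq_or_eq_neg.1 (hsq.trans (one_pow 2).symm) with h1 | h1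
  · exact hplus.2 n h1
  · exact hminus.2 n (by rw [neg_mul, mul_neg, h1, neg_neg])

/-- Kronecker's identity in the form in which the inhomogeneous terms of the functional equation of
`reducedF` match those of `reducedG`. -/
theorem fracSum_odd_eq (hQ0 : Q ≠ 0) (hQ : ‖Q‖ < 1) (he : e ^ 2 = Q) (hu : InStrip e u)
    (hv : v ∈ orbitCompl Q {e, -e}) :
    fracSum (fun n => (Q * u ^ 2) ^ n) (Q ^ 2) (Q * v ^ 2) =
      -(qPoch (Q ^ 2) (Q ^ 2) ^ 4 / qPoch Q Q ^ 2 * (theta (u * v) Q * theta (-(u * v)) Q) /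
        ((u * v) ^ 2 * thetaOdd u Q * thetaOdd v Q)) := by
  have he0 : e ≠ 0 := ne_zero_pow two_ne_zero (he ▸ hQ0)
  have hu0 : u ≠ 0 := norm_pos_iff.1 ((norm_nonneg e).trans_lt hu.lt_norm)
  have hv0 := hv.1
  have hQ2 := norm_pow_lt_one hQ two_ne_zero
  have hP := qPoch_self_ne_zero hQ
  rw [fracSum_zpow_eq (pow_ne_zero 2 hQ0) hQ2 (hu.norm_sq_lt he0 he) (hu.norm_mul_sq_lt_one he)
      (mul_sq_mem_orbitCompl hQ0 he hv), ← thetaOdd, ← thetaOdd,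
    show Q * u ^ 2 * (Q * v ^ 2) = Q ^ 2 * (u * v) ^ 2 by ring,
    theta_mul_left (pow_ne_zero 2 hQ0) hQ2 (pow_ne_zero 2 (mul_ne_zero hu0 hv0)),
    eq_div_of_mul_eq (pow_ne_zero 2 hP) (theta_sq_mul hQ (u * v))]
  field_simp

/-- The function `F`, up to a factor `q`, in the base `Q = q²` and in the variables `x`, `y`,
`b = z / q`; see `F_eq_reducedF`. -/
def reducedF (x y b Q : ℂ) : ℂ :=
  b * pairSum (Q ^ 2) (Q * x ^ 2) (Q * y ^ 2) (Q * b ^ 2) +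
    x * y * pairSum (Q ^ 2) (Q * x ^ 2) (Q * y ^ 2) (Q ^ 2 * (Q * b ^ 2))

theorem reducedF_mul_left (hQ0 : Q ≠ 0) (hQ : ‖Q‖ < 1) (he : e ^ 2 = Q)
    (hx : x ∈ orbitCompl Q {e, -e}) (hy : InStrip e y) (hb : InStrip e b) :
    reducedF (Q * x) y b Q = x / (b * y) * reducedF x y b Q +
      qPoch (Q ^ 2) (Q ^ 2) ^ 4 / qPoch Q Q ^ 2 *
        (theta (b * x) Q * theta (-(b * x)) Q / (b ^ 2 * x * y * thetaOdd x Q * thetaOdd b Q) +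
          theta (x * y) Q * theta (-(x * y)) Q / (b * y ^ 2 * thetaOdd x Q * thetaOdd y Q) -
          theta (b * y) Q * theta (-(b * y)) Q / (b * y ^ 2 * thetaOdd y Q * thetaOdd b Q)) := by
  have he0 : e ≠ 0 := ne_zero_pow two_ne_zero (he ▸ hQ0)
  have he1 := norm_lt_one_of_sq_eq hQ he
  have hQ20 : Q ^ 2 ≠ 0 := pow_ne_zero 2 hQ0
  have hQ2 := norm_pow_lt_one hQ two_ne_zero
  have hX := mul_sq_mem_orbitCompl hQ0 he hx
  have hbA : b ∈ orbitCompl Q {e, -e} := orbitCompl_anti (by simp) (hb.mem_orbitCompl he0 he1 he)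
  have hb0 := hbA.1
  have hx0 := hx.1
  have hy0 : y ≠ 0 := (hy.mem_orbitCompl he0 he1 he).1
  rw [reducedF, reducedF, show Q * (Q * x) ^ 2 = Q ^ 2 * (Q * x ^ 2) by ring,
    pairSum_shift_left hQ20 hQ2 hX (hy.norm_sq_lt he0 he) (hy.norm_mul_sq_lt_one he)
      (hb.norm_sq_lt he0 he) (hb.norm_mul_sq_lt_one he),
    pairSum_shift_right hQ20 hQ2 hX (hy.norm_sq_lt he0 he) (hy.norm_mul_sq_lt_one he)
      (hb.norm_sq_lt he0 he) (hb.norm_mul_sq_lt_one he),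
    pairSum_zero_eq hQ20 hQ2 (hy.norm_sq_lt he0 he) (hy.norm_mul_sq_lt_one he)
      (hb.norm_sq_lt he0 he) (hb.norm_mul_sq_lt_one he),
    fracSum_odd_eq hQ0 hQ he hb hx, fracSum_odd_eq hQ0 hQ he hy hx,
    fracSum_odd_eq hQ0 hQ he hy hbA, mul_comm y b, mul_comm y x]
  field_simp
  ring

theorem analyticAt_reducedF (hQ0 : Q ≠ 0) (hQ : ‖Q‖ < 1) (he : e ^ 2 = Q) (hx : x ≠ 0)
    (hX : ∀ n : ℤ, n ≠ -1 → (Q ^ 2) ^ n * (Q * x ^ 2) ≠ 1) (hy : InStrip e y) (hb : InStrip e b) :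
    AnalyticAt ℂ (fun x => reducedF x y b Q) x := by
  have he0 : e ≠ 0 := ne_zero_pow two_ne_zero (he ▸ hQ0)
  have hQ20 : Q ^ 2 ≠ 0 := pow_ne_zero 2 hQ0
  have hQ2 := norm_pow_lt_one hQ two_ne_zero
  have hlt := norm_sq_lt_norm hQ20 hQ2
  have hb1 := hb.norm_mul_sq_lt_one he
  have hsq : AnalyticAt ℂ (fun x : ℂ => Q * x ^ 2) x := by fun_prop
  have hsum {a : ℂ} (ha : ‖Q ^ 2‖ ^ 2 < ‖a‖) (ha1 : ‖a‖ < 1) :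
      AnalyticAt ℂ (fun x => pairSum (Q ^ 2) (Q * x ^ 2) (Q * y ^ 2) a) x :=
    AnalyticAt.fun_comp (g := fun X => pairSum (Q ^ 2) X (Q * y ^ 2) a)
      (analyticAt_pairSum hQ20 hQ2 (mul_ne_zero hQ0 (pow_ne_zero 2 hx)) hX
        (hlt.trans (hy.norm_sq_lt he0 he)) (hy.norm_mul_sq_lt_one he) ha ha1) hsq
  refine (analyticAt_const.mul (hsum (hlt.trans (hb.norm_sq_lt he0 he)) hb1)).add
    ((analyticAt_id.mul analyticAt_const).mul (hsum ?_ ?_))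
  · rw [sq ‖Q ^ 2‖, norm_mul]
    exact mul_lt_mul_of_pos_left (hb.norm_sq_lt he0 he) (norm_pos_iff.2 hQ20)
  · rw [norm_mul]
    exact mul_lt_one_of_nonneg_of_lt_one_left (norm_nonneg _) hQ2 hb1.le

theorem zpow_mul_ne_of_sq (hQ0 : Q ≠ 0) (hQ : ‖Q‖ < 1) {a : ℂ} (ha : a ^ 2 = 1 ∨ a ^ 2 = Q) (n : ℤ)
    (hn : n ≠ -1) : (Q ^ 2) ^ n * (Q * a ^ 2) ≠ 1 := by
  rcases ha with ha | ha
  · have hpow : (Q ^ 2) ^ n * (Q * a ^ 2) = Q ^ (2 * n + 1) := by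
      rw [ha, mul_one, zpow_add_one₀ hQ0, zpow_mul]
      rfl
    exact hpow ▸ zpow_ne_one_of_norm_lt_one hQ (by omega)
  · have hpow : (Q ^ 2) ^ n * (Q * a ^ 2) = (Q ^ 2) ^ (n + 1) := by
      rw [ha, zpow_add_one₀ (pow_ne_zero 2 hQ0), sq Q]
    exact hpow ▸ zpow_ne_one_of_norm_lt_one (norm_pow_lt_one hQ two_ne_zero) (by omega)

/-- The combination of `reducedF` and `reducedG` whose vanishing is the identity `F = G`. -/
def defect (x y b Q : ℂ) : ℂ :=
  x * y * reducedF x y b Q + qPoch (Q ^ 2) (Q ^ 2) ^ 4 / qPoch Q Q ^ 2 * reducedG x y b Q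

theorem defect_mul_left (hQ0 : Q ≠ 0) (hQ : ‖Q‖ < 1) (he : e ^ 2 = Q)
    (hx : x ∈ orbitCompl Q {1, e, -e}) (hy : InStrip e y) (hb : InStrip e b) :
    defect (Q * x) y b Q = Q / (b * y) * x * defect x y b Q := by
  have he0 : e ≠ 0 := ne_zero_pow two_ne_zero (he ▸ hQ0)
  have he1 := norm_lt_one_of_sq_eq hQ he
  have hyA := hy.mem_orbitCompl he0 he1 he
  have hbA := hb.mem_orbitCompl he0 he1 he
  have hodd {v : ℂ} (hv : v ∈ orbitCompl Q {1, e, -e}) : thetaOdd v Q ≠ 0 :=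
    thetaOdd_ne_zero hQ0 hQ he (orbitCompl_anti (by simp) hv)
  have hx0 := hx.1
  have hy0 := hyA.1
  have hb0 := hbA.1
  have hP := qPoch_self_ne_zero hQ
  have hWx := hodd hx
  have hWy := hodd hyA
  have hWb := hodd hbA
  rw [defect, defect, reducedF_mul_left hQ0 hQ he (orbitCompl_anti (by simp) hx) hy hb,
    reducedG_mul_left hQ0 hQ he hx hyA hbA]
  field_simp
  ring

theorem analyticAt_defect (hQ0 : Q ≠ 0) (hQ : ‖Q‖ < 1) (he : e ^ 2 = Q)
    (hx : x ∈ orbitCompl Q {1, e, -e}) (hy : InStrip e y) (hb : InStrip e b) :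
    AnalyticAt ℂ (fun x => defect x y b Q) x := by
  have he0 : e ≠ 0 := ne_zero_pow two_ne_zero (he ▸ hQ0)
  have he1 := norm_lt_one_of_sq_eq hQ he
  have hX := mem_orbitCompl_one.1
    (mul_sq_mem_orbitCompl hQ0 he (orbitCompl_anti (B := {1, e, -e}) (by simp) hx))
  exact ((analyticAt_id.mul analyticAt_const).mul
    (analyticAt_reducedF hQ0 hQ he hx.1 (fun n _ => hX.2 n) hy hb)).add
      (analyticAt_const.mul (analyticAt_reducedG hQ0 hQ he hx
        (orbitCompl_anti (by simp) (hy.mem_orbitCompl he0 he1 he))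
        (orbitCompl_anti (by simp) (hb.mem_orbitCompl he0 he1 he))))

theorem hasSimplePoleAt_defect (hQ0 : Q ≠ 0) (hQ : ‖Q‖ < 1) (he : e ^ 2 = Q) {a : ℂ}
    (ha : a ^ 2 = 1 ∨ a ^ 2 = Q) (hy : InStrip e y) (hb : InStrip e b)
    (hG : HasSimplePoleAt (fun x => reducedG x y b Q) 0 a) :
    HasSimplePoleAt (fun x => defect x y b Q) 0 a := by
  have ha0 : a ≠ 0 :=
    ne_zero_pow two_ne_zero (ha.elim (fun h => h ▸ one_ne_zero) fun h => h ▸ hQ0)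
  have hF : AnalyticAt ℂ (fun x => x * y * reducedF x y b Q) a :=
    (analyticAt_id.mul analyticAt_const).mul
      (analyticAt_reducedF hQ0 hQ he ha0 (zpow_mul_ne_of_sq hQ0 hQ ha) hy hb)
  simpa [defect] using (hasSimplePoleAt_of_analyticAt hF).add (hG.analyticAt_mul
    (analyticAt_const (v := qPoch (Q ^ 2) (Q ^ 2) ^ 4 / qPoch Q Q ^ 2)))

theorem defect_eq_zero (hQ0 : Q ≠ 0) (hQ : ‖Q‖ < 1) (he : e ^ 2 = Q)
    (hx : x ∈ orbitCompl Q {1, e, -e}) (hy : InStrip e y) (hb : InStrip e b) :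
    defect x y b Q = 0 := by
  have he0 : e ≠ 0 := ne_zero_pow two_ne_zero (he ▸ hQ0)
  have he1 := norm_lt_one_of_sq_eq hQ he
  have hyA := hy.mem_orbitCompl he0 he1 he
  have hbA := hb.mem_orbitCompl he0 he1 he
  have hy1 : y ∈ orbitCompl Q {1} := orbitCompl_anti (by simp) hyA
  have hb1 : b ∈ orbitCompl Q {1} := orbitCompl_anti (by simp) hbA
  have hone := hasSimplePoleAt_defect hQ0 hQ he (.inl (one_pow 2)) hy hb
    (hasSimplePoleAt_reducedG_one hQ0 hQ hy1 hb1)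
  have hsqrt {a : ℂ} (ha : a ^ 2 = Q) := hasSimplePoleAt_defect hQ0 hQ he (.inr ha) hy hb
    (hasSimplePoleAt_reducedG_sqrt hQ0 hQ ha (mem_orbitCompl_one_of_sq_eq hQ0 hQ ha) hy1 hb1)
  have hpoles : ∀ a ∈ ({1, e, -e} : Finset ℂ), HasSimplePoleAt (fun x => defect x y b Q) 0 a := by
    simp only [Finset.forall_mem_insert, Finset.mem_singleton, forall_eq]
    exact ⟨hone, hsqrt he, hsqrt ((neg_sq e).trans he)⟩
  exact eq_zero_of_linear_multiplier (c := Q / (b * y)) (f := fun x => defect x y b Q) hQ0 hQ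
    (div_ne_zero hQ0 (mul_ne_zero hbA.1 hyA.1))
    (fun u hu => analyticAt_defect hQ0 hQ he hu hy hb) hpoles (by simp [he0])
    (fun u hu => defect_mul_left hQ0 hQ he hu hy hb) hx

end MainIdentity

section Translation

variable {Q q u x y b X : ℂ}

theorem pairTerm₂_eq (hq0 : q ≠ 0) (x y z : ℂ) :
    pairTerm₂ q x y z = pairTerm₁ q x y (q ^ 2 * z) := by
  ext ⟨s, t⟩
  have hexp : (q ^ 2 * z) ^ (2 * t) = q ^ (4 * t) * z ^ (2 * t) := by
    rw [mul_zpow, ← zpow_natCast, ← zpow_mul]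
    ring_nf
  simp only [pairTerm₁, pairTerm₂]
  rw [hexp, zpow_add₀ hq0 _ (4 * t)]
  ring

theorem indicator_pairTerm₁ (hq0 : q ≠ 0) (x y z : ℂ) :
    pairIndex.indicator (pairTerm₁ q x y z) = fun p =>
      pairWeight p * pairFrac (q ^ 4) (q ^ 2 * x ^ 2) (q ^ 2 * y ^ 2) (z ^ 2) p := by
  ext ⟨s, t⟩
  by_cases hp : sg s = sg t
  · rw [Set.indicator_of_mem (show (s, t) ∈ pairIndex from hp), pairTerm₁, pairWeight, if_pos hp,
      pairFrac]
    simp only [mul_zpow, ← zpow_natCast, ← zpow_mul]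
    rw [show 4 * s * t + 2 * s = 4 * (s * t) + 2 * s by ring, zpow_add₀ hq0 (4 * (s * t)),
      show 4 * s + 4 * t + 2 = 4 * (s + t) + 2 by ring, zpow_add₀ hq0 _ 2]
    push_cast
    ring_nf
  · rw [Set.indicator_of_notMem (show (s, t) ∉ pairIndex from hp), pairWeight, if_neg hp, zero_mul]

theorem F_eq_pairSum (hq0 : q ≠ 0) (x y z : ℂ) : F q x y z =
    z * pairSum (q ^ 4) (q ^ 2 * x ^ 2) (q ^ 2 * y ^ 2) (z ^ 2) +
      x * y * q * pairSum (q ^ 4) (q ^ 2 * x ^ 2) (q ^ 2 * y ^ 2) (q ^ 4 * z ^ 2) := by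
  rw [F, pairTerm₂_eq hq0, tsum_subtype pairIndex, tsum_subtype pairIndex,
    indicator_pairTerm₁ hq0, indicator_pairTerm₁ hq0, mul_pow, ← pow_mul]
  rfl

theorem F_eq_reducedF (hq0 : q ≠ 0) (x y b : ℂ) :
    F q x y (q * b) = q * reducedF x y b (q ^ 2) := by
  rw [F_eq_pairSum hq0, reducedF, ← pow_mul, mul_pow]
  ring_nf

theorem theta_sq_mul_appellLerch (hQ0 : Q ≠ 0) (hQ : ‖Q‖ < 1) (hu : theta (-u) Q ≠ 0) (X : ℂ) :
    theta (u ^ 2) (Q ^ 2) * appellLerch X Q (-u) =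
      qPoch (Q ^ 2) (Q ^ 2) / qPoch Q Q ^ 2 * (theta u Q * lerch u (X * -u / Q) Q) := by
  have hP := qPoch_self_ne_zero hQ
  have hsq := theta_sq_mul hQ u
  rw [appellLerch_eq hQ0, neg_neg]
  generalize lerch u (X * -u / Q) Q = l
  field_simp
  linear_combination l * hsq

theorem theta_mul_lerch_mul_left (hQ0 : Q ≠ 0) (hQ : ‖Q‖ < 1) (hX : X ≠ 0)
    (hb : b ∈ orbitCompl Q {1}) :
    theta (Q * X) Q * lerch (Q * X) b Q =
      -(X * b)⁻¹ * (theta X Q * (lerch X b Q - theta (-X) Q)) := by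
  rw [theta_mul_left hQ0 hQ hX, lerch_mul_left hQ0 hQ hX hb, mul_inv]
  ring

theorem theta_mul_theta_neg_mul (hq0 : q ≠ 0) (hq : ‖q‖ < 1) (hx : x ≠ 0) :
    theta x q * theta (-(q * x)) (q ^ 2) =
      J q 1 / J q 4 * (theta x (q ^ 2) * thetaOdd x (q ^ 2)) := by
  have hq2 := norm_pow_lt_one hq two_ne_zero
  have hP := qPoch_self_ne_zero hq2
  have hP4 : qPoch ((q ^ 2) ^ 2) ((q ^ 2) ^ 2) ≠ 0 :=
    qPoch_self_ne_zero (norm_pow_lt_one hq2 two_ne_zero)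
  have hsplit := theta_mul_qPoch_sq hq0 hq hx
  have hodd := thetaOdd_mul_qPoch_sq hq2 rfl x
  rw [J, J, pow_one, show q ^ 4 = (q ^ 2) ^ 2 by ring]
  generalize qPoch ((q ^ 2) ^ 2) ((q ^ 2) ^ 2) = P₄ at *
  field_simp
  refine mul_right_cancel₀ (pow_ne_zero 2 hP) ?_
  linear_combination P₄ * theta (-(q * x)) (q ^ 2) * hsplit -
    qPoch q q * theta x (q ^ 2) * hodd

theorem lerch_term_eq (hQ0 : Q ≠ 0) (hQ : ‖Q‖ < 1) (hu0 : u ≠ 0) (hu : theta (-u) Q ≠ 0)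
    (hX : X * -(Q * u) / Q = b) (hb : b ∈ orbitCompl Q {1}) :
    theta ((Q * u) ^ 2) (Q ^ 2) * appellLerch X Q (-(Q * u)) =
      -(qPoch (Q ^ 2) (Q ^ 2) / qPoch Q Q ^ 2 / (u * b)) *
        (theta u Q * (lerch u b Q - theta (-u) Q)) := by
  have hQu : theta (-(Q * u)) Q ≠ 0 :=
    theta_neg_mul_left hQ0 hQ hu0 ▸ mul_ne_zero (inv_ne_zero hu0) hu
  rw [theta_sq_mul_appellLerch hQ0 hQ hQu, hX, theta_mul_lerch_mul_left hQ0 hQ hu0 hb]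
  ring

theorem theta_quotient_eq (hq0 : q ≠ 0) (hq : ‖q‖ < 1) (hx : x ∈ orbitCompl (q ^ 2) {1, q, -q})
    (hy : y ∈ orbitCompl (q ^ 2) {1, q, -q}) (hb : b ∈ orbitCompl (q ^ 2) {1, q, -q}) :
    q * b * (J q 1 ^ 3 * J q 2 ^ 3 / (theta x q * theta y q * theta (q * b) q)) *
        (theta (x * y) (q ^ 2) * theta (q ^ 2 * (b * x)) (q ^ 2) * theta (q ^ 2 * (b * y)) (q ^ 2) /
          (theta (-(q * x)) (q ^ 2) * theta (-(q * y)) (q ^ 2) * theta (-(q * b)) (q ^ 2))) =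
      -(q / (x * y)) * (J q 2 ^ 3 * J q 4 ^ 3 *
        (theta (b * y) (q ^ 2) * theta (b * x) (q ^ 2) * theta (x * y) (q ^ 2)) /
        (theta x (q ^ 2) * theta y (q ^ 2) * theta b (q ^ 2) *
          (thetaOdd x (q ^ 2) * thetaOdd y (q ^ 2) * thetaOdd b (q ^ 2)))) := by
  have hQ0 := pow_ne_zero 2 hq0
  have hQ := norm_pow_lt_one hq two_ne_zero
  have hx0 := hx.1
  have hy0 := hy.1
  have hb0 := hb.1
  have hJ1 : J q 1 ≠ 0 := qPoch_self_ne_zero (norm_pow_lt_one hq one_ne_zero)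
  have hdenom (u : ℂ) (hu : u ∈ orbitCompl (q ^ 2) {1, q, -q}) :=
    theta_mul_theta_neg_mul hq0 hq hu.1
  have hcoeff : -(q * b ^ 2 * (J q 1 ^ 3 * J q 2 ^ 3)) / (J q 1 / J q 4) ^ 3 *
      ((b * x)⁻¹ * (b * y)⁻¹) = -(q / (x * y)) * (J q 2 ^ 3 * J q 4 ^ 3) := by
    field_simp
  calc _ = -(q * b ^ 2 * (J q 1 ^ 3 * J q 2 ^ 3)) *
        (theta (x * y) (q ^ 2) * theta (q ^ 2 * (b * x)) (q ^ 2) *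
          theta (q ^ 2 * (b * y)) (q ^ 2)) /
        (theta x q * theta (-(q * x)) (q ^ 2) * (theta y q * theta (-(q * y)) (q ^ 2)) *
          (theta b q * theta (-(q * b)) (q ^ 2))) := by
        rw [theta_mul_left hq0 hq hb0]
        field_simp
    _ = _ := by
        rw [hdenom x hx, hdenom y hy, hdenom b hb, theta_mul_left hQ0 hQ (mul_ne_zero hb0 hx0),
          theta_mul_left hQ0 hQ (mul_ne_zero hb0 hy0)]
        linear_combination hcoeff * (theta (b * y) (q ^ 2) * theta (b * x) (q ^ 2) *
          theta (x * y) (q ^ 2) / (theta x (q ^ 2) * theta y (q ^ 2) * theta b (q ^ 2) *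
            (thetaOdd x (q ^ 2) * thetaOdd y (q ^ 2) * thetaOdd b (q ^ 2))))

theorem G_eq_theta_sq_mul (q x y b : ℂ) : G q x y (q * b) =
    q * b * (J q 4 ^ 3 / (thetaOdd y (q ^ 2) * thetaOdd b (q ^ 2))) *
        (theta ((q ^ 2 * (b * y)) ^ 2) ((q ^ 2) ^ 2) *
          appellLerch (-(q * x / (y * (q * b)))) (q ^ 2) (-(q ^ 2 * (b * y)))) +
      q * b * (J q 4 ^ 3 / (thetaOdd x (q ^ 2) * thetaOdd b (q ^ 2))) *
        (theta ((q ^ 2 * (b * x)) ^ 2) ((q ^ 2) ^ 2) *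
          appellLerch (-(q * y / (x * (q * b)))) (q ^ 2) (-(q ^ 2 * (b * x)))) -
      q * b * (J q 1 ^ 3 * J q 2 ^ 3 / (theta x q * theta y q * theta (q * b) q)) *
        (theta (x * y) (q ^ 2) * theta (q ^ 2 * (b * x)) (q ^ 2) * theta (q ^ 2 * (b * y)) (q ^ 2) /
          (theta (-(q * x)) (q ^ 2) * theta (-(q * y)) (q ^ 2) * theta (-(q * b)) (q ^ 2))) -
      q / (x * y) * (J q 4 ^ 3 / (thetaOdd x (q ^ 2) * thetaOdd y (q ^ 2))) *
        (theta ((x * y) ^ 2) ((q ^ 2) ^ 2) *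
          appellLerch (-(q * (q * b) / (x * y))) (q ^ 2) (-(x * y))) := by
  have hodd (u : ℂ) : thetaOdd u (q ^ 2) = theta (q ^ 2 * u ^ 2) (q ^ 4) := by
    rw [thetaOdd, ← pow_mul]
  have hprod (u : ℂ) : q * u * (q * b) = q ^ 2 * (b * u) := by ring
  have hsq (u : ℂ) : q ^ 2 * u ^ 2 * (q * b) ^ 2 = (q ^ 2 * (b * u)) ^ 2 := by ring
  rw [G, hprod, hprod, hsq, hsq, hodd, hodd, hodd, ← pow_mul, mul_pow q b, mul_pow x y,
    mul_comm x q, mul_comm y q]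
  ring

theorem G_eq_reducedG (hq0 : q ≠ 0) (hq : ‖q‖ < 1) (hx : x ∈ orbitCompl (q ^ 2) {1, q, -q})
    (hy : y ∈ orbitCompl (q ^ 2) {1, q, -q}) (hb : b ∈ orbitCompl (q ^ 2) {1, q, -q})
    (hby : theta (-(b * y)) (q ^ 2) ≠ 0) (hbx : theta (-(b * x)) (q ^ 2) ≠ 0)
    (hxy : theta (-(x * y)) (q ^ 2) ≠ 0) :
    G q x y (q * b) = -(q / (x * y)) *
      (qPoch ((q ^ 2) ^ 2) ((q ^ 2) ^ 2) ^ 4 / qPoch (q ^ 2) (q ^ 2) ^ 2 *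
        reducedG x y b (q ^ 2)) := by
  have hQ0 := pow_ne_zero 2 hq0
  have hQ := norm_pow_lt_one hq two_ne_zero
  have hx0 := hx.1
  have hy0 := hy.1
  have hb0 := hb.1
  have hJ2 : J q 2 ≠ 0 := qPoch_self_ne_zero hQ
  have hJ4 : J q 4 ≠ 0 := qPoch_self_ne_zero (norm_pow_lt_one hq four_ne_zero)
  have hP2 : qPoch (q ^ 2) (q ^ 2) = J q 2 := rfl
  have hP4 : qPoch ((q ^ 2) ^ 2) ((q ^ 2) ^ 2) = J q 4 := by rw [J, ← pow_mul]
  have hone {u : ℂ} (hu : u ∈ orbitCompl (q ^ 2) {1, q, -q}) : u ∈ orbitCompl (q ^ 2) {1} :=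
    orbitCompl_anti (by simp) hu
  have hWx := thetaOdd_ne_zero hQ0 hQ rfl (orbitCompl_anti (by simp) hx)
  have hWy := thetaOdd_ne_zero hQ0 hQ rfl (orbitCompl_anti (by simp) hy)
  have hWb := thetaOdd_ne_zero hQ0 hQ rfl (orbitCompl_anti (by simp) hb)
  have hW1 : thetaOdd 1 (q ^ 2) = J q 2 ^ 2 / J q 4 :=
    eq_div_of_mul_eq hJ4 (hP4 ▸ thetaOdd_one_mul hQ0 hQ)
  rw [G_eq_theta_sq_mul, lerch_term_eq hQ0 hQ (mul_ne_zero hb0 hy0) hby (by field_simp) (hone hx),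
    lerch_term_eq hQ0 hQ (mul_ne_zero hb0 hx0) hbx (by field_simp) (hone hy),
    theta_quotient_eq hq0 hq hx hy hb, theta_sq_mul_appellLerch hQ0 hQ hxy,
    show -(q * (q * b) / (x * y)) * -(x * y) / q ^ 2 = b by field_simp, hP2, hP4, reducedG,
    oddNumerator, hP2, hW1]
  generalize theta (b * y) (q ^ 2) * (lerch (b * y) x (q ^ 2) - theta (-(b * y)) (q ^ 2)) = A,
    theta (b * x) (q ^ 2) * (lerch (b * x) y (q ^ 2) - theta (-(b * x)) (q ^ 2)) = B,
    theta (x * y) (q ^ 2) * lerch (x * y) b (q ^ 2) = D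
  generalize theta x (q ^ 2) = θx, theta y (q ^ 2) = θy, theta b (q ^ 2) = θb,
    thetaOdd x (q ^ 2) = ωx, thetaOdd y (q ^ 2) = ωy, thetaOdd b (q ^ 2) = ωb at *
  field_simp
  ring

end Translation

section DoubleSum

variable {q u x y z : ℂ}

/-- The open annulus `‖q‖ < ‖u‖ < 1`, a fundamental annulus for `u ↦ q u` without its boundary. -/
structure InAnnulus (q u : ℂ) : Prop where
  lt_norm : ‖q‖ < ‖u‖
  norm_lt_one : ‖u‖ < 1

theorem InAnnulus.ne_zero (hu : InAnnulus q u) : u ≠ 0 :=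
  norm_pos_iff.1 ((norm_nonneg q).trans_lt hu.lt_norm)

theorem InAnnulus.inStrip (hu : InAnnulus q u) : InStrip q u where
  lt_norm := hu.lt_norm
  norm_mul_lt := by
    rw [norm_mul]
    exact mul_lt_one_of_nonneg_of_lt_one_left (norm_nonneg q) (hu.lt_norm.trans hu.norm_lt_one)
      hu.norm_lt_one.le
  norm_ne_one := hu.norm_lt_one.ne

theorem InAnnulus.inStrip_div (hq0 : q ≠ 0) (hu : InAnnulus q u) : InStrip q (u / q) where
  lt_norm := by
    rw [norm_div, lt_div_iff₀ (norm_pos_iff.2 hq0)]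
    exact (mul_lt_of_lt_one_right (norm_pos_iff.2 hq0)
      (hu.lt_norm.trans hu.norm_lt_one)).trans hu.lt_norm
  norm_mul_lt := by rw [mul_div_cancel₀ u hq0]; exact hu.norm_lt_one
  norm_ne_one := by
    rw [norm_div]
    exact ((one_lt_div (norm_pos_iff.2 hq0)).2 hu.lt_norm).ne'

theorem mem_orbitCompl_sq_iff (hq0 : q ≠ 0) {A : Finset ℂ} :
    x ∈ orbitCompl (q ^ 2) A ↔ x ≠ 0 ∧ ∀ a ∈ A, ∀ n : ℤ, x ≠ a * q ^ (2 * n) := by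
  have key (a : ℂ) (n : ℤ) : (q ^ 2) ^ n * x = a ↔ x = a * q ^ (2 * -n) := by
    rw [mul_neg, zpow_neg, zpow_mul, eq_mul_inv_iff_mul_eq₀ (zpow_ne_zero n (zpow_ne_zero 2 hq0)),
      mul_comm x]
    rfl
  refine and_congr_right fun _ => forall₂_congr fun a _ => ?_
  exact (forall_congr' fun n => not_congr (key a n)).trans
    ((Equiv.neg ℤ).forall_congr_right (q := fun n => x ≠ a * q ^ (2 * n)))

theorem mem_orbitCompl_odd_iff (hq0 : q ≠ 0) : x ∈ orbitCompl (q ^ 2) {q, -q} ↔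
    x ≠ 0 ∧ ∀ n : ℤ, x ≠ q ^ (2 * n + 1) ∧ x ≠ -q ^ (2 * n + 1) := by
  simp only [mem_orbitCompl_sq_iff hq0, Finset.forall_mem_insert, Finset.mem_singleton, forall_eq,
    ← forall_and, neg_mul, zpow_add_one₀ hq0, mul_comm q]

theorem theta_neg_ne_zero (hq0 : q ≠ 0) (hq : ‖q‖ < 1) (hu0 : u ≠ 0)
    (hu : ∀ n : ℤ, u ≠ -q ^ (2 * n)) : theta (-u) (q ^ 2) ≠ 0 := by
  refine theta_ne_zero_of_mem (pow_ne_zero 2 hq0) (norm_pow_lt_one hq two_ne_zero)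
    ((mem_orbitCompl_sq_iff hq0).2 ⟨neg_ne_zero.2 hu0, ?_⟩)
  simpa [neg_eq_iff_eq_neg] using hu

theorem F_eq_G (hq0 : q ≠ 0) (hx : x ∈ orbitCompl (q ^ 2) {q, -q}) (hy : InAnnulus q y)
    (hz : InAnnulus q z) (hr : (x, y, z) ∈ regularSet q) : F q x y z = G q x y z := by
  have hq := hy.lt_norm.trans hy.norm_lt_one
  have hQ0 := pow_ne_zero 2 hq0
  have hQ := norm_pow_lt_one hq two_ne_zero
  obtain ⟨b, rfl⟩ : ∃ b, z = q * b := ⟨z / q, (mul_div_cancel₀ z hq0).symm⟩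
  have hb : InStrip q b := by simpa only [mul_div_cancel_left₀ b hq0] using hz.inStrip_div hq0
  have hyA := hy.inStrip.mem_orbitCompl hq0 hq rfl
  have hbA := hb.mem_orbitCompl hq0 hq rfl
  have hxA : x ∈ orbitCompl (q ^ 2) {1, q, -q} := by
    refine ⟨hx.1, Finset.forall_mem_insert .. |>.2 ⟨?_, hx.2⟩⟩
    refine ((mem_orbitCompl_sq_iff hq0 (A := {1})).2 ⟨hx.1, ?_⟩).2 1 (by simp)
    simpa using fun n => (hr n).1
  have hodd {v : ℂ} (hv0 : v ≠ 0) (hv : ∀ n : ℤ, v * (q * b) ≠ -q ^ (2 * n + 1)) :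
      theta (-(b * v)) (q ^ 2) ≠ 0 := by
    refine theta_neg_ne_zero hq0 hq (mul_ne_zero hbA.1 hv0) fun n h => hv n ?_
    rw [zpow_add_one₀ hq0]
    linear_combination q * h
  have hby := hodd hy.ne_zero fun n => (hr n).2.1
  have hbx := hodd hx.1 fun n => (hr n).2.2.1
  have hxy := theta_neg_ne_zero hq0 hq (mul_ne_zero hx.1 hy.ne_zero) fun n => (hr n).2.2.2
  have hdefect := defect_eq_zero hQ0 hQ rfl hxA hy.inStrip hb
  rw [defect, add_eq_zero_iff_eq_neg'] at hdefect
  rw [F_eq_reducedF hq0, G_eq_reducedG hq0 hq hxA hyA hbA hby hbx hxy, hdefect]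
  have := hx.1
  have := hy.ne_zero
  field_simp

theorem zpow_mul_sq_ne_one (hq0 : q ≠ 0) (hx : x ∈ orbitCompl (q ^ 2) {q, -q}) (n : ℤ) :
    (q ^ 4) ^ n * (q ^ 2 * x ^ 2) ≠ 1 := by
  have hX := (mem_orbitCompl_one.1 (mul_sq_mem_orbitCompl (pow_ne_zero 2 hq0) rfl hx)).2 n
  rwa [← pow_mul] at hX

theorem InAnnulus.norm_sq_lt (hq0 : q ≠ 0) (hu : InAnnulus q u) :
    ‖q ^ 4‖ ^ 2 < ‖q ^ 2 * u ^ 2‖ := by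
  have hQ0 := pow_ne_zero 2 hq0
  have hQ := norm_pow_lt_one (hu.lt_norm.trans hu.norm_lt_one) two_ne_zero
  have h4 := norm_sq_lt_norm (pow_ne_zero 2 hQ0) (norm_pow_lt_one hQ two_ne_zero)
  rw [← pow_mul] at h4
  exact h4.trans (pow_mul q 2 2 ▸ hu.inStrip.norm_sq_lt hq0 rfl)

theorem norm_pow_four_sq_lt (hz : ‖q‖ ^ 4 < ‖z‖) : ‖q ^ 4‖ ^ 2 < ‖z ^ 2‖ := by
  rw [norm_pow, norm_pow]
  gcongr

theorem InAnnulus.norm_pow_four_lt (hq0 : q ≠ 0) (hz : InAnnulus q z) : ‖q‖ ^ 4 < ‖z‖ :=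
  (pow_lt_self_of_lt_one₀ (norm_pos_iff.2 hq0) (hz.lt_norm.trans hz.norm_lt_one)
    (by norm_num)).trans hz.lt_norm

theorem InAnnulus.norm_pow_four_lt_sq_mul (hq0 : q ≠ 0) (hz : InAnnulus q z) :
    ‖q‖ ^ 4 < ‖q ^ 2 * z‖ := by
  have := norm_pos_iff.2 hq0
  calc ‖q‖ ^ 4 = ‖q‖ ^ 2 * ‖q‖ ^ 2 := by ring
    _ < ‖q‖ ^ 2 * ‖q‖ := by
        gcongr
        exact norm_sq_lt_norm hq0 (hz.lt_norm.trans hz.norm_lt_one)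
    _ < ‖q ^ 2 * z‖ := by
        rw [norm_mul, norm_pow]
        gcongr
        exact hz.lt_norm

theorem InAnnulus.norm_sq_mul_lt_one (hz : InAnnulus q z) : ‖q ^ 2 * z‖ < 1 := by
  rw [norm_mul]
  exact mul_lt_one_of_nonneg_of_lt_one_left (norm_nonneg _)
    (norm_pow_lt_one (hz.lt_norm.trans hz.norm_lt_one) two_ne_zero) hz.norm_lt_one.le

theorem summable_pairTerm₁ (hq0 : q ≠ 0) (hx : x ∈ orbitCompl (q ^ 2) {q, -q})
    (hy : InAnnulus q y) (hz : ‖q‖ ^ 4 < ‖z‖) (hz1 : ‖z‖ < 1) :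
    Summable fun p : pairIndex => pairTerm₁ q x y z p := by
  refine (summable_subtype_iff_indicator (f := pairTerm₁ q x y z)).2 ?_
  rw [indicator_pairTerm₁ hq0]
  exact summable_pairSum (pow_ne_zero 4 hq0)
    (norm_pow_lt_one (hy.lt_norm.trans hy.norm_lt_one) four_ne_zero)
    (mul_ne_zero (pow_ne_zero 2 hq0) (pow_ne_zero 2 hx.1)) (fun n _ => zpow_mul_sq_ne_one hq0 hx n)
    (hy.norm_sq_lt hq0) (hy.inStrip.norm_mul_sq_lt_one rfl) (norm_pow_four_sq_lt hz)
    (norm_pow_lt_one hz1 two_ne_zero)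

theorem summable_pairTerm₂ (hq0 : q ≠ 0) (hx : x ∈ orbitCompl (q ^ 2) {q, -q})
    (hy : InAnnulus q y) (hz : InAnnulus q z) :
    Summable fun p : pairIndex => pairTerm₂ q x y z p := by
  rw [pairTerm₂_eq hq0]
  exact summable_pairTerm₁ hq0 hx hy (hz.norm_pow_four_lt_sq_mul hq0) hz.norm_sq_mul_lt_one

theorem continuousAt_pairSum_sq (hq0 : q ≠ 0) (hx : x ∈ orbitCompl (q ^ 2) {q, -q})
    (hy : InAnnulus q y) (hz : ‖q‖ ^ 4 < ‖z‖) (hz1 : ‖z‖ < 1) :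
    ContinuousAt (fun p : ℂ × ℂ × ℂ =>
      pairSum (q ^ 4) (q ^ 2 * p.1 ^ 2) (q ^ 2 * p.2.1 ^ 2) (p.2.2 ^ 2)) (x, y, z) :=
  ContinuousAt.comp (g := fun v : ℂ × ℂ × ℂ => pairSum (q ^ 4) v.1 v.2.1 v.2.2)
    (f := fun p : ℂ × ℂ × ℂ => (q ^ 2 * p.1 ^ 2, q ^ 2 * p.2.1 ^ 2, p.2.2 ^ 2))
    (continuousAt_pairSum (pow_ne_zero 4 hq0)
      (norm_pow_lt_one (hy.lt_norm.trans hy.norm_lt_one) four_ne_zero)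
      (mul_ne_zero (pow_ne_zero 2 hq0) (pow_ne_zero 2 hx.1))
      (fun n _ => zpow_mul_sq_ne_one hq0 hx n) (hy.norm_sq_lt hq0)
      (hy.inStrip.norm_mul_sq_lt_one rfl) (norm_pow_four_sq_lt hz)
      (norm_pow_lt_one hz1 two_ne_zero))
    (by fun_prop)

theorem continuousAt_F (hq0 : q ≠ 0) (hx : x ∈ orbitCompl (q ^ 2) {q, -q}) (hy : InAnnulus q y)
    (hz : InAnnulus q z) : ContinuousAt (fun p : ℂ × ℂ × ℂ => F q p.1 p.2.1 p.2.2) (x, y, z) := by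
  have hfst := continuousAt_pairSum_sq hq0 hx hy (hz.norm_pow_four_lt hq0) hz.norm_lt_one
  have hsnd := ContinuousAt.comp (f := fun p : ℂ × ℂ × ℂ => (p.1, p.2.1, q ^ 2 * p.2.2))
    (x := (x, y, z))
    (continuousAt_pairSum_sq hq0 hx hy (hz.norm_pow_four_lt_sq_mul hq0) hz.norm_sq_mul_lt_one)
    (by fun_prop)
  have hz_cont : ContinuousAt (fun p : ℂ × ℂ × ℂ => p.2.2) (x, y, z) := by fun_prop
  have hcoeff : ContinuousAt (fun p : ℂ × ℂ × ℂ => p.1 * p.2.1 * q) (x, y, z) := by fun_prop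
  refine ((hz_cont.mul hfst).add (hcoeff.mul hsnd)).congr (.of_forall fun p => ?_)
  simp only [F_eq_pairSum hq0, Pi.add_apply, Pi.mul_apply, Function.comp_apply, mul_pow, ← pow_mul]

theorem isOpen_setOf_inAnnulus (q : ℂ) : IsOpen {u | InAnnulus q u} := by
  simp only [show {u | InAnnulus q u} = {u | ‖q‖ < ‖u‖} ∩ {u | ‖u‖ < 1} from
    Set.ext fun _ => ⟨fun h => ⟨h.1, h.2⟩, fun h => ⟨h.1, h.2⟩⟩]
  exact (isOpen_lt continuous_const continuous_norm).inter
    (isOpen_lt continuous_norm continuous_const)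

theorem tendsto_G (hq0 : q ≠ 0) (hx : x ∈ orbitCompl (q ^ 2) {q, -q}) (hy : InAnnulus q y)
    (hz : InAnnulus q z) :
    Tendsto (fun p : ℂ × ℂ × ℂ => G q p.1 p.2.1 p.2.2) (𝓝[regularSet q] (x, y, z))
      (𝓝 (F q x y z)) := by
  have hQ := norm_pow_lt_one (hy.lt_norm.trans hy.norm_lt_one) two_ne_zero
  have hnear : ∀ᶠ p : ℂ × ℂ × ℂ in 𝓝 (x, y, z),
      p.1 ∈ orbitCompl (q ^ 2) {q, -q} ∧ InAnnulus q p.2.1 ∧ InAnnulus q p.2.2 := by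
    have hopen := isOpen_setOf_inAnnulus q
    exact ((isOpen_orbitCompl (pow_ne_zero 2 hq0) hQ _).prod (hopen.prod hopen)).mem_nhds
      ⟨hx, hy, hz⟩
  refine ((continuousAt_F hq0 hx hy hz).mono_left nhdsWithin_le_nhds).congr' ?_
  filter_upwards [nhdsWithin_le_nhds hnear, self_mem_nhdsWithin] with p hp hr
  exact F_eq_G hq0 hp.1 hp.2.1 hp.2.2 hr

end DoubleSum

section TripleSum

variable {q Q x y z X w a : ℂ}

/-- The triples of integers of equal sign. -/
def octants : Set (ℤ × ℤ × ℤ) := {p | sg p.1 = sg p.2.1 ∧ sg p.2.1 = sg p.2.2}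

theorem indicator_octants (f : ℤ × ℤ × ℤ → ℂ) (r s t : ℤ) :
    octants.indicator f (r, s, t) = pairWeight (s, t) * (pairWeight (s, r) * f (r, s, t)) := by
  simp only [octants, Set.indicator, Set.mem_ofPred_eq, pairWeight, sg]
  split_ifs <;> simp_all

theorem zpow_mul_le {κ : ℝ} (hκ0 : 0 < κ) (hκ1 : κ ≤ 1) {s t : ℤ} (hst : sg s = sg t) :
    κ ^ (s * t) ≤ κ⁻¹ * (κ ^ (-s).toNat * κ ^ (-t).toNat) := by
  simpa using zpow_mul_min_le hκ0 hκ1 0 hst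

theorem norm_indicator_tripleTerm_le (hQ0 : Q ≠ 0) (hQ : ‖Q‖ ≤ 1) {ρ : ℝ} (hX0 : X ≠ 0)
    (hw0 : w ≠ 0) (ha0 : a ≠ 0) (hX : ‖X‖ ≤ ρ) (hw : ‖w‖ ≤ ρ) (ha : ‖a‖ ≤ ρ)
    (hX' : ‖Q‖ ^ 2 / ‖X‖ ≤ ρ) (hw' : ‖Q‖ ^ 2 / ‖w‖ ≤ ρ) (ha' : ‖Q‖ ^ 2 / ‖a‖ ≤ ρ)
    (p : ℤ × ℤ × ℤ) : ‖octants.indicator (tripleTerm Q X w a) p‖ ≤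
      ‖Q‖⁻¹ ^ 3 * (ρ ^ p.1.natAbs * (ρ ^ p.2.1.natAbs * ρ ^ p.2.2.natAbs)) := by
  obtain ⟨r, s, t⟩ := p
  have hQn := norm_pos_iff.2 hQ0
  have hXn := norm_pos_iff.2 hX0
  have hwn := norm_pos_iff.2 hw0
  have han := norm_pos_iff.2 ha0
  have hρ : 0 < ρ := hXn.trans_le hX
  by_cases hmem : (r, s, t) ∈ octants
  · have ⟨hrs, hst⟩ : sg r = sg s ∧ sg s = sg t := hmem
    rw [Set.indicator_of_mem hmem]
    simp only [tripleTerm, norm_mul, norm_zpow, zpow_add₀ hQn.ne']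
    calc ‖Q‖ ^ (r * s) * ‖Q‖ ^ (r * t) * ‖Q‖ ^ (s * t) * ‖X‖ ^ r * ‖w‖ ^ s * ‖a‖ ^ t
        ≤ ‖Q‖⁻¹ * (‖Q‖ ^ (-r).toNat * ‖Q‖ ^ (-s).toNat) *
          (‖Q‖⁻¹ * (‖Q‖ ^ (-r).toNat * ‖Q‖ ^ (-t).toNat)) *
          (‖Q‖⁻¹ * (‖Q‖ ^ (-s).toNat * ‖Q‖ ^ (-t).toNat)) * ‖X‖ ^ r * ‖w‖ ^ s * ‖a‖ ^ t := by
          gcongr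
          exacts [zpow_mul_le hQn hQ hrs, zpow_mul_le hQn hQ (hrs.trans hst),
            zpow_mul_le hQn hQ hst]
      _ = ‖Q‖⁻¹ ^ 3 * ((‖Q‖ ^ 2) ^ (-r).toNat * ‖X‖ ^ r *
          ((‖Q‖ ^ 2) ^ (-s).toNat * ‖w‖ ^ s * ((‖Q‖ ^ 2) ^ (-t).toNat * ‖a‖ ^ t))) := by ring
      _ ≤ ‖Q‖⁻¹ ^ 3 * (ρ ^ r.natAbs * (ρ ^ s.natAbs * ρ ^ t.natAbs)) := by
          gcongr
          exacts [pow_toNat_mul_zpow_le (by positivity) hXn hX hX' _,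
            pow_toNat_mul_zpow_le (by positivity) hwn hw hw' _,
            pow_toNat_mul_zpow_le (by positivity) han ha ha' _]
  · rw [Set.indicator_of_notMem hmem, norm_zero]
    positivity

theorem summable_indicator_tripleTerm (hQ0 : Q ≠ 0) (hQ : ‖Q‖ ≤ 1) (hX : ‖Q‖ ^ 2 < ‖X‖)
    (hX1 : ‖X‖ < 1) (hw : ‖Q‖ ^ 2 < ‖w‖) (hw1 : ‖w‖ < 1) (ha : ‖Q‖ ^ 2 < ‖a‖) (ha1 : ‖a‖ < 1) :
    Summable (octants.indicator (tripleTerm Q X w a)) := by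
  have hQn : 0 ≤ ‖Q‖ ^ 2 := by positivity
  have hXn := hQn.trans_lt hX
  have hwn := hQn.trans_lt hw
  have han := hQn.trans_lt ha
  set ρ := max (max ‖X‖ (‖Q‖ ^ 2 / ‖X‖)) (max (max ‖w‖ (‖Q‖ ^ 2 / ‖w‖)) (max ‖a‖ (‖Q‖ ^ 2 / ‖a‖)))
    with hρ
  have hρ1 : ρ < 1 := by
    simp only [hρ, max_lt_iff, div_lt_one hXn, div_lt_one hwn, div_lt_one han]
    exact ⟨⟨hX1, hX⟩, ⟨hw1, hw⟩, ha1, ha⟩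
  have hρ0 : 0 ≤ ρ := by positivity
  have hgeom := summable_pow_natAbs hρ0 hρ1
  have hpair : Summable fun p : ℤ × ℤ => ρ ^ p.1.natAbs * ρ ^ p.2.natAbs :=
    hgeom.mul_of_nonneg hgeom (fun _ => by positivity) (fun _ => by positivity)
  refine ((hgeom.mul_of_nonneg hpair (fun _ => by positivity)
    (fun _ => by positivity)).mul_left (‖Q‖⁻¹ ^ 3)).of_norm_bounded ?_
  exact norm_indicator_tripleTerm_le hQ0 hQ (norm_pos_iff.1 hXn) (norm_pos_iff.1 hwn)
    (norm_pos_iff.1 han) (by simp [hρ]) (by simp [hρ]) (by simp [hρ]) (by simp [hρ])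
    (by simp [hρ]) (by simp [hρ])

theorem hasSum_indicator_tripleTerm_fst (hQ0 : Q ≠ 0) (hQ : ‖Q‖ ≤ 1) (hX : ‖Q‖ ^ 2 < ‖X‖)
    (hX1 : ‖X‖ < 1) (s t : ℤ) :
    HasSum (fun r => octants.indicator (tripleTerm Q X w a) (r, s, t))
      (pairWeight (s, t) * pairFrac Q X w a (s, t)) := by
  have hQn := norm_pos_iff.2 hQ0
  by_cases hst : sg s = sg t
  · have hsign := sg_eq_sg_iff.1 hst
    have hnonneg (hs : 0 ≤ s) : ‖Q ^ (s + t) * X‖ < 1 := by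
      rw [norm_mul, norm_zpow]
      exact mul_lt_one_of_nonneg_of_lt_one_right
        (zpow_le_one₀ hQn hQ (add_nonneg hs (hsign.1 hs))) (norm_nonneg X) hX1
    have hneg (hs : s < 0) : 1 < ‖Q ^ (s + t) * X‖ := by
      rw [norm_mul, norm_zpow]
      calc 1 = ‖Q‖ ^ (-2 : ℤ) * ‖Q‖ ^ 2 := by
            rw [zpow_neg, zpow_ofNat, inv_mul_cancel₀ (by positivity)]
        _ < ‖Q‖ ^ (-2 : ℤ) * ‖X‖ := by gcongr
        _ ≤ ‖Q‖ ^ (s + t) * ‖X‖ := by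
            gcongr ?_ * _
            exact zpow_le_zpow_right_of_le_one₀ hQn hQ (by omega)
    rw [pairFrac, div_eq_mul_inv, ← mul_assoc]
    refine ((hasSum_pairWeight_mul_zpow hnonneg hneg).mul_left _).congr_fun fun r => ?_
    rw [indicator_octants, tripleTerm, mul_zpow, ← zpow_mul,
      show r * s + r * t + s * t = s * t + (s + t) * r by ring, zpow_add₀ hQ0]
    ring
  · simpa only [indicator_octants, pairWeight_eq_zero (p := (s, t)) hst, zero_mul] using hasSum_zero

theorem hasSum_indicator_tripleTerm (hQ0 : Q ≠ 0) (hQ : ‖Q‖ ≤ 1) (hX : ‖Q‖ ^ 2 < ‖X‖)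
    (hX1 : ‖X‖ < 1) (hw : ‖Q‖ ^ 2 < ‖w‖) (hw1 : ‖w‖ < 1) (ha : ‖Q‖ ^ 2 < ‖a‖) (ha1 : ‖a‖ < 1) :
    HasSum (octants.indicator (tripleTerm Q X w a)) (pairSum Q X w a) := by
  have hsum := (summable_indicator_tripleTerm hQ0 hQ hX hX1 hw hw1 ha ha1).hasSum
  have hswap := (Equiv.prodComm (ℤ × ℤ) ℤ).hasSum_iff.2 hsum
  have hfst := hswap.prod_fiberwise fun p => hasSum_indicator_tripleTerm_fst hQ0 hQ hX hX1 p.1 p.2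
  rwa [← hfst.tsum_eq] at hsum

/-- The parametrization of the triples with first two entries even and last entry odd. -/
def evenEvenOdd (p : ℤ × ℤ × ℤ) : ℤ × ℤ × ℤ := (2 * p.1, 2 * p.2.1, 2 * p.2.2 + 1)

/-- The parametrization of the triples with first two entries odd and last entry even. -/
def oddOddEven (p : ℤ × ℤ × ℤ) : ℤ × ℤ × ℤ := (2 * p.1 + 1, 2 * p.2.1 + 1, 2 * p.2.2)

theorem evenEvenOdd_injective : Function.Injective evenEvenOdd := by
  rintro ⟨r, s, t⟩ ⟨r', s', t'⟩ h
  simp only [evenEvenOdd, Prod.mk.injEq] at h ⊢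
  omega

theorem oddOddEven_injective : Function.Injective oddOddEven := by
  rintro ⟨r, s, t⟩ ⟨r', s', t'⟩ h
  simp only [oddOddEven, Prod.mk.injEq] at h ⊢
  omega

theorem disjoint_range_evenEvenOdd_range_oddOddEven :
    Disjoint (Set.range evenEvenOdd) (Set.range oddOddEven) := by
  rw [Set.disjoint_left]
  rintro _ ⟨⟨r, s, t⟩, rfl⟩ ⟨⟨r', s', t'⟩, h⟩
  simp only [evenEvenOdd, oddOddEven, Prod.mk.injEq] at h
  omega

theorem tripleIndex_subset_union_range :
    tripleIndex ⊆ Set.range evenEvenOdd ∪ Set.range oddOddEven := by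
  rintro ⟨r, s, t⟩ ⟨-, -, hrs, hst⟩
  simp only [Int.ModEq] at hrs hst
  rcases Int.emod_two_eq_zero_or_one s with hs | hs
  · refine Or.inl ⟨(r / 2, s / 2, t / 2), ?_⟩
    simp only [evenEvenOdd, Prod.mk.injEq]
    omega
  · refine Or.inr ⟨(r / 2, s / 2, t / 2), ?_⟩
    simp only [oddOddEven, Prod.mk.injEq]
    omega

theorem evenEvenOdd_mem_tripleIndex {p : ℤ × ℤ × ℤ} :
    evenEvenOdd p ∈ tripleIndex ↔ p ∈ octants := by
  simp only [evenEvenOdd, tripleIndex, octants, Set.mem_ofPred_eq, Int.ModEq, sg_eq_sg_iff]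
  omega

theorem oddOddEven_mem_tripleIndex {p : ℤ × ℤ × ℤ} :
    oddOddEven p ∈ tripleIndex ↔ p ∈ octants := by
  simp only [oddOddEven, tripleIndex, octants, Set.mem_ofPred_eq, Int.ModEq, sg_eq_sg_iff]
  omega

theorem tripleTerm_evenEvenOdd (hq0 : q ≠ 0) (hz0 : z ≠ 0) (p : ℤ × ℤ × ℤ) :
    tripleTerm q x y z (evenEvenOdd p) =
      z * tripleTerm (q ^ 4) (q ^ 2 * x ^ 2) (q ^ 2 * y ^ 2) (z ^ 2) p := by
  obtain ⟨r, s, t⟩ := p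
  simp only [tripleTerm, evenEvenOdd, mul_zpow, ← zpow_natCast, ← zpow_mul]
  rw [show 2 * r * (2 * s) + 2 * r * (2 * t + 1) + 2 * s * (2 * t + 1) =
    4 * (r * s + r * t + s * t) + 2 * r + 2 * s by ring, zpow_add₀ hq0, zpow_add₀ hq0,
    zpow_add_one₀ hz0]
  push_cast
  ring

theorem tripleTerm_oddOddEven (hq0 : q ≠ 0) (hx0 : x ≠ 0) (hy0 : y ≠ 0) (p : ℤ × ℤ × ℤ) :
    tripleTerm q x y z (oddOddEven p) =
      x * y * q * tripleTerm (q ^ 4) (q ^ 2 * x ^ 2) (q ^ 2 * y ^ 2) ((q ^ 2 * z) ^ 2) p := by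
  obtain ⟨r, s, t⟩ := p
  simp only [tripleTerm, oddOddEven, mul_zpow, ← zpow_natCast, ← zpow_mul]
  rw [show (2 * r + 1) * (2 * s + 1) + (2 * r + 1) * (2 * t) + (2 * s + 1) * (2 * t) =
    4 * (r * s + r * t + s * t) + 2 * r + 2 * s + 4 * t + 1 by ring, zpow_add_one₀ hq0,
    zpow_add₀ hq0, zpow_add₀ hq0, zpow_add₀ hq0, zpow_add_one₀ hx0, zpow_add_one₀ hy0]
  push_cast
  ring

theorem hasSum_octants_sq (hq0 : q ≠ 0) (hx : InAnnulus q x) (hy : InAnnulus q y)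
    (hz : ‖q‖ ^ 4 < ‖z‖) (hz1 : ‖z‖ < 1) :
    HasSum (octants.indicator (tripleTerm (q ^ 4) (q ^ 2 * x ^ 2) (q ^ 2 * y ^ 2) (z ^ 2)))
      (pairSum (q ^ 4) (q ^ 2 * x ^ 2) (q ^ 2 * y ^ 2) (z ^ 2)) :=
  hasSum_indicator_tripleTerm (pow_ne_zero 4 hq0)
    (norm_pow_lt_one (hx.lt_norm.trans hx.norm_lt_one) four_ne_zero).le (hx.norm_sq_lt hq0)
    (hx.inStrip.norm_mul_sq_lt_one rfl) (hy.norm_sq_lt hq0) (hy.inStrip.norm_mul_sq_lt_one rfl)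
    (norm_pow_four_sq_lt hz) (norm_pow_lt_one hz1 two_ne_zero)

theorem hasSum_tripleTerm (hq0 : q ≠ 0) (hx : InAnnulus q x) (hy : InAnnulus q y)
    (hz : InAnnulus q z) : HasSum (fun p : tripleIndex => tripleTerm q x y z p) (F q x y z) := by
  have heven : HasSum (tripleIndex.indicator (tripleTerm q x y z) ∘ evenEvenOdd)
      (z * pairSum (q ^ 4) (q ^ 2 * x ^ 2) (q ^ 2 * y ^ 2) (z ^ 2)) := by
    refine ((hasSum_octants_sq hq0 hx hy (hz.norm_pow_four_lt hq0)
      hz.norm_lt_one).mul_left z).congr_fun fun p => ?_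
    simp only [Function.comp_apply, Set.indicator, tripleTerm_evenEvenOdd hq0 hz.ne_zero,
      mul_ite, mul_zero]
    classical exact if_congr evenEvenOdd_mem_tripleIndex rfl rfl
  have hodd : HasSum (tripleIndex.indicator (tripleTerm q x y z) ∘ oddOddEven)
      (x * y * q * pairSum (q ^ 4) (q ^ 2 * x ^ 2) (q ^ 2 * y ^ 2) ((q ^ 2 * z) ^ 2)) := by
    refine ((hasSum_octants_sq hq0 hx hy (hz.norm_pow_four_lt_sq_mul hq0)
      hz.norm_sq_mul_lt_one).mul_left (x * y * q)).congr_fun fun p => ?_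
    simp only [Function.comp_apply, Set.indicator, tripleTerm_oddOddEven hq0 hx.ne_zero hy.ne_zero,
      mul_ite, mul_zero]
    classical exact if_congr oddOddEven_mem_tripleIndex rfl rfl
  have hunion := HasSum.add_disjoint (f := tripleIndex.indicator (tripleTerm q x y z))
    disjoint_range_evenEvenOdd_range_oddOddEven (evenEvenOdd_injective.hasSum_range_iff.2 heven)
    (oddOddEven_injective.hasSum_range_iff.2 hodd)
  rw [F_eq_pairSum hq0, show q ^ 4 * z ^ 2 = (q ^ 2 * z) ^ 2 by ring]
  exact hasSum_subtype_iff_indicator.2 ((hasSum_subtype_iff_of_support_subset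
    (Set.support_indicator_subset.trans tripleIndex_subset_union_range)).1 hunion)

theorem exponent_mem_Ioo_of_norm_eq_zpow (hq0 : q ≠ 0) (hq : ‖q‖ < 1) {c : ℝ} {k m : ℤ}
    (hc : ‖q‖ ^ m < c) (hc1 : c < 1) (h : c = ‖q‖ ^ k) : k ∈ Set.Ioo 0 m := by
  have hqn := norm_pos_iff.2 hq0
  rw [h] at hc hc1
  rw [← zpow_zero ‖q‖] at hc1
  exact ⟨(zpow_lt_zpow_iff_right_of_lt_one₀ hqn hq).1 hc1,
    (zpow_lt_zpow_iff_right_of_lt_one₀ hqn hq).1 hc⟩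

theorem InAnnulus.norm_ne_zpow (hq0 : q ≠ 0) (hx : InAnnulus q x) (k : ℤ) : ‖x‖ ≠ ‖q‖ ^ k := by
  intro h
  obtain ⟨hk, hk1⟩ := exponent_mem_Ioo_of_norm_eq_zpow (m := 1) hq0
    (hx.lt_norm.trans hx.norm_lt_one) (by simpa using hx.lt_norm) hx.norm_lt_one h
  omega

theorem InAnnulus.eq_one_of_mul_eq_neg_zpow (hq0 : q ≠ 0) (hx : InAnnulus q x) (hy : InAnnulus q y)
    {k : ℤ} (h : x * y = -q ^ k) : k = 1 := by
  have hlt : ‖q‖ ^ (2 : ℤ) < ‖x‖ * ‖y‖ := by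
    rw [zpow_ofNat, pow_two]
    exact mul_lt_mul'' hx.lt_norm hy.lt_norm (norm_nonneg q) (norm_nonneg q)
  obtain ⟨hk, hk2⟩ := exponent_mem_Ioo_of_norm_eq_zpow hq0 (hx.lt_norm.trans hx.norm_lt_one) hlt
    (mul_lt_one_of_nonneg_of_lt_one_left (norm_nonneg x) hx.norm_lt_one hy.norm_lt_one.le)
    (by rw [← norm_mul, h, norm_neg, norm_zpow])
  omega

theorem InAnnulus.mem_orbitCompl_odd (hq0 : q ≠ 0) (hx : InAnnulus q x) :
    x ∈ orbitCompl (q ^ 2) {q, -q} :=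
  orbitCompl_anti (by simp)
    (hx.inStrip.mem_orbitCompl hq0 (hx.lt_norm.trans hx.norm_lt_one) rfl)

theorem mem_regularSet (hq0 : q ≠ 0) (hx : InAnnulus q x) (hy : InAnnulus q y)
    (hz : InAnnulus q z) (hyz : y * z ≠ -q) (hxz : x * z ≠ -q) : (x, y, z) ∈ regularSet q := by
  refine fun n => ⟨fun h => hx.norm_ne_zpow hq0 (2 * n) (norm_zpow q _ ▸ congrArg norm h),
    fun h => hyz ?_, fun h => hxz ?_, fun h => ?_⟩
  · rw [h, hy.eq_one_of_mul_eq_neg_zpow hq0 hz h, zpow_one]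
  · rw [h, hx.eq_one_of_mul_eq_neg_zpow hq0 hz h, zpow_one]
  · have := hx.eq_one_of_mul_eq_neg_zpow hq0 hy h
    omega

end TripleSum

end KroneckerTriple

end

open KroneckerTriple in
theorem theorem3 (q y z : ℂ) (hq0 : q ≠ 0) (hq1 : ‖q‖ < 1)
    (hqy : ‖q‖ < ‖y‖) (hy1 : ‖y‖ < 1) (hqz : ‖q‖ < ‖z‖) (hz1 : ‖z‖ < 1) :
    (∀ x : ℂ, ‖q‖ < ‖x‖ → ‖x‖ < 1 →
      Summable (fun p : tripleIndex => tripleTerm q x y z p) ∧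
      (y * z ≠ -q → x * z ≠ -q → tripleSum q x y z = G q x y z) ∧
      Tendsto (fun p : ℂ × ℂ × ℂ => G q p.1 p.2.1 p.2.2)
        (𝓝[regularSet q] (x, y, z)) (𝓝 (tripleSum q x y z))) ∧
    (∀ x : ℂ, x ≠ 0 → (∀ n : ℤ, x ≠ q ^ (2 * n + 1) ∧ x ≠ -q ^ (2 * n + 1)) →
      Summable (fun p : pairIndex => pairTerm₁ q x y z p) ∧
      Summable (fun p : pairIndex => pairTerm₂ q x y z p) ∧
      ((x, y, z) ∈ regularSet q → F q x y z = G q x y z) ∧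
      Tendsto (fun p : ℂ × ℂ × ℂ => G q p.1 p.2.1 p.2.2)
        (𝓝[regularSet q] (x, y, z)) (𝓝 (F q x y z))) := by
  have hy : InAnnulus q y := ⟨hqy, hy1⟩
  have hz : InAnnulus q z := ⟨hqz, hz1⟩
  refine ⟨fun x hqx hx1 => ?_, fun x hx0 hx => ?_⟩
  · have hx : InAnnulus q x := ⟨hqx, hx1⟩
    have hsum := hasSum_tripleTerm hq0 hx hy hz
    have hxA := hx.mem_orbitCompl_odd hq0
    rw [tripleSum, hsum.tsum_eq]
    exact ⟨hsum.summable,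
      fun hyz hxz => F_eq_G hq0 hxA hy hz (mem_regularSet hq0 hx hy hz hyz hxz),
      tendsto_G hq0 hxA hy hz⟩
  · have hxA := (mem_orbitCompl_odd_iff hq0).2 ⟨hx0, hx⟩
    exact ⟨summable_pairTerm₁ hq0 hxA hy (hz.norm_pow_four_lt hq0) hz1,
      summable_pairTerm₂ hq0 hxA hy hz, F_eq_G hq0 hxA hy hz, tendsto_G hq0 hxA hy hz⟩
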